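/- **Setting.** A power network has finitely many buses, each a generator bus ($i\in G$), a load bus with nonzero load ($i\in L$) or an uncontrolled bus ($i\in Z$), and an undirected graph of lines with neighbour sets $N_i$ and symmetric stiffnesses $t_{ij}=t_{ji}>0$. Put $\tau_i=\sum_{j\in N_i}t_{ij}$, $P_{ij}=t_{ij}(\theta_i-\theta_j)$ with real-valued angles, and, for set points $w^*,\theta_i^{**}$, $\theta_i^*(t)=2\pi w^*t+\theta_i^{**}$ and $F_i^*=\sum_{j\in N_i}t_{ij}(\theta_i^{**}-\theta_j^{**})$. With $m_i,T_{CH_i},T_{G_i},R_i>0$ and real $D_i,b_i,c_i$, the dynamics are $$\dot\theta_i=2\pi w_i,\qquad \dot w_i=-\tfrac1{m_i}\Big(D_iw_i+\sum_{j\in N_i}P_{ij}-P_{M_i}+P^E_{L_i}+P^{IE}_{L_i}-P_{ren_i}\Big),\qquad \dot P^E_{L_i}=b_i+c_iP^E_{L_i}-\lambda_i,$$ $$\dot P_{M_i}=-\tfrac1{T_{CH_i}}(P_{M_i}-P_{v_i}),\qquad \dot P_{v_i}=-\tfrac1{T_{G_i}}\big(P_{v_i}+\tfrac1{R_i}w_i-P_{ref_i}\big)$$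 for $i\in G$; for $i\in L$ there are no $P_{M_i},P_{v_i}$ (put $P_{M_i}=0$); for $i\in Z$ there are only $\theta_i,w_i$ (put $P_{M_i}=P^E_{L_i}=P^{IE}_{L_i}=P_{ren_i}=0$). The known inelastic demands $P^{IE}_{L_i}$ are twice differentiable. The wind powers are $P_{ren_i}=P^L_i+P^M_i$, $P^L_i=\Psi_{i,1}\chi_i$, $P^M_i=\Psi_{i,2}\chi_i$, $\dot\chi_i=\Phi_i\chi_i$, $\chi_i(t)\in\mathbb R^{2\ell}$, $\ell=\ell^L+\ell^M$, where $\Phi_i$ is block diagonal with blocks $\begin{pmatrix}0&1\\-\rho_{i,l}^2&0\end{pmatrix}$, the frequencies $\rho_{i,l}$ are known, $\chi_i$ is not measured, $\Psi_i=\Psi_{i,1}+\Psi_{i,2}$, $\Psi_{i,1}$ is supported on the first $2\ell^L$ and $\Psi_{i,2}$ on the last $2\ell^M$ coordinates, and $(\Psi_i,\Phi_i)$ is observable. **Internal model.** For $i\in G\cup L$ let $M_i$ be Hurwitz, $(M_i,N_i)$ controllable, and let $T_i$ solve $T_i\Phi_i-M_iT_i=N_i\Psi_i$. The internal model is $\dot\eta_i=M_i\eta_i+N_i(-P_{M_i}+P^E_{L_i}+P^{IE}_{L_i}+F_i^*+D_iw^*)$,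 with $P_{M_i}=0$ for $i\in L$. **Manifolds.** $\theta_i^*(t)$ and $w^*$ at all buses, $\vartheta_i=T_i\chi_i$ for $\eta_i$. For $i\in G$: $P_{M_i}^*=P^{IE}_{L_i}-P^L_i+D_iw^*+F_i^*$, $P_{v_i}^*=T_{CH_i}\dot P_{M_i}^*+P_{M_i}^*$, $P^{E*}_{L_i}=P^M_i$, $P_{ref_i}^*=T_{G_i}\dot P_{v_i}^*+P_{v_i}^*+\frac{w^*}{R_i}$, $\lambda_i^*=-\dot P^M_i+c_iP^M_i+b_i$. For $i\in L$: $P^{E*}_{L_i}=P_{ren_i}-P^{IE}_{L_i}-D_iw^*-F_i^*$ and $\lambda_i^*=-\dot P^{E*}_{L_i}+b_i+c_iP^{E*}_{L_i}$. Assume $D_iw^*+F_i^*=0$ for all $i\in Z$. **Transformation and controllers.** A bar denotes a manifold in which $P^L_i,P^M_i$ are replaced by the estimates $\Psi_{i,1}T_i^{-1}\eta_i,\ \Psi_{i,2}T_i^{-1}\eta_i$ and their time derivatives by the time derivatives of these estimates along the closed loop (which are functions of the local state). Let all gains $k_{i,l}$ be positive and $e_1=\tau_i-\frac{k_{i,1}}{2\pi}(D_i-m_i\Psi_iT_i^{-1}N_i-m_ik_{i,1})$,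 $e_2=D_i-m_i\Psi_iT_i^{-1}N_i-m_ik_{i,1}-m_ik_{i,2}$, $v_1=e_1(1-T_{CH_i}k_{i,1})$, $v_2=2\pi T_{CH_i}e_1+e_2-T_{CH_i}k_{i,2}e_2$, $v_3=1+\frac{e_2}{m_i}T_{CH_i}-T_{CH_i}k_{i,3}$ (index $i$ omitted). Put $$\hat x_{i,1}=\theta_i-\theta_i^*,\qquad \hat x_{i,2}=w_i-w^*+\tfrac{k_{i,1}}{2\pi}\hat x_{i,1},\qquad \hat x_{i,6}=\eta_i-\vartheta_i+m_iN_i\big(\hat x_{i,2}-\tfrac{k_{i,1}}{2\pi}\hat x_{i,1}\big),$$ for $i\in G$: $\hat x_{i,3}=P_{M_i}-\bar P_{M_i}-e_1\hat x_{i,1}-e_2\hat x_{i,2}$, $\hat x_{i,4}=P_{v_i}-\bar P_{v_i}-v_1\hat x_{i,1}-v_2\hat x_{i,2}-v_3\hat x_{i,3}$, $\hat x_{i,5}=P^E_{L_i}-\bar P^E_{L_i}$; for $i\in L$: $\hat x_{i,3}=P^E_{L_i}-\bar P^E_{L_i}+e_1\hat x_{i,1}+e_2\hat x_{i,2}$;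 for $i\in Z$: $\hat x_i=(\theta_i-\theta_i^*,w_i-w^*)$. The controllers are, for $i\in G$, $$\begin{aligned}P_{ref_i}={}&\bar P_{ref_i}+\big(v_1-\tfrac{k_{i,1}}{2\pi R_i}-T_{G_i}k_{i,1}v_1\big)\hat x_{i,1}+\big(v_2+\tfrac1{R_i}+2\pi T_{G_i}v_1-T_{G_i}k_{i,2}v_2\big)\hat x_{i,2}\\&+\big(v_3+\tfrac{T_{G_i}}{m_i}v_2-T_{G_i}k_{i,3}v_3\big)\hat x_{i,3}+\big(1-T_{G_i}k_{i,4}+\tfrac{T_{G_i}}{T_{CH_i}}v_3\big)\hat x_{i,4},\end{aligned}$$ $\lambda_i=\bar\lambda_i+(c_i+k_{i,5})\hat x_{i,5}$, and for $i\in L$, $\lambda_i=\bar\lambda_i-e_1(c_i+k_{i,1})\hat x_{i,1}+(2\pi e_1-e_2(c_i+k_{i,2}))\hat x_{i,2}+(c_i+k_{i,3}-\frac{e_2}{m_i})\hat x_{i,3}$. **Theorem.** 1. For each $i\in G\cup L$ the equation $T_i\Phi_i-M_iT_i=N_i\Psi_i$ has exactly one solution, and it is nonsingular. The transformed state $\hat{\mathbf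 x}$ of the whole network satisfies $\dot{\hat{\mathbf x}}=\mathbf A\hat{\mathbf x}$ along every closed-loop trajectory, where $\mathbf A$ is an explicit constant matrix. 2. The matrix $\mathbf A$ is Hurwitz if and only if all states, internal model states and inputs converge globally and exponentially to their manifolds: there are $C,\alpha>0$ such that for every initial time $t_0$, every initial state and all $t\ge t_0$, with $\mathbf x$ the vector of all states and internal model states, $\mathbf u$ the vector of inputs, and $\mathbf x^*,\mathbf u^*$ their manifolds, $$\|\mathbf x(t)-\mathbf x^*(t)\|\le Ce^{-\alpha(t-t_0)}\|\mathbf x(t_0)-\mathbf x^*(t_0)\|,\qquad \|\mathbf u(t)-\mathbf u^*(t)\|\le Ce^{-\alpha(t-t_0)}\|\mathbf x(t_0)-\mathbf x^*(t_0)\|.$$ This equivalence holds for each fixed choice of the trajectories $\chi_i$ and demands $P^{IE}_{L_i}$, and also with $C,\alpha$ required to be uniform over all such choices. 3. Gains and internal models that make $\mathbf A$ Hurwitz always exist if $D_i>\tau_i$ for every $i\in Z$ and every bus in $Z$ is connected in the graph to some bus in $G\cup L$. Moreover they can be chosen from local information only: for given $\ell^L,\ell^M$ there are rules, one for generator buses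 and one for load buses, that compute $k_{i,l}>0$, a Hurwitz $M_i$ and an $N_i$ with $(M_i,N_i)$ controllable from the parameters of bus $i$ ($m_i,D_i,b_i,c_i,\Psi_i,\rho_{i,l}$ and, for $i\in G$, $T_{CH_i},T_{G_i},R_i$) and from $\tau_i$ alone, such that $\mathbf A$ is Hurwitz for every such network. -/

import Mathlib

open scoped Matrix

noncomputable section

namespace PowerNet

/-! ### Linear systems -/

/-- A real square matrix is Hurwitz if all its (complex) eigenvalues have negative real part. -/
def IsHurwitz {ι : Type} [Fintype ι] (A : Matrix ι ι ℝ) : Prop :=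
  ∀ (z : ℂ) (v : ι → ℂ), v ≠ 0 → (A.map (algebraMap ℝ ℂ)) *ᵥ v = z • v → z.re < 0

/-- Controllability of `(M, N)`: the vectors `N, M N, M² N, …` span the space. -/
def IsControllable {ι : Type} [Fintype ι] [DecidableEq ι] (M : Matrix ι ι ℝ) (N : ι → ℝ) : Prop :=
  Submodule.span ℝ (Set.range fun k : ℕ => (M ^ k) *ᵥ N) = ⊤

/-- Observability of `(Ψ, Φ)`: only the zero state has outputs `Ψ Φ^k v` that all vanish. -/
def IsObservable {ι : Type} [Fintype ι] [DecidableEq ι] (Ψ : ι → ℝ) (Φ : Matrix ι ι ℝ) : Prop :=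
  ∀ v : ι → ℝ, (∀ k : ℕ, Ψ ⬝ᵥ ((Φ ^ k) *ᵥ v) = 0) → v = 0

/-! ### Wind power exosystem -/

/-- Index set of the exosystem state in `ℝ^{2ℓ}`, `ℓ = ℓL + ℓM`: one pair `(χ_l, dχ_l/dt)` for each
low (`Fin ℓL`) or medium (`Fin ℓM`) frequency. -/
abbrev Exo (ℓL ℓM : ℕ) : Type := (Fin ℓL ⊕ Fin ℓM) × Fin 2

/-- Frequencies and output row of the wind power exosystem `dχ/dt = Φ χ`, `P_ren = Ψ χ`. -/
structure Wind (ℓL ℓM : ℕ) where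
  ρ : Fin ℓL ⊕ Fin ℓM → ℝ
  Ψ : Exo ℓL ℓM → ℝ

/-- Block diagonal matrix with the blocks `[0, 1; -ρ_l², 0]`. -/
def Wind.Φ {ℓL ℓM : ℕ} (W : Wind ℓL ℓM) : Matrix (Exo ℓL ℓM) (Exo ℓL ℓM) ℝ :=
  Matrix.of fun p q => if p.1 = q.1 then !![0, 1; -(W.ρ p.1) ^ 2, 0] p.2 q.2 else 0

/-- `Ψ₁ = [Ψ^L, 0]`, the row that outputs the low frequency part. -/
def Wind.Ψ₁ {ℓL ℓM : ℕ} (W : Wind ℓL ℓM) : Exo ℓL ℓM → ℝ :=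
  fun p => if p.1.isLeft then W.Ψ p else 0

/-- `Ψ₂ = [0, Ψ^M]`, the row that outputs the medium frequency part. -/
def Wind.Ψ₂ {ℓL ℓM : ℕ} (W : Wind ℓL ℓM) : Exo ℓL ℓM → ℝ :=
  fun p => if p.1.isLeft then 0 else W.Ψ p

/-- The matrices `(M, N)` of a local internal model. -/
structure IntModel (ℓL ℓM : ℕ) where
  M : Matrix (Exo ℓL ℓM) (Exo ℓL ℓM) ℝ
  N : Exo ℓL ℓM → ℝ

/-- The Sylvester equation `T Φ - M T = N Ψ`. -/
def IsSylvester {ℓL ℓM : ℕ} (W : Wind ℓL ℓM) (I : IntModel ℓL ℓM)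
    (T : Matrix (Exo ℓL ℓM) (Exo ℓL ℓM) ℝ) : Prop :=
  T * W.Φ - I.M * T = Matrix.vecMulVec I.N W.Ψ

open Classical in
/-- The solution `T*` of the Sylvester equation. -/
def sylv {ℓL ℓM : ℕ} (W : Wind ℓL ℓM) (I : IntModel ℓL ℓM) :
    Matrix (Exo ℓL ℓM) (Exo ℓL ℓM) ℝ :=
  if h : ∃ T, IsSylvester W I T then h.choose else 0

/-- The row `r (T*)⁻¹`; applied to `η` it estimates the signal `r χ`. It is used for `r = Ψ, Ψ₁, Ψ₂`. -/
def estRow {ℓL ℓM : ℕ} (W : Wind ℓL ℓM) (I : IntModel ℓL ℓM) (r : Exo ℓL ℓM → ℝ) :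
    Exo ℓL ℓM → ℝ :=
  r ᵥ* (sylv W I)⁻¹

/-! ### Local data of the buses -/

/-- Local parameters of a generator bus. -/
structure GenParams (ℓL ℓM : ℕ) where
  (m D TCH TG R b c : ℝ)
  wind : Wind ℓL ℓM
  m_pos : 0 < m
  TCH_pos : 0 < TCH
  TG_pos : 0 < TG
  R_pos : 0 < R

/-- Local parameters of a load bus with nonzero load. -/
structure LoadParams (ℓL ℓM : ℕ) where
  (m D b c : ℝ)
  wind : Wind ℓL ℓM
  m_pos : 0 < m

/-- Local parameters of an uncontrolled bus (load bus with zero load). -/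
structure ZeroParams where
  (m D : ℝ)
  m_pos : 0 < m

/-- Control gains `k_1, …, k_5` (indexed from `0`) and internal model of a generator bus. -/
structure GenDesign (ℓL ℓM : ℕ) where
  k : Fin 5 → ℝ
  im : IntModel ℓL ℓM

/-- Control gains `k_1, k_2, k_3` (indexed from `0`) and internal model of a load bus. -/
structure LoadDesign (ℓL ℓM : ℕ) where
  k : Fin 3 → ℝ
  im : IntModel ℓL ℓM

def GenDesign.Admissible {ℓL ℓM : ℕ} (d : GenDesign ℓL ℓM) : Prop :=
  (∀ l, 0 < d.k l) ∧ IsHurwitz d.im.M ∧ IsControllable d.im.M d.im.N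

def LoadDesign.Admissible {ℓL ℓM : ℕ} (d : LoadDesign ℓL ℓM) : Prop :=
  (∀ l, 0 < d.k l) ∧ IsHurwitz d.im.M ∧ IsControllable d.im.M d.im.N

/-! ### Generator bus

The local state is indexed by `Fin 5 ⊕ Exo`: the entries `inl 0, …, inl 4` are
`θ, w, P_M, P_v, P_L^E` and the entries `inr _` are the internal model state `η`.
The input is `![P_ref, λ]`. Below `τ` is `∑_j t_ij`, `F` is `∑_j P_ij`, `Fs` is `∑_j P_ij^*`,
`ws` is `w^*`, and `pie, pie', pie''` are the inelastic demand and its derivatives. -/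

abbrev GenState (ℓL ℓM : ℕ) : Type := Fin 5 ⊕ Exo ℓL ℓM → ℝ

section Gen

variable {ℓL ℓM : ℕ}

/-- The signal that drives the internal model. -/
def genDrive (p : GenParams ℓL ℓM) (Fs ws pie : ℝ) (x : GenState ℓL ℓM) : ℝ :=
  -x (.inl 2) + x (.inl 4) + pie + Fs + p.D * ws

/-- Right-hand side of the internal model. -/
def genEtaDot (p : GenParams ℓL ℓM) (I : IntModel ℓL ℓM) (Fs ws pie : ℝ) (x : GenState ℓL ℓM) :
    Exo ℓL ℓM → ℝ :=
  I.M *ᵥ (fun e => x (.inr e)) + genDrive p Fs ws pie x • I.N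

/-- Right-hand side of the generator, demand and internal model dynamics with input `u`. -/
def genRhs (p : GenParams ℓL ℓM) (I : IntModel ℓL ℓM) (F Fs ws pie pren : ℝ) (u : Fin 2 → ℝ)
    (x : GenState ℓL ℓM) : GenState ℓL ℓM :=
  Sum.elim
    ![2 * Real.pi * x (.inl 1),
      -(1 / p.m) * (p.D * x (.inl 1) + F - x (.inl 2) + (x (.inl 4) + pie) - pren),
      -(1 / p.TCH) * (x (.inl 2) - x (.inl 3)),
      -(1 / p.TG) * (x (.inl 3) + 1 / p.R * x (.inl 1) - u 0),
      p.b + p.c * x (.inl 4) - u 1]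
    (genEtaDot p I Fs ws pie x)

/-- The manifolds of `θ, w, P_M, P_v, P_L^E`, as a function of the low frequency wind power `pL`,
its derivative `pL'` and the medium frequency wind power `pM`. -/
def genManifold (p : GenParams ℓL ℓM) (θs ws Fs pie pie' pL pL' pM : ℝ) : Fin 5 → ℝ :=
  ![θs, ws, pie - pL + p.D * ws + Fs, p.TCH * (pie' - pL') + pie - pL + p.D * ws + Fs, pM]

/-- The manifold of `P_ref`. -/
def genRefManifold (p : GenParams ℓL ℓM) (ws Fs pie pie' pie'' pL pL' pL'' : ℝ) : ℝ :=
  p.TG * p.TCH * (pie'' - pL'') + (p.TG + p.TCH) * (pie' - pL') + pie - pL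
    + (p.D + 1 / p.R) * ws + Fs

/-- The manifold of the price `λ`. -/
def genPriceManifold (p : GenParams ℓL ℓM) (pM pM' : ℝ) : ℝ := -pM' + p.c * pM + p.b

/-- The coefficients `e_{M,1}, e_{M,2}, e_{v,1}, e_{v,2}, e_{v,3}` of the transformation. -/
def genM1 (p : GenParams ℓL ℓM) (d : GenDesign ℓL ℓM) (τ : ℝ) : ℝ :=
  τ - d.k 0 / (2 * Real.pi) *
    (p.D - p.m * (estRow p.wind d.im p.wind.Ψ ⬝ᵥ d.im.N) - p.m * d.k 0)

def genM2 (p : GenParams ℓL ℓM) (d : GenDesign ℓL ℓM) : ℝ :=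
  p.D - p.m * (estRow p.wind d.im p.wind.Ψ ⬝ᵥ d.im.N) - p.m * d.k 0 - p.m * d.k 1

def genV1 (p : GenParams ℓL ℓM) (d : GenDesign ℓL ℓM) (τ : ℝ) : ℝ :=
  genM1 p d τ * (1 - p.TCH * d.k 0)

def genV2 (p : GenParams ℓL ℓM) (d : GenDesign ℓL ℓM) (τ : ℝ) : ℝ :=
  2 * Real.pi * p.TCH * genM1 p d τ + genM2 p d - p.TCH * d.k 1 * genM2 p d

def genV3 (p : GenParams ℓL ℓM) (d : GenDesign ℓL ℓM) : ℝ :=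
  1 + genM2 p d / p.m * p.TCH - p.TCH * d.k 2

/-- The transformed states `x̂_1, …, x̂_5`. The wind power in the manifold is replaced by its estimate
`Ψ_j (T*)⁻¹ η`, and the derivative of the wind power by the time derivative of this estimate, which
is `Ψ_j (T*)⁻¹ (dη/dt)`. -/
def genHat (p : GenParams ℓL ℓM) (d : GenDesign ℓL ℓM) (τ θs ws Fs pie pie' : ℝ)
    (x : GenState ℓL ℓM) : Fin 5 → ℝ :=
  let r₁ := estRow p.wind d.im p.wind.Ψ₁
  let r₂ := estRow p.wind d.im p.wind.Ψ₂
  let η : Exo ℓL ℓM → ℝ := fun e => x (.inr e)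
  let η' := genEtaDot p d.im Fs ws pie x
  let μ := genManifold p θs ws Fs pie pie' (r₁ ⬝ᵥ η) (r₁ ⬝ᵥ η') (r₂ ⬝ᵥ η)
  let y1 := x (.inl 0) - μ 0
  let y2 := x (.inl 1) - μ 1 - (-(d.k 0 / (2 * Real.pi)) * y1)
  let y3 := x (.inl 2) - μ 2 - (genM1 p d τ * y1 + genM2 p d * y2)
  let y4 := x (.inl 3) - μ 3 - (genV1 p d τ * y1 + genV2 p d τ * y2 + genV3 p d * y3)
  let y5 := x (.inl 4) - μ 4
  ![y1, y2, y3, y4, y5]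

/-- All transformed states of the bus; `ϑ = T* χ` is the manifold of `η`. -/
def genHatFull (p : GenParams ℓL ℓM) (d : GenDesign ℓL ℓM) (τ θs ws Fs pie pie' : ℝ)
    (ϑ : Exo ℓL ℓM → ℝ) (x : GenState ℓL ℓM) : GenState ℓL ℓM :=
  let y := genHat p d τ θs ws Fs pie pie' x
  Sum.elim y (fun e => x (.inr e) - ϑ e
    - (-(p.m * d.im.N e * (y 1 - d.k 0 / (2 * Real.pi) * y 0))))

/-- The controller of the bus, a feedback of the local state. The first and second derivatives of
the wind power in the input manifolds are replaced by the time derivatives of the estimates,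
evaluated with the dynamics of the internal model, of `P_M` and of `P_L^E`. -/
def genControl (p : GenParams ℓL ℓM) (d : GenDesign ℓL ℓM) (τ θs ws Fs pie pie' pie'' : ℝ)
    (x : GenState ℓL ℓM) : Fin 2 → ℝ :=
  let r₁ := estRow p.wind d.im p.wind.Ψ₁
  let r₂ := estRow p.wind d.im p.wind.Ψ₂
  let y := genHat p d τ θs ws Fs pie pie' x
  let η : Exo ℓL ℓM → ℝ := fun e => x (.inr e)
  let η' := genEtaDot p d.im Fs ws pie x
  let price := genPriceManifold p (r₂ ⬝ᵥ η) (r₂ ⬝ᵥ η') + (p.c + d.k 4) * y 4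
  let drive' := -(-(1 / p.TCH) * (x (.inl 2) - x (.inl 3)))
    + (p.b + p.c * x (.inl 4) - price) + pie'
  let η'' := d.im.M *ᵥ η' + drive' • d.im.N
  let ref := genRefManifold p ws Fs pie pie' pie'' (r₁ ⬝ᵥ η) (r₁ ⬝ᵥ η') (r₁ ⬝ᵥ η'')
    + (genV1 p d τ - d.k 0 / (2 * Real.pi * p.R) - p.TG * d.k 0 * genV1 p d τ) * y 0
    + (genV2 p d τ + 1 / p.R + 2 * Real.pi * p.TG * genV1 p d τ
        - p.TG * d.k 1 * genV2 p d τ) * y 1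
    + (genV3 p d + p.TG / p.m * genV2 p d τ - p.TG * d.k 2 * genV3 p d) * y 2
    + (-(p.TG * d.k 3) + 1 + p.TG / p.TCH * genV3 p d) * y 3
  ![ref, price]

/-- The transformed dynamics of the bus; `s` is `∑_j t_ij x̂_{j,1}`. -/
def genHatRhs (p : GenParams ℓL ℓM) (d : GenDesign ℓL ℓM) (τ s : ℝ) (y : GenState ℓL ℓM) :
    GenState ℓL ℓM :=
  let ζ : Exo ℓL ℓM → ℝ := fun e => y (.inr e)
  let v := y (.inl 1) - d.k 0 / (2 * Real.pi) * y (.inl 0)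
  let a := y (.inl 4) + estRow p.wind d.im p.wind.Ψ ⬝ᵥ ζ - s
  Sum.elim
    ![-(d.k 0) * y (.inl 0) + 2 * Real.pi * y (.inl 1),
      -(d.k 1) * y (.inl 1) + 1 / p.m * (y (.inl 2) - a),
      -(d.k 2) * y (.inl 2) + 1 / p.TCH * y (.inl 3) + genM2 p d / p.m * a,
      -(d.k 3) * y (.inl 3) + 1 / p.m * (genV2 p d τ - genM2 p d * genV3 p d) * a,
      -(d.k 4) * y (.inl 4)]
    (d.im.M *ᵥ ζ - (p.m * v) • (d.im.M *ᵥ d.im.N)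
      - (p.D * v + τ * y (.inl 0) - s) • d.im.N)

end Gen

/-! ### Load bus

The entries `inl 0, inl 1, inl 2` of the local state are `θ, w, P_L^E` and the entries `inr _` are
the internal model state `η`; the input is the price `λ`. -/

abbrev LoadState (ℓL ℓM : ℕ) : Type := Fin 3 ⊕ Exo ℓL ℓM → ℝ

section Load

variable {ℓL ℓM : ℕ}

def loadEtaDot (p : LoadParams ℓL ℓM) (I : IntModel ℓL ℓM) (Fs ws pie : ℝ)
    (x : LoadState ℓL ℓM) : Exo ℓL ℓM → ℝ :=
  I.M *ᵥ (fun e => x (.inr e)) + (x (.inl 2) + pie + Fs + p.D * ws) • I.N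

def loadRhs (p : LoadParams ℓL ℓM) (I : IntModel ℓL ℓM) (F Fs ws pie pren : ℝ) (u : ℝ)
    (x : LoadState ℓL ℓM) : LoadState ℓL ℓM :=
  Sum.elim
    ![2 * Real.pi * x (.inl 1),
      -(1 / p.m) * (p.D * x (.inl 1) + F + (x (.inl 2) + pie) - pren),
      p.b + p.c * x (.inl 2) - u]
    (loadEtaDot p I Fs ws pie x)

/-- The manifolds of `θ, w, P_L^E`; `pr` is the total wind power. -/
def loadManifold (p : LoadParams ℓL ℓM) (θs ws Fs pie pr : ℝ) : Fin 3 → ℝ :=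
  ![θs, ws, pr - pie - p.D * ws - Fs]

def loadPriceManifold (p : LoadParams ℓL ℓM) (ws Fs pie pie' pr pr' : ℝ) : ℝ :=
  -pr' + pie' + p.b + p.c * (pr - pie - p.D * ws - Fs)

def loadM1 (p : LoadParams ℓL ℓM) (d : LoadDesign ℓL ℓM) (τ : ℝ) : ℝ :=
  τ - d.k 0 / (2 * Real.pi) *
    (p.D - p.m * (estRow p.wind d.im p.wind.Ψ ⬝ᵥ d.im.N) - p.m * d.k 0)

def loadM2 (p : LoadParams ℓL ℓM) (d : LoadDesign ℓL ℓM) : ℝ :=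
  p.D - p.m * (estRow p.wind d.im p.wind.Ψ ⬝ᵥ d.im.N) - p.m * d.k 0 - p.m * d.k 1

def loadHat (p : LoadParams ℓL ℓM) (d : LoadDesign ℓL ℓM) (τ θs ws Fs pie : ℝ)
    (x : LoadState ℓL ℓM) : Fin 3 → ℝ :=
  let μ := loadManifold p θs ws Fs pie
    (estRow p.wind d.im p.wind.Ψ ⬝ᵥ (fun e => x (.inr e)))
  let y1 := x (.inl 0) - μ 0
  let y2 := x (.inl 1) - μ 1 - (-(d.k 0 / (2 * Real.pi)) * y1)
  let y3 := x (.inl 2) - μ 2 - (-(loadM1 p d τ * y1 + loadM2 p d * y2))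
  ![y1, y2, y3]

def loadHatFull (p : LoadParams ℓL ℓM) (d : LoadDesign ℓL ℓM) (τ θs ws Fs pie : ℝ)
    (ϑ : Exo ℓL ℓM → ℝ) (x : LoadState ℓL ℓM) : LoadState ℓL ℓM :=
  let y := loadHat p d τ θs ws Fs pie x
  Sum.elim y (fun e => x (.inr e) - ϑ e
    - (-(p.m * d.im.N e * (y 1 - d.k 0 / (2 * Real.pi) * y 0))))

def loadControl (p : LoadParams ℓL ℓM) (d : LoadDesign ℓL ℓM) (τ θs ws Fs pie pie' : ℝ)
    (x : LoadState ℓL ℓM) : ℝ :=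
  let r := estRow p.wind d.im p.wind.Ψ
  let y := loadHat p d τ θs ws Fs pie x
  loadPriceManifold p ws Fs pie pie' (r ⬝ᵥ (fun e => x (.inr e)))
      (r ⬝ᵥ loadEtaDot p d.im Fs ws pie x)
    + (-(loadM1 p d τ * (p.c + d.k 0))) * y 0
    + (2 * Real.pi * loadM1 p d τ - loadM2 p d * (p.c + d.k 1)) * y 1
    + (p.c + d.k 2 - loadM2 p d / p.m) * y 2

def loadHatRhs (p : LoadParams ℓL ℓM) (d : LoadDesign ℓL ℓM) (τ s : ℝ) (y : LoadState ℓL ℓM) :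
    LoadState ℓL ℓM :=
  let ζ : Exo ℓL ℓM → ℝ := fun e => y (.inr e)
  let v := y (.inl 1) - d.k 0 / (2 * Real.pi) * y (.inl 0)
  let a := estRow p.wind d.im p.wind.Ψ ⬝ᵥ ζ - s
  Sum.elim
    ![-(d.k 0) * y (.inl 0) + 2 * Real.pi * y (.inl 1),
      -(d.k 1) * y (.inl 1) + 1 / p.m * (-y (.inl 2) - a),
      -(d.k 2) * y (.inl 2) - loadM2 p d / p.m * a]
    (d.im.M *ᵥ ζ - (p.m * v) • (d.im.M *ᵥ d.im.N)
      - (p.D * v + τ * y (.inl 0) - s) • d.im.N)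

end Load

/-! ### Uncontrolled bus, state `![θ, w]` -/

def zeroRhs (p : ZeroParams) (F : ℝ) (x : Fin 2 → ℝ) : Fin 2 → ℝ :=
  ![2 * Real.pi * x 1, -(1 / p.m) * (p.D * x 1 + F)]

def zeroHatRhs (p : ZeroParams) (τ s : ℝ) (y : Fin 2 → ℝ) : Fin 2 → ℝ :=
  ![2 * Real.pi * y 1, -(1 / p.m) * (p.D * y 1 + τ * y 0 - s)]

/-! ### The network -/

/-- A power network with generator buses `G`, load buses `L` and uncontrolled buses `Z`. -/
structure Network (G L Z : Type) (ℓL ℓM : ℕ) where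
  gen : G → GenParams ℓL ℓM
  load : L → LoadParams ℓL ℓM
  zero : Z → ZeroParams
  /-- the transmission lines -/
  graph : SimpleGraph (G ⊕ L ⊕ Z)
  /-- the tie-line stiffness, used only for pairs of neighbours -/
  t : G ⊕ L ⊕ Z → G ⊕ L ⊕ Z → ℝ
  t_symm : ∀ i j, t i j = t j i
  t_pos : ∀ i j, graph.Adj i j → 0 < t i j

/-- Control gains and internal models at all controlled buses. -/
structure Design (G L : Type) (ℓL ℓM : ℕ) where
  gen : G → GenDesign ℓL ℓM
  load : L → LoadDesign ℓL ℓM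

def Design.Admissible {G L : Type} {ℓL ℓM : ℕ} (d : Design G L ℓL ℓM) : Prop :=
  (∀ g, (d.gen g).Admissible) ∧ (∀ l, (d.load l).Admissible)

/-- The set points `w^*` and `θ_i^{**}`. -/
structure SetPoint (G L Z : Type) where
  w : ℝ
  θ : G ⊕ L ⊕ Z → ℝ

/-- Exosystem states and inelastic demands at the generator and load buses. -/
structure Signals (G L : Type) (ℓL ℓM : ℕ) where
  χG : G → ℝ → Exo ℓL ℓM → ℝ
  χL : L → ℝ → Exo ℓL ℓM → ℝ
  pieG : G → ℝ → ℝ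
  pieL : L → ℝ → ℝ

/-- Index set of the state of the whole network. -/
abbrev Idx (G L Z : Type) (ℓL ℓM : ℕ) : Type :=
  (G × (Fin 5 ⊕ Exo ℓL ℓM)) ⊕ (L × (Fin 3 ⊕ Exo ℓL ℓM)) ⊕ (Z × Fin 2)

/-- Index set of the inputs: `P_ref, λ` at generator buses, `λ` at load buses. -/
abbrev InIdx (G L : Type) : Type := (G × Fin 2) ⊕ L

section Net

variable {G L Z : Type} {ℓL ℓM : ℕ}

def genPart (x : Idx G L Z ℓL ℓM → ℝ) (g : G) : GenState ℓL ℓM := fun a => x (.inl (g, a))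

def loadPart (x : Idx G L Z ℓL ℓM → ℝ) (l : L) : LoadState ℓL ℓM := fun a => x (.inr (.inl (l, a)))

def zeroPart (x : Idx G L Z ℓL ℓM → ℝ) (z : Z) : Fin 2 → ℝ := fun a => x (.inr (.inr (z, a)))

/-- Assembles a network state from local states. -/
def assemble (a : G → GenState ℓL ℓM) (b : L → LoadState ℓL ℓM) (c : Z → Fin 2 → ℝ) :
    Idx G L Z ℓL ℓM → ℝ :=
  Sum.elim (fun q => a q.1 q.2) (Sum.elim (fun q => b q.1 q.2) (fun q => c q.1 q.2))

/-- The phase angles (the first local coordinates) of all buses. -/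
def angle (x : Idx G L Z ℓL ℓM → ℝ) : G ⊕ L ⊕ Z → ℝ :=
  Sum.elim (fun g => genPart x g (.inl 0))
    (Sum.elim (fun l => loadPart x l (.inl 0)) (fun z => zeroPart x z 0))

/-- The signals are trajectories of the exosystems and twice differentiable demands. -/
def Signals.Admissible (σ : Signals G L ℓL ℓM) (net : Network G L Z ℓL ℓM) : Prop :=
  (∀ g t, HasDerivAt (σ.χG g) ((net.gen g).wind.Φ *ᵥ σ.χG g t) t) ∧
  (∀ l t, HasDerivAt (σ.χL l) ((net.load l).wind.Φ *ᵥ σ.χL l t) t) ∧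
  (∀ g, Differentiable ℝ (σ.pieG g) ∧ Differentiable ℝ (deriv (σ.pieG g))) ∧
  (∀ l, Differentiable ℝ (σ.pieL l) ∧ Differentiable ℝ (deriv (σ.pieL l)))

variable [Fintype G] [Fintype L] [Fintype Z]

open Classical in
/-- `∑_{j ∈ N_i} t_ij`. -/
def Network.tSum (net : Network G L Z ℓL ℓM) (i : G ⊕ L ⊕ Z) : ℝ :=
  ∑ j with net.graph.Adj i j, net.t i j

open Classical in
/-- `∑_{j ∈ N_i} t_ij θ_j`. -/
def Network.inflow (net : Network G L Z ℓL ℓM) (θ : G ⊕ L ⊕ Z → ℝ) (i : G ⊕ L ⊕ Z) : ℝ :=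
  ∑ j with net.graph.Adj i j, net.t i j * θ j

open Classical in
/-- `∑_{j ∈ N_i} P_ij` with `P_ij = t_ij (θ_i - θ_j)`. -/
def Network.flow (net : Network G L Z ℓL ℓM) (θ : G ⊕ L ⊕ Z → ℝ) (i : G ⊕ L ⊕ Z) : ℝ :=
  ∑ j with net.graph.Adj i j, net.t i j * (θ i - θ j)

/-- Desired phase angle `2π w^* t + θ_i^{**}`. -/
def SetPoint.angle (op : SetPoint G L Z) (i : G ⊕ L ⊕ Z) (t : ℝ) : ℝ :=
  2 * Real.pi * op.w * t + op.θ i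

/-- The distributed controllers, as a function of time and state. -/
def control (net : Network G L Z ℓL ℓM) (op : SetPoint G L Z) (d : Design G L ℓL ℓM)
    (σ : Signals G L ℓL ℓM) (t : ℝ) (x : Idx G L Z ℓL ℓM → ℝ) : InIdx G L → ℝ :=
  Sum.elim
    (fun q => genControl (net.gen q.1) (d.gen q.1) (net.tSum (.inl q.1)) (op.angle (.inl q.1) t)
      op.w (net.flow op.θ (.inl q.1)) (σ.pieG q.1 t) (deriv (σ.pieG q.1) t)
      (deriv (deriv (σ.pieG q.1)) t) (genPart x q.1) q.2)
    (fun l => loadControl (net.load l) (d.load l) (net.tSum (.inr (.inl l)))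
      (op.angle (.inr (.inl l)) t) op.w (net.flow op.θ (.inr (.inl l)))
      (σ.pieL l t) (deriv (σ.pieL l) t) (loadPart x l))

/-- Right-hand side of the network dynamics, internal models included, with inputs `u`. -/
def plantRhs (net : Network G L Z ℓL ℓM) (op : SetPoint G L Z) (d : Design G L ℓL ℓM)
    (σ : Signals G L ℓL ℓM) (t : ℝ) (u : InIdx G L → ℝ) (x : Idx G L Z ℓL ℓM → ℝ) :
    Idx G L Z ℓL ℓM → ℝ :=
  assemble
    (fun g => genRhs (net.gen g) (d.gen g).im (net.flow (angle x) (.inl g))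
      (net.flow op.θ (.inl g)) op.w (σ.pieG g t) ((net.gen g).wind.Ψ ⬝ᵥ σ.χG g t)
      (fun a => u (.inl (g, a))) (genPart x g))
    (fun l => loadRhs (net.load l) (d.load l).im (net.flow (angle x) (.inr (.inl l)))
      (net.flow op.θ (.inr (.inl l))) op.w (σ.pieL l t) ((net.load l).wind.Ψ ⬝ᵥ σ.χL l t)
      (u (.inr l)) (loadPart x l))
    (fun z => zeroRhs (net.zero z) (net.flow (angle x) (.inr (.inr z))) (zeroPart x z))

/-- Closed-loop trajectories on `[t₀, ∞)`. -/
def IsSolution (net : Network G L Z ℓL ℓM) (op : SetPoint G L Z) (d : Design G L ℓL ℓM)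
    (σ : Signals G L ℓL ℓM) (t₀ : ℝ) (x : ℝ → Idx G L Z ℓL ℓM → ℝ) : Prop :=
  ∀ t, t₀ ≤ t →
    HasDerivWithinAt x (plantRhs net op d σ t (control net op d σ t (x t)) (x t)) (Set.Ici t₀) t

/-- The manifolds of all states. The manifold of `η` is `ϑ = T* χ`. -/
def manifold (net : Network G L Z ℓL ℓM) (op : SetPoint G L Z) (d : Design G L ℓL ℓM)
    (σ : Signals G L ℓL ℓM) (t : ℝ) : Idx G L Z ℓL ℓM → ℝ :=
  assemble
    (fun g => Sum.elim
      (genManifold (net.gen g) (op.angle (.inl g) t) op.w (net.flow op.θ (.inl g))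
        (σ.pieG g t) (deriv (σ.pieG g) t)
        ((net.gen g).wind.Ψ₁ ⬝ᵥ σ.χG g t) (deriv (fun s => (net.gen g).wind.Ψ₁ ⬝ᵥ σ.χG g s) t)
        ((net.gen g).wind.Ψ₂ ⬝ᵥ σ.χG g t))
      (sylv (net.gen g).wind (d.gen g).im *ᵥ σ.χG g t))
    (fun l => Sum.elim
      (loadManifold (net.load l) (op.angle (.inr (.inl l)) t) op.w
        (net.flow op.θ (.inr (.inl l))) (σ.pieL l t) ((net.load l).wind.Ψ ⬝ᵥ σ.χL l t))
      (sylv (net.load l).wind (d.load l).im *ᵥ σ.χL l t))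
    (fun z => ![op.angle (.inr (.inr z)) t, op.w])

/-- The manifolds of all inputs. -/
def inputManifold (net : Network G L Z ℓL ℓM) (op : SetPoint G L Z)
    (σ : Signals G L ℓL ℓM) (t : ℝ) : InIdx G L → ℝ :=
  Sum.elim
    (fun q =>
      let pL : ℝ → ℝ := fun s => (net.gen q.1).wind.Ψ₁ ⬝ᵥ σ.χG q.1 s
      let pM : ℝ → ℝ := fun s => (net.gen q.1).wind.Ψ₂ ⬝ᵥ σ.χG q.1 s
      ![genRefManifold (net.gen q.1) op.w (net.flow op.θ (.inl q.1)) (σ.pieG q.1 t)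
          (deriv (σ.pieG q.1) t) (deriv (deriv (σ.pieG q.1)) t) (pL t) (deriv pL t)
          (deriv (deriv pL) t),
        genPriceManifold (net.gen q.1) (pM t) (deriv pM t)] q.2)
    (fun l =>
      let pr : ℝ → ℝ := fun s => (net.load l).wind.Ψ ⬝ᵥ σ.χL l s
      loadPriceManifold (net.load l) op.w (net.flow op.θ (.inr (.inl l))) (σ.pieL l t)
        (deriv (σ.pieL l) t) (pr t) (deriv pr t))

/-- The transformed state `x̂` of the network. -/
def hat (net : Network G L Z ℓL ℓM) (op : SetPoint G L Z) (d : Design G L ℓL ℓM)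
    (σ : Signals G L ℓL ℓM) (t : ℝ) (x : Idx G L Z ℓL ℓM → ℝ) : Idx G L Z ℓL ℓM → ℝ :=
  assemble
    (fun g => genHatFull (net.gen g) (d.gen g) (net.tSum (.inl g)) (op.angle (.inl g) t) op.w
      (net.flow op.θ (.inl g)) (σ.pieG g t) (deriv (σ.pieG g) t)
      (sylv (net.gen g).wind (d.gen g).im *ᵥ σ.χG g t) (genPart x g))
    (fun l => loadHatFull (net.load l) (d.load l) (net.tSum (.inr (.inl l)))
      (op.angle (.inr (.inl l)) t) op.w (net.flow op.θ (.inr (.inl l))) (σ.pieL l t)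
      (sylv (net.load l).wind (d.load l).im *ᵥ σ.χL l t) (loadPart x l))
    (fun z => ![zeroPart x z 0 - op.angle (.inr (.inr z)) t, zeroPart x z 1 - op.w])

/-- The linear vector field of the transformed network. -/
def hatRhs (net : Network G L Z ℓL ℓM) (d : Design G L ℓL ℓM) (y : Idx G L Z ℓL ℓM → ℝ) :
    Idx G L Z ℓL ℓM → ℝ :=
  assemble
    (fun g => genHatRhs (net.gen g) (d.gen g) (net.tSum (.inl g))
      (net.inflow (angle y) (.inl g)) (genPart y g))
    (fun l => loadHatRhs (net.load l) (d.load l) (net.tSum (.inr (.inl l)))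
      (net.inflow (angle y) (.inr (.inl l))) (loadPart y l))
    (fun z => zeroHatRhs (net.zero z) (net.tSum (.inr (.inr z)))
      (net.inflow (angle y) (.inr (.inr z))) (zeroPart y z))

open Classical in
/-- The closed-loop matrix `A` of the transformed network: its columns are the values of the linear
vector field at the standard basis vectors. -/
def closedLoop (net : Network G L Z ℓL ℓM)
    (d : Design G L ℓL ℓM) : Matrix (Idx G L Z ℓL ℓM) (Idx G L Z ℓL ℓM) ℝ :=
  Matrix.of fun a b => hatRhs net d (fun c => if c = b then 1 else 0) a

/-- States and inputs converge to their manifolds from every initial state at every initial time,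
with overshoot `C` and rate `α`, in the Euclidean norm. -/
def ExpConv (net : Network G L Z ℓL ℓM) (op : SetPoint G L Z) (d : Design G L ℓL ℓM)
    (σ : Signals G L ℓL ℓM) (C α : ℝ) : Prop :=
  ∀ (t₀ : ℝ) (x : ℝ → Idx G L Z ℓL ℓM → ℝ), IsSolution net op d σ t₀ x → ∀ t, t₀ ≤ t →
    ‖WithLp.toLp 2 (x t - manifold net op d σ t)‖ ≤
        C * Real.exp (-α * (t - t₀)) * ‖WithLp.toLp 2 (x t₀ - manifold net op d σ t₀)‖ ∧
    ‖WithLp.toLp 2 (control net op d σ t (x t) - inputManifold net op σ t)‖ ≤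
        C * Real.exp (-α * (t - t₀)) * ‖WithLp.toLp 2 (x t₀ - manifold net op d σ t₀)‖

/-- Every wind power exosystem of the network is observable. -/
def Network.Observable (net : Network G L Z ℓL ℓM) : Prop :=
  (∀ g, IsObservable (net.gen g).wind.Ψ (net.gen g).wind.Φ) ∧
  (∀ l, IsObservable (net.load l).wind.Ψ (net.load l).wind.Φ)

/-- At the uncontrolled buses the desired power flows balance the damping power at frequency `w^*`. -/
def SetPoint.Balanced (op : SetPoint G L Z) (net : Network G L Z ℓL ℓM) : Prop :=
  ∀ z, (net.zero z).D * op.w + net.flow op.θ (.inr (.inr z)) = 0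

/-- The design that applies fixed rules, one for generator buses and one for load buses, to the
local parameters and `∑_{j ∈ N_i} t_ij` at each controlled bus. -/
def Network.localDesign (net : Network G L Z ℓL ℓM)
    (ruleG : GenParams ℓL ℓM → ℝ → GenDesign ℓL ℓM)
    (ruleL : LoadParams ℓL ℓM → ℝ → LoadDesign ℓL ℓM) : Design G L ℓL ℓM where
  gen g := ruleG (net.gen g) (net.tSum (.inl g))
  load l := ruleL (net.load l) (net.tSum (.inr (.inl l)))

end Net

end PowerNet

end

open scoped Matrix

noncomputable section

namespace PowerNet

/-! ### Spectra of complex matrices -/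

section Spectrum

variable {ι : Type} [Fintype ι] [DecidableEq ι]

/-! Sylvester equation. `I.M` is Hurwitz and the spectrum of Φ lies on the imaginary axis, so T ↦ TΦ
- MT is injective, hence bijective (`exists_unique_sylvester`). If ker T lies in ker Ψ, then it is
Φ-invariant and unobservable, hence zero. Otherwise the equation puts N into the range of T, which
is then M-invariant, and controllability makes T onto (`isUnit_of_isSylvester`).

Linearity of the closed loop. The plant is affine, and the manifold is itself a trajectory under the
input manifold (`hasDerivAt_manifold`). Subtracting it removes set points, demands and wind, and
leaves an autonomous linear equation `netErr` for the deviation z. The estimates are exact at η =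
Tχ, so the transformed state and the input deviation are fixed linear maps `hatLin`, `controlLin` of
z (`hat_eq`, `control_eq`). A backstepping computation at each bus (`genHatLin_genErr`,
`loadHatLin_loadErr`) shows that the injective map `hatLin` conjugates `netErr` to A. Convergence to
the manifolds is therefore decay of y' = Ay, with constants that do not see the signals, and every
solution of y' = Ay comes from a closed-loop trajectory for any given signals.

Existence of gains. Fix a diagonal internal model and set all gains of a bus equal to one large κ.
Let z be an eigenvalue of A with Re z ≥ 0 and ω = Im z, let θ_i be the angle components of an
eigenvector and s_i = ∑ t_ij θ_j. Eliminating the other local variables at a controlled bus gives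
θ_i = w_i s_i, where |w_i| ≤ δ_i and |Im w_i| ≤ δ_i |ω| with δ_i τ_i ≤ 1/16 (`exists_high_gain`).
The bound relative to ω is essential, because the dissipation of an uncontrolled bus, D_i ω
|θ_i|²/(2π), also vanishes with ω. If ω ≠ 0, symmetry of t makes ∑ conj(θ_i) s_i real, and comparing
imaginary parts with D_i > τ_i forces θ = 0. If ω = 0, a maximum principle for |θ_i| does so: a
maximum cannot sit at a controlled bus, and at an uncontrolled bus it spreads to all neighbours,
hence along a path to a controlled bus. With θ = 0 the buses decouple, and each is stable in
isolation. The threshold on κ involves only the local parameters and τ_i, so the rules are local. -/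

lemma exists_eigenvector_of_not_isUnit {A : Matrix ι ι ℂ} {z : ℂ}
    (h : ¬ IsUnit (algebraMap ℂ (Matrix ι ι ℂ) z - A)) : ∃ v ≠ 0, A *ᵥ v = z • v := by
  rw [Matrix.isUnit_iff_isUnit_det, isUnit_iff_ne_zero, not_not,
    ← Matrix.exists_mulVec_eq_zero_iff] at h
  obtain ⟨v, hv, h⟩ := h
  refine ⟨v, hv, ?_⟩
  rw [Matrix.sub_mulVec, sub_eq_zero, Algebra.algebraMap_eq_smul_one, Matrix.smul_mulVec,
    Matrix.one_mulVec] at h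
  exact h.symm

lemma exists_eigenvector_of_isRoot_charpoly {A : Matrix ι ι ℂ} {z : ℂ}
    (h : A.charpoly.IsRoot z) : ∃ v ≠ 0, A *ᵥ v = z • v := by
  apply exists_eigenvector_of_not_isUnit
  rw [Matrix.isUnit_iff_isUnit_det, isUnit_iff_ne_zero, not_not]
  rw [Polynomial.IsRoot.def, Matrix.eval_charpoly] at h
  exact h

/-- Intertwiners of complex matrices without a common eigenvalue vanish. -/
lemma intertwiner_eq_zero {A B X : Matrix ι ι ℂ} (h : A * X = X * B)
    (hAB : ∀ z : ℂ, (∃ v ≠ 0, A *ᵥ v = z • v) → (∃ v ≠ 0, B *ᵥ v = z • v) → False) :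
    X = 0 := by
  have hpow : ∀ p : Polynomial ℂ, Polynomial.aeval A p * X = X * Polynomial.aeval B p := by
    intro p
    induction p using Polynomial.induction_on' with
    | add p q hp hq => simp only [map_add, add_mul, mul_add, hp, hq]
    | monomial n a =>
      have : A ^ n * X = X * B ^ n := by
        induction n with
        | zero => simp
        | succ n ih => rw [pow_succ, mul_assoc, h, ← mul_assoc, ih, mul_assoc, ← pow_succ]
      simp only [Polynomial.aeval_monomial, Algebra.algebraMap_eq_smul_one, smul_mul_assoc, one_mul,
        mul_smul_comm, this]
  -- For p the characteristic polynomial of A, p(A) = 0 leaves X p(B) = 0. Here p(B) is a product of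
  -- factors B - z over eigenvalues z of A, and a singular factor would give a common eigenvalue.
  have hunit : IsUnit (Polynomial.aeval B A.charpoly) := by
    by_contra hn
    rw [(IsAlgClosed.splits A.charpoly).eq_prod_roots_of_monic A.charpoly_monic] at hn
    obtain ⟨z, hz, hroot⟩ := spectrum.exists_mem_of_not_isUnit_aeval_prod hn
    exact hAB z (exists_eigenvector_of_isRoot_charpoly hroot)
      (exists_eigenvector_of_not_isUnit hz)
  have h0 := hpow A.charpoly
  rw [Matrix.aeval_self_charpoly, zero_mul] at h0
  exact (hunit.mul_left_eq_zero).mp h0.symm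

end Spectrum

/-! ### The Sylvester equation -/

section Sylvester

variable {ℓL ℓM : ℕ}

lemma Wind.Φ_mulVec_zero {R : Type} [CommRing R] (W : Wind ℓL ℓM) (f : ℝ →+* R)
    (v : Exo ℓL ℓM → R) (l : Fin ℓL ⊕ Fin ℓM) : (W.Φ.map f *ᵥ v) (l, 0) = v (l, 1) := by
  simp [Matrix.mulVec, dotProduct, Wind.Φ, Fintype.sum_prod_type, apply_ite f, ite_mul]

lemma Wind.Φ_mulVec_one {R : Type} [CommRing R] (W : Wind ℓL ℓM) (f : ℝ →+* R)
    (v : Exo ℓL ℓM → R) (l : Fin ℓL ⊕ Fin ℓM) :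
    (W.Φ.map f *ᵥ v) (l, 1) = -(f (W.ρ l)) ^ 2 * v (l, 0) := by
  simp [Matrix.mulVec, dotProduct, Wind.Φ, Fintype.sum_prod_type, apply_ite f, ite_mul]

/-- The eigenvalues of the exosystem lie on the imaginary axis. -/
lemma Wind.re_eigenvalue_Φ (W : Wind ℓL ℓM) {z : ℂ} {v : Exo ℓL ℓM → ℂ} (hv : v ≠ 0)
    (h : W.Φ.map (algebraMap ℝ ℂ) *ᵥ v = z • v) : z.re = 0 := by
  obtain ⟨⟨l, j⟩, hl⟩ := Function.ne_iff.mp hv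
  have h0 := congrFun h (l, 0)
  have h1 := congrFun h (l, 1)
  rw [W.Φ_mulVec_zero] at h0
  rw [W.Φ_mulVec_one] at h1
  simp only [Pi.smul_apply, smul_eq_mul, Complex.coe_algebraMap] at h0 h1
  -- In each block the second component is z times the first, so a nonzero block has a nonzero first
  -- component.
  have hne : v (l, 0) ≠ 0 := by
    intro h00
    rw [h00, mul_zero] at h0
    fin_cases j
    · exact hl h00
    · exact hl h0
  rw [h0] at h1
  have h2 : z * z = -((W.ρ l : ℂ) ^ 2) := by
    apply mul_right_cancel₀ hne
    linear_combination -h1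
  have hre := congrArg Complex.re h2
  have him := congrArg Complex.im h2
  simp only [← Complex.ofReal_pow, Complex.mul_re, Complex.mul_im, Complex.neg_re, Complex.neg_im,
    Complex.ofReal_re, Complex.ofReal_im] at hre him
  -- z² = -ρ² is real and nonpositive. If Im z = 0, then (Re z)² = -ρ² still forces Re z = 0.
  have : z.re * z.im = 0 := by linarith
  rcases mul_eq_zero.mp this with h | h
  · exact h
  · rw [h] at hre
    nlinarith [sq_nonneg (W.ρ l), sq_nonneg z.re]

/-- After complexification T intertwines `I.M`, with spectrum in the open left half plane, and Φ,
with spectrum on the imaginary axis. -/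
lemma sylvester_injective (W : Wind ℓL ℓM) (I : IntModel ℓL ℓM) (hM : IsHurwitz I.M)
    {T : Matrix (Exo ℓL ℓM) (Exo ℓL ℓM) ℝ} (h : T * W.Φ - I.M * T = 0) : T = 0 := by
  have h' : I.M.map (algebraMap ℝ ℂ) * T.map (algebraMap ℝ ℂ) =
      T.map (algebraMap ℝ ℂ) * W.Φ.map (algebraMap ℝ ℂ) := by
    rw [← Matrix.map_mul, ← Matrix.map_mul, sub_eq_zero.mp h]
  have := intertwiner_eq_zero h' (by
    rintro z ⟨v, hv, h1⟩ ⟨w, hw, h2⟩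
    have h3 := hM z v hv h1
    have h4 := W.re_eigenvalue_Φ hw h2
    linarith)
  ext i j
  have hij := congrFun (congrFun this i) j
  simpa using hij

/-- The Sylvester operator is an endomorphism of a finite-dimensional space, so injectivity already
gives solvability. -/
lemma exists_unique_sylvester (W : Wind ℓL ℓM) (I : IntModel ℓL ℓM) (hM : IsHurwitz I.M) :
    ∃! T, IsSylvester W I T := by
  let S : Matrix (Exo ℓL ℓM) (Exo ℓL ℓM) ℝ →ₗ[ℝ] Matrix (Exo ℓL ℓM) (Exo ℓL ℓM) ℝ :=
    LinearMap.mulRight ℝ W.Φ - LinearMap.mulLeft ℝ I.M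
  have hS : ∀ T, S T = T * W.Φ - I.M * T := fun T => by simp [S]
  have hinj : Function.Injective S := by
    rw [← LinearMap.ker_eq_bot, LinearMap.ker_eq_bot']
    intro T hT
    exact sylvester_injective W I hM (by rw [← hS, hT])
  have hbij : Function.Bijective S := ⟨hinj, LinearMap.injective_iff_surjective.mp hinj⟩
  obtain ⟨T, hT, huniq⟩ := hbij.existsUnique (Matrix.vecMulVec I.N W.Ψ)
  exact ⟨T, (hS T).symm.trans hT, fun T' h => huniq T' ((hS T').trans h)⟩

lemma sylv_spec (W : Wind ℓL ℓM) (I : IntModel ℓL ℓM) (hM : IsHurwitz I.M) :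
    IsSylvester W I (sylv W I) := by
  have h : ∃ T, IsSylvester W I T := (exists_unique_sylvester W I hM).exists
  rw [sylv, dif_pos h]
  exact h.choose_spec

/-- A dichotomy. If Ψ vanishes on ker T, the equation makes ker T invariant under Φ, and
observability gives injectivity. If Tv = 0 and Ψv ≠ 0, then TΦv = (Ψv) N puts N into the range of T,
the equation makes this range M-invariant, and controllability gives surjectivity. -/
lemma isUnit_of_isSylvester (W : Wind ℓL ℓM) (I : IntModel ℓL ℓM)
    (hO : IsObservable W.Ψ W.Φ) (hC : IsControllable I.M I.N)
    {T : Matrix (Exo ℓL ℓM) (Exo ℓL ℓM) ℝ} (hT : IsSylvester W I T) : IsUnit T := by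
  have hvec : ∀ v, T *ᵥ (W.Φ *ᵥ v) = I.M *ᵥ (T *ᵥ v) + (W.Ψ ⬝ᵥ v) • I.N := by
    intro v
    have := congrArg (· *ᵥ v) hT
    simp only [Matrix.sub_mulVec, ← Matrix.mulVec_mulVec, Matrix.vecMulVec_mulVec] at this
    rw [sub_eq_iff_eq_add] at this
    rw [this, add_comm]
    simp
  rw [← Matrix.mulVec_injective_iff_isUnit]
  by_cases hker : ∀ v, T *ᵥ v = 0 → W.Ψ ⬝ᵥ v = 0
  · refine (injective_iff_map_eq_zero T.mulVecLin).mpr fun v hv => ?_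
    have hk : ∀ k : ℕ, T *ᵥ ((W.Φ ^ k) *ᵥ v) = 0 := by
      intro k
      induction k with
      | zero => simpa using hv
      | succ k ih =>
        rw [pow_succ', ← Matrix.mulVec_mulVec, hvec, ih, hker _ ih]
        simp
    exact hO v fun k => hker _ (hk k)
  · push Not at hker
    obtain ⟨v, hv, hΨ⟩ := hker
    have hN : I.N ∈ LinearMap.range T.mulVecLin := by
      refine ⟨(W.Ψ ⬝ᵥ v)⁻¹ • (W.Φ *ᵥ v), ?_⟩
      rw [map_smul, Matrix.mulVecLin_apply, hvec, hv, Matrix.mulVec_zero, zero_add, smul_smul,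
        inv_mul_cancel₀ hΨ, one_smul]
    have hM : ∀ u ∈ LinearMap.range T.mulVecLin, I.M *ᵥ u ∈ LinearMap.range T.mulVecLin := by
      rintro _ ⟨u, rfl⟩
      have h1 : I.M *ᵥ (T.mulVecLin u) = T.mulVecLin (W.Φ *ᵥ u) - (W.Ψ ⬝ᵥ u) • I.N := by
        rw [Matrix.mulVecLin_apply, Matrix.mulVecLin_apply, hvec, add_sub_cancel_right]
      rw [h1]
      exact Submodule.sub_mem _ ⟨_, rfl⟩ (Submodule.smul_mem _ _ hN)
    have htop : LinearMap.range T.mulVecLin = ⊤ := by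
      rw [eq_top_iff, ← hC, Submodule.span_le]
      rintro _ ⟨k, rfl⟩
      induction k with
      | zero => simpa using hN
      | succ k ih =>
        have := hM _ ih
        rwa [Matrix.mulVec_mulVec, ← pow_succ'] at this
    exact LinearMap.injective_iff_surjective.mpr (LinearMap.range_eq_top.mp htop)

lemma isUnit_sylv (W : Wind ℓL ℓM) (I : IntModel ℓL ℓM) (hO : IsObservable W.Ψ W.Φ)
    (hM : IsHurwitz I.M) (hC : IsControllable I.M I.N) : IsUnit (sylv W I) :=
  isUnit_of_isSylvester W I hO hC (sylv_spec W I hM)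

/-- The estimates are exact when η lies on its manifold Tχ. -/
lemma estRow_dotProduct_sylv (W : Wind ℓL ℓM) (I : IntModel ℓL ℓM) (hU : IsUnit (sylv W I))
    (r χ : Exo ℓL ℓM → ℝ) : estRow W I r ⬝ᵥ (sylv W I *ᵥ χ) = r ⬝ᵥ χ := by
  rw [estRow, ← Matrix.dotProduct_mulVec, Matrix.mulVec_mulVec,
    Matrix.nonsing_inv_mul _ ((Matrix.isUnit_iff_isUnit_det _).mp hU), Matrix.one_mulVec]

/-- The Sylvester equation read as dynamics: ϑ = Tχ solves the internal model equation driven by the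
wind power Ψχ. -/
lemma sylv_mulVec_Φ (W : Wind ℓL ℓM) (I : IntModel ℓL ℓM) (hM : IsHurwitz I.M)
    (χ : Exo ℓL ℓM → ℝ) :
    sylv W I *ᵥ (W.Φ *ᵥ χ) = I.M *ᵥ (sylv W I *ᵥ χ) + (W.Ψ ⬝ᵥ χ) • I.N := by
  have := congrArg (· *ᵥ χ) (sylv_spec W I hM)
  simp only [Matrix.sub_mulVec, ← Matrix.mulVec_mulVec, Matrix.vecMulVec_mulVec] at this
  rw [sub_eq_iff_eq_add] at this
  rw [this, add_comm]
  simp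

lemma Wind.Ψ₁_add_Ψ₂ (W : Wind ℓL ℓM) : W.Ψ₁ + W.Ψ₂ = W.Ψ := by
  ext p
  simp only [Pi.add_apply, Wind.Ψ₁, Wind.Ψ₂]
  split_ifs <;> simp

lemma estRow_add (W : Wind ℓL ℓM) (I : IntModel ℓL ℓM) :
    estRow W I W.Ψ₁ + estRow W I W.Ψ₂ = estRow W I W.Ψ := by
  rw [estRow, estRow, estRow, ← Matrix.add_vecMul, W.Ψ₁_add_Ψ₂]

end Sylvester

/-! ### Error dynamics of the buses

The local states are written as `Sum.elim a η`; `z = x - x^*` is the deviation from the manifold. -/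

section Gen

variable {ℓL ℓM : ℕ}

/-- The deviation dynamics of a generator bus, with input deviation `u`. -/
def genErr (p : GenParams ℓL ℓM) (I : IntModel ℓL ℓM) (F : ℝ) (u : Fin 2 → ℝ)
    (z : GenState ℓL ℓM) : GenState ℓL ℓM :=
  Sum.elim
    ![2 * Real.pi * z (.inl 1),
      -(1 / p.m) * (p.D * z (.inl 1) + F - z (.inl 2) + z (.inl 4)),
      -(1 / p.TCH) * (z (.inl 2) - z (.inl 3)),
      -(1 / p.TG) * (z (.inl 3) + 1 / p.R * z (.inl 1) - u 0),
      p.c * z (.inl 4) - u 1]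
    (genEtaDot p I 0 0 0 z)

/-- The transformed state of a generator bus as a linear function of the deviation. -/
def genHatLin (p : GenParams ℓL ℓM) (d : GenDesign ℓL ℓM) (τ : ℝ) (z : GenState ℓL ℓM) :
    GenState ℓL ℓM :=
  genHatFull p d τ 0 0 0 0 0 0 z

/-- The input deviation of a generator bus as a linear function of the state deviation. -/
def genControlLin (p : GenParams ℓL ℓM) (d : GenDesign ℓL ℓM) (τ : ℝ) (z : GenState ℓL ℓM) :
    Fin 2 → ℝ :=
  genControl p d τ 0 0 0 0 0 0 z - ![0, p.b]

lemma forall_fin_five {P : Fin 5 → Prop} : (∀ i, P i) ↔ P 0 ∧ P 1 ∧ P 2 ∧ P 3 ∧ P 4 := by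
  simp [Fin.forall_fin_succ]

/-- Set points, demand and wind power enter additively and cancel in the difference. -/
lemma genRhs_sub (p : GenParams ℓL ℓM) (I : IntModel ℓL ℓM) (F F' Fs ws pie pren : ℝ)
    (u u' : Fin 2 → ℝ) (x x' : GenState ℓL ℓM) :
    genRhs p I F Fs ws pie pren u x - genRhs p I F' Fs ws pie pren u' x' =
      genErr p I (F - F') (u - u') (x - x') := by
  rw [genRhs, genRhs, genErr, ← Sum.elim_sub_sub]
  congr 1
  · ext i
    revert i
    rw [forall_fin_five]
    simp only [Pi.sub_apply, Matrix.cons_val]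
    refine ⟨?_, ?_, ?_, ?_, ?_⟩ <;> ring
  · simp only [genEtaDot, genDrive]
    have : (fun e => (x - x') (.inr e)) = (fun e => x (.inr e)) - fun e => x' (.inr e) := rfl
    rw [this, Matrix.mulVec_sub]
    ext e
    simp only [Pi.sub_apply, Pi.add_apply, Pi.smul_apply, smul_eq_mul]
    ring

/-- The transformation is affine in the state, and its constant part vanishes on the manifold
because the estimates are exact there. The derivative of the estimate needs its own hypothesis
`h₁'`, since the manifold of P_v contains it; on the manifold the drive of the internal model is `pL
+ pM`. -/
lemma genHatFull_eq (p : GenParams ℓL ℓM) (d : GenDesign ℓL ℓM)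
    (τ θs ws Fs pie pie' pL pL' pM : ℝ) (ϑ : Exo ℓL ℓM → ℝ)
    (h₁ : estRow p.wind d.im p.wind.Ψ₁ ⬝ᵥ ϑ = pL) (h₂ : estRow p.wind d.im p.wind.Ψ₂ ⬝ᵥ ϑ = pM)
    (h₁' : estRow p.wind d.im p.wind.Ψ₁ ⬝ᵥ (d.im.M *ᵥ ϑ + (pL + pM) • d.im.N) = pL')
    (x : GenState ℓL ℓM) :
    genHatFull p d τ θs ws Fs pie pie' ϑ x =
      genHatLin p d τ (x - Sum.elim (genManifold p θs ws Fs pie pie' pL pL' pM) ϑ) := by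
  obtain ⟨a, η, rfl⟩ : ∃ a η, x = Sum.elim a η := ⟨_, _, (Sum.elim_comp_inl_inr x).symm⟩
  simp only [dotProduct_add, dotProduct_smul, smul_eq_mul] at h₁'
  have hy : genHat p d τ θs ws Fs pie pie' (Sum.elim a η) = genHat p d τ 0 0 0 0 0
      (Sum.elim a η - Sum.elim (genManifold p θs ws Fs pie pie' pL pL' pM) ϑ) := by
    ext i
    revert i
    rw [forall_fin_five]
    subst h₁ h₂ h₁'
    simp only [genHat, genManifold, genEtaDot, genDrive, Sum.elim_inl, Sum.elim_inr,
      Matrix.cons_val, Pi.sub_apply, ← Pi.sub_def, Matrix.mulVec_sub,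
      dotProduct_add, dotProduct_sub, dotProduct_smul, smul_eq_mul]
    refine ⟨?_, ?_, ?_, ?_, ?_⟩ <;> ring
  rw [genHatLin, genHatFull, genHatFull]
  simp only [hy]
  congr 1
  ext e
  simp

/-- As for the transformation, now with second derivatives of the estimate. The price keeps the
constant `b` even at zero signals, which is why `genControlLin` subtracts it. -/
lemma genControl_eq (p : GenParams ℓL ℓM) (d : GenDesign ℓL ℓM)
    (τ θs ws Fs pie pie' pie'' pL pL' pL'' pM pM' : ℝ) (ϑ ϑ' : Exo ℓL ℓM → ℝ)
    (h₁ : estRow p.wind d.im p.wind.Ψ₁ ⬝ᵥ ϑ = pL) (h₂ : estRow p.wind d.im p.wind.Ψ₂ ⬝ᵥ ϑ = pM)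
    (hϑ : ϑ' = d.im.M *ᵥ ϑ + (pL + pM) • d.im.N)
    (h₁' : estRow p.wind d.im p.wind.Ψ₁ ⬝ᵥ ϑ' = pL')
    (h₂' : estRow p.wind d.im p.wind.Ψ₂ ⬝ᵥ ϑ' = pM')
    (h₁'' : estRow p.wind d.im p.wind.Ψ₁ ⬝ᵥ (d.im.M *ᵥ ϑ' + (pL' + pM') • d.im.N) = pL'')
    (x : GenState ℓL ℓM) :
    genControl p d τ θs ws Fs pie pie' pie'' x =
      ![genRefManifold p ws Fs pie pie' pie'' pL pL' pL'', genPriceManifold p pM pM'] +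
      genControlLin p d τ (x - Sum.elim (genManifold p θs ws Fs pie pie' pL pL' pM) ϑ) := by
  have hT := p.TCH_pos.ne'
  have hhat := genHatFull_eq p d τ θs ws Fs pie pie' pL pL' pM ϑ h₁ h₂ (hϑ ▸ h₁') x
  have hy : genHat p d τ θs ws Fs pie pie' x = genHat p d τ 0 0 0 0 0
      (x - Sum.elim (genManifold p θs ws Fs pie pie' pL pL' pM) ϑ) := by
    ext i
    exact congrFun hhat (.inl i)
  obtain ⟨a, η, rfl⟩ : ∃ a η, x = Sum.elim a η := ⟨_, _, (Sum.elim_comp_inl_inr x).symm⟩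
  simp only [genControlLin, genControl, hy]
  generalize genHat p d τ 0 0 0 0 0 (Sum.elim a η - Sum.elim _ ϑ) = y
  subst hϑ
  simp only [dotProduct_add, dotProduct_smul, smul_eq_mul, Matrix.mulVec_add, Matrix.mulVec_smul]
    at h₁' h₂' h₁''
  ext i
  revert i
  rw [Fin.forall_fin_two]
  subst h₁ h₂
  simp only [genManifold, genEtaDot, genDrive, Sum.elim_inl, Sum.elim_inr,
      Matrix.cons_val, Pi.sub_apply, Pi.add_apply, ← Pi.sub_def, Matrix.mulVec_sub,
      Matrix.mulVec_add, Matrix.mulVec_smul, genPriceManifold, genRefManifold,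
      dotProduct_add, dotProduct_sub, dotProduct_smul, smul_eq_mul]
  subst h₁' h₂' h₁''
  constructor
  · field_simp
    ring
  · ring

/-- The combination of the first two transformed states inside `genHatFull` is the frequency
deviation `a 1`, so the last block is η + m w N. -/
lemma genHatLin_elim (p : GenParams ℓL ℓM) (d : GenDesign ℓL ℓM) (τ : ℝ) (a : Fin 5 → ℝ)
    (η : Exo ℓL ℓM → ℝ) :
    genHatLin p d τ (Sum.elim a η) =
      Sum.elim (genHat p d τ 0 0 0 0 0 (Sum.elim a η)) (η + (p.m * a 1) • d.im.N) := by
  rw [genHatLin, genHatFull]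
  congr 1
  ext e
  simp only [genHat, genManifold, Matrix.cons_val, Sum.elim_inl, Sum.elim_inr, Pi.zero_apply,
    Pi.add_apply, Pi.smul_apply, smul_eq_mul]
  ring

/-- The components are described by equations instead of nested `let`s, so that the same lemma
evaluates the transformation at the deviation and at its time derivative. -/
lemma genHat_zero (p : GenParams ℓL ℓM) (d : GenDesign ℓL ℓM) (τ : ℝ) (a : Fin 5 → ℝ)
    (η η' : Exo ℓL ℓM → ℝ) (h' : genEtaDot p d.im 0 0 0 (Sum.elim a η) = η')
    (y1 y2 y3 y4 y5 : ℝ) (h1 : y1 = a 0) (h2 : y2 = a 1 + d.k 0 / (2 * Real.pi) * y1)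
    (h3 : y3 = a 2 + estRow p.wind d.im p.wind.Ψ₁ ⬝ᵥ η - (genM1 p d τ * y1 + genM2 p d * y2))
    (h4 : y4 = a 3 + p.TCH * (estRow p.wind d.im p.wind.Ψ₁ ⬝ᵥ η')
      + estRow p.wind d.im p.wind.Ψ₁ ⬝ᵥ η
      - (genV1 p d τ * y1 + genV2 p d τ * y2 + genV3 p d * y3))
    (h5 : y5 = a 4 - estRow p.wind d.im p.wind.Ψ₂ ⬝ᵥ η) :
    genHat p d τ 0 0 0 0 0 (Sum.elim a η) = ![y1, y2, y3, y4, y5] := by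
  have e1 : a 0 - 0 = y1 := by rw [h1, sub_zero]
  have e2 : a 1 - 0 - -(d.k 0 / (2 * Real.pi)) * y1 = y2 := by rw [h2]; ring
  have e3 : a 2 - (0 - estRow p.wind d.im p.wind.Ψ₁ ⬝ᵥ η + p.D * 0 + 0)
      - (genM1 p d τ * y1 + genM2 p d * y2) = y3 := by rw [h3]; ring
  have e4 : a 3 - (p.TCH * (0 - estRow p.wind d.im p.wind.Ψ₁ ⬝ᵥ η') + 0 -
      estRow p.wind d.im p.wind.Ψ₁ ⬝ᵥ η + p.D * 0 + 0)
      - (genV1 p d τ * y1 + genV2 p d τ * y2 + genV3 p d * y3) = y4 := by rw [h4]; ring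
  simp only [genHat, genManifold, Matrix.cons_val, Sum.elim_inl, Sum.elim_inr, h', e1, e2, e3, e4,
    h5]

/-- Backstepping. P_M acts as virtual input of the swing equation, P_v of the P_M equation and P_ref
of the P_v equation; the coefficients `genM1`, …, `genV3` cancel all own-bus terms up to one scalar
A, built from the demand error, the estimation error and the inflow. In the last block, adding m w N
to η cancels the drive -P_M + P^E by the swing equation. -/
lemma genHatLin_genErr (p : GenParams ℓL ℓM) (d : GenDesign ℓL ℓM) (τ s : ℝ)
    (z : GenState ℓL ℓM) :
    genHatLin p d τ (genErr p d.im (τ * z (.inl 0) - s) (genControlLin p d τ z) z) =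
      genHatRhs p d τ s (genHatLin p d τ z) := by
  have hT := p.TCH_pos.ne'
  have hG := p.TG_pos.ne'
  have hm := p.m_pos.ne'
  obtain ⟨a, η, rfl⟩ : ∃ a η, z = Sum.elim a η := ⟨_, _, (Sum.elim_comp_inl_inr z).symm⟩
  set r₁ := estRow p.wind d.im p.wind.Ψ₁ with hr₁
  set r₂ := estRow p.wind d.im p.wind.Ψ₂ with hr₂
  have hr : estRow p.wind d.im p.wind.Ψ = r₁ + r₂ := (estRow_add p.wind d.im).symm
  obtain ⟨η', hη'⟩ : ∃ η', genEtaDot p d.im 0 0 0 (Sum.elim a η) = η' := ⟨_, rfl⟩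
  obtain ⟨y1, h1⟩ : ∃ y, y = a 0 := ⟨_, rfl⟩
  obtain ⟨y2, h2⟩ : ∃ y, y = a 1 + d.k 0 / (2 * Real.pi) * y1 := ⟨_, rfl⟩
  obtain ⟨y3, h3⟩ : ∃ y, y = a 2 + r₁ ⬝ᵥ η - (genM1 p d τ * y1 + genM2 p d * y2) := ⟨_, rfl⟩
  obtain ⟨y4, h4⟩ : ∃ y, y = a 3 + p.TCH * (r₁ ⬝ᵥ η') + r₁ ⬝ᵥ η
      - (genV1 p d τ * y1 + genV2 p d τ * y2 + genV3 p d * y3) := ⟨_, rfl⟩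
  obtain ⟨y5, h5⟩ : ∃ y, y = a 4 - r₂ ⬝ᵥ η := ⟨_, rfl⟩
  have hy := genHat_zero p d τ a η η' hη' y1 y2 y3 y4 y5 h1 h2 h3 h4 h5
  -- the input deviation
  obtain ⟨u, hu⟩ : ∃ u, genControlLin p d τ (Sum.elim a η) = u := ⟨_, rfl⟩
  -- The second derivative of η along the closed loop. It contains the price but not P_ref, so P_ref
  -- may be defined from it without circularity.
  obtain ⟨η'', hη''⟩ : ∃ η'', d.im.M *ᵥ η' +
      (1 / p.TCH * (a 2 - a 3) + (p.c * a 4 - u 1)) • d.im.N = η'' := ⟨_, rfl⟩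
  have hu1 : u 1 = -(r₂ ⬝ᵥ η') + p.c * (r₂ ⬝ᵥ η) + (p.c + d.k 4) * y5 := by
    rw [← hu]
    simp only [genControlLin, genControl, hy, hη', Pi.sub_apply, Matrix.cons_val, Sum.elim_inr,
      genPriceManifold, ← hr₁, ← hr₂]
    ring
  have hu0 : u 0 = -(p.TG * p.TCH * (r₁ ⬝ᵥ η'')) - (p.TG + p.TCH) * (r₁ ⬝ᵥ η') - r₁ ⬝ᵥ η
    + (genV1 p d τ - d.k 0 / (2 * Real.pi * p.R) - p.TG * d.k 0 * genV1 p d τ) * y1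
    + (genV2 p d τ + 1 / p.R + 2 * Real.pi * p.TG * genV1 p d τ
        - p.TG * d.k 1 * genV2 p d τ) * y2
    + (genV3 p d + p.TG / p.m * genV2 p d τ - p.TG * d.k 2 * genV3 p d) * y3
    + (-(p.TG * d.k 3) + 1 + p.TG / p.TCH * genV3 p d) * y4 := by
    have hd : -(-(1 / p.TCH) * (a 2 - a 3)) + (p.b + p.c * a 4 -
        (-(r₂ ⬝ᵥ η') + p.c * (r₂ ⬝ᵥ η) + p.b + (p.c + d.k 4) * y5)) + 0 =
        1 / p.TCH * (a 2 - a 3) + (p.c * a 4 - u 1) := by rw [hu1]; ring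
    rw [← hu]
    simp only [genControlLin, genControl, hy, hη', Pi.sub_apply, Matrix.cons_val, Sum.elim_inr,
      Sum.elim_inl, genPriceManifold, genRefManifold, ← hr₁, ← hr₂, hd, hη'']
    ring
  rw [hu]
  clear_value r₁ r₂
  -- the derivative of the deviation
  obtain ⟨b, hb⟩ : ∃ b : Fin 5 → ℝ, b = ![2 * Real.pi * a 1,
      -(1 / p.m) * (p.D * a 1 + (τ * a 0 - s) - a 2 + a 4),
      -(1 / p.TCH) * (a 2 - a 3),
      -(1 / p.TG) * (a 3 + 1 / p.R * a 1 - u 0),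
      p.c * a 4 - u 1] := ⟨_, rfl⟩
  have hz : genErr p d.im (τ * (Sum.elim a η : GenState ℓL ℓM) (.inl 0) - s) u (Sum.elim a η) =
      Sum.elim b η' := by
    rw [genErr, hη', hb]
    rfl
  have hb0 : b 0 = 2 * Real.pi * a 1 := by rw [hb]; rfl
  have hb1 : b 1 = -(1 / p.m) * (p.D * a 1 + (τ * a 0 - s) - a 2 + a 4) := by rw [hb]; rfl
  have hb2 : b 2 = -(1 / p.TCH) * (a 2 - a 3) := by rw [hb]; rfl
  have hb3 : b 3 = -(1 / p.TG) * (a 3 + 1 / p.R * a 1 - u 0) := by rw [hb]; rfl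
  have hb4 : b 4 = p.c * a 4 - u 1 := by rw [hb]; rfl
  clear hb
  -- At zero signals `genEtaDot` is linear, so at the derivative of the deviation it returns the
  -- second derivative of η.
  have hηb : genEtaDot p d.im 0 0 0 (Sum.elim b η') = η'' := by
    rw [← hη'', genEtaDot, genDrive]
    simp only [Sum.elim_inl, Sum.elim_inr, hb2, hb4]
    congr 2
    ring
  have hζ : (fun e => (Sum.elim ![y1, y2, y3, y4, y5] (η + (p.m * a 1) • d.im.N) :
      GenState ℓL ℓM) (.inr e)) = η + (p.m * a 1) • d.im.N := rfl
  have hη'eq : η' = d.im.M *ᵥ η + (-a 2 + a 4) • d.im.N := by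
    rw [← hη', genEtaDot, genDrive]
    simp only [Sum.elim_inl, Sum.elim_inr]
    congr 2
    ring
  rw [hz, genHatLin_elim, genHatLin_elim, hy, genHatRhs]
  simp only [hζ, hr, Sum.elim_inl, Matrix.cons_val, add_dotProduct, dotProduct_add,
    dotProduct_smul, smul_eq_mul]
  have hv1 : genV1 p d τ = genM1 p d τ * (1 - p.TCH * d.k 0) := rfl
  have hv2 : genV2 p d τ = 2 * Real.pi * p.TCH * genM1 p d τ + genM2 p d
    - p.TCH * d.k 1 * genM2 p d := rfl
  have hv3 : genV3 p d = 1 + genM2 p d / p.m * p.TCH - p.TCH * d.k 2 := rfl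
  have hm1 : genM1 p d τ = τ - d.k 0 / (2 * Real.pi) *
    (p.D - p.m * (r₁ ⬝ᵥ d.im.N + r₂ ⬝ᵥ d.im.N) - p.m * d.k 0) := by
    rw [genM1, hr, add_dotProduct]
  have hm2 : genM2 p d = p.D - p.m * (r₁ ⬝ᵥ d.im.N + r₂ ⬝ᵥ d.im.N) - p.m * d.k 0 - p.m * d.k 1 := by
    rw [genM2, hr, add_dotProduct]
  congr 1
  · have ha1 : a 1 = y2 - d.k 0 / (2 * Real.pi) * y1 := by rw [h2]; ring
    have e1 : -(d.k 0) * y1 + 2 * Real.pi * y2 = b 0 := by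
      rw [hb0, h2]
      field_simp
      ring
    -- In terms of η + m w N the estimate leaves an extra multiple of m w ΨT⁻¹N; the ΨT⁻¹N terms of
    -- `genM1` and `genM2` absorb it, together with damping and stiffness.
    have e2 : -(d.k 1) * y2 + 1 / p.m * (y3 - (y5 + (r₁ ⬝ᵥ η + r₂ ⬝ᵥ η +
        p.m * a 1 * (r₁ ⬝ᵥ d.im.N + r₂ ⬝ᵥ d.im.N)) - s)) = b 1 + d.k 0 / (2 * Real.pi) * (-(d.k 0) * y1 + 2 * Real.pi * y2) := by
      have ha2 : a 2 = y3 - r₁ ⬝ᵥ η + (genM1 p d τ * y1 + genM2 p d * y2) := by rw [h3]; ring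
      have ha4 : a 4 = y5 + r₂ ⬝ᵥ η := by rw [h5]; ring
      rw [hb1, ha2, ha4, ha1, ← h1, hm1, hm2]
      field_simp
      ring
    -- The remaining stages use nothing about this scalar: they pass on whatever disturbs the swing
    -- equation.
    generalize y5 + (r₁ ⬝ᵥ η + r₂ ⬝ᵥ η +
        p.m * a 1 * (r₁ ⬝ᵥ d.im.N + r₂ ⬝ᵥ d.im.N)) - s = A at e2 ⊢
    have ha2 : a 2 = y3 - r₁ ⬝ᵥ η + (genM1 p d τ * y1 + genM2 p d * y2) := by rw [h3]; ring
    have ha3 : a 3 = y4 - p.TCH * (r₁ ⬝ᵥ η') - r₁ ⬝ᵥ η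
      + (genV1 p d τ * y1 + genV2 p d τ * y2 + genV3 p d * y3) := by rw [h4]; ring
    have e3 : -(d.k 2) * y3 + 1 / p.TCH * y4 + genM2 p d / p.m * A =
        b 2 + r₁ ⬝ᵥ η' - (genM1 p d τ * (-(d.k 0) * y1 + 2 * Real.pi * y2) +
          genM2 p d * (-(d.k 1) * y2 + 1 / p.m * (y3 - A))) := by
      rw [hb2, ha3, ha2, hv1, hv2, hv3]
      field_simp
      ring
    have e4 : -(d.k 3) * y4 + 1 / p.m * (genV2 p d τ - genM2 p d * genV3 p d) * A =
        b 3 + p.TCH * (r₁ ⬝ᵥ η'') + r₁ ⬝ᵥ η' -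
          (genV1 p d τ * (-(d.k 0) * y1 + 2 * Real.pi * y2) +
          genV2 p d τ * (-(d.k 1) * y2 + 1 / p.m * (y3 - A)) +
          genV3 p d * (-(d.k 2) * y3 + 1 / p.TCH * y4 + genM2 p d / p.m * A)) := by
      rw [hb3, hu0, ha3, ha1]
      field_simp
      ring
    have e5 : -(d.k 4) * y5 = b 4 - r₂ ⬝ᵥ η' := by
      rw [hb4, hu1, h5]
      ring
    exact genHat_zero p d τ b η' η'' hηb _ _ _ _ _ e1 e2 (by rw [e3, hr₁])
      (by rw [e4, hr₁]) (by rw [e5, hr₂])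
  · have hv : y2 - d.k 0 / (2 * Real.pi) * y1 = a 1 := by rw [h2]; ring
    rw [hv, hη'eq, Matrix.mulVec_add, Matrix.mulVec_smul, hb1, ← h1]
    ext e
    simp only [Pi.sub_apply, Pi.add_apply, Pi.smul_apply, smul_eq_mul]
    field_simp
    ring

/-- The manifold of a generator bus is a trajectory under the input manifold. -/
lemma hasDerivAt_genManifold (p : GenParams ℓL ℓM) (I : IntModel ℓL ℓM) (hM : IsHurwitz I.M)
    (θs : ℝ → ℝ) (ws Fs : ℝ) (hθ : ∀ t, HasDerivAt θs (2 * Real.pi * ws) t) (pie : ℝ → ℝ)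
    (hpie : Differentiable ℝ pie) (hpie' : Differentiable ℝ (deriv pie))
    (χ : ℝ → Exo ℓL ℓM → ℝ) (hχ : ∀ t, HasDerivAt χ (p.wind.Φ *ᵥ χ t) t) (pL pM : ℝ → ℝ)
    (hpL : ∀ t, p.wind.Ψ₁ ⬝ᵥ χ t = pL t) (hpM : ∀ t, p.wind.Ψ₂ ⬝ᵥ χ t = pM t)
    (dL : Differentiable ℝ pL) (dL' : Differentiable ℝ (deriv pL)) (dM : Differentiable ℝ pM)
    (t : ℝ) :
    HasDerivAt (fun t => Sum.elim (genManifold p (θs t) ws Fs (pie t) (deriv pie t) (pL t)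
        (deriv pL t) (pM t)) (sylv p.wind I *ᵥ χ t))
      (genRhs p I Fs Fs ws (pie t) (p.wind.Ψ ⬝ᵥ χ t)
        ![genRefManifold p ws Fs (pie t) (deriv pie t) (deriv (deriv pie) t) (pL t) (deriv pL t)
          (deriv (deriv pL) t), genPriceManifold p (pM t) (deriv pM t)]
        (Sum.elim (genManifold p (θs t) ws Fs (pie t) (deriv pie t) (pL t)
        (deriv pL t) (pM t)) (sylv p.wind I *ᵥ χ t))) t := by
  have hT := p.TCH_pos.ne'
  have hG := p.TG_pos.ne'
  have h1 := (hpie t).hasDerivAt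
  have h2 := (hpie' t).hasDerivAt
  have h3 := (dL t).hasDerivAt
  have h4 := (dL' t).hasDerivAt
  have h5 := (dM t).hasDerivAt
  have hΨ : p.wind.Ψ ⬝ᵥ χ t = pL t + pM t := by
    rw [← p.wind.Ψ₁_add_Ψ₂, add_dotProduct, hpL, hpM]
  rw [hasDerivAt_pi]
  rintro (i | e)
  · revert i
    rw [forall_fin_five]
    simp only [genRhs, genManifold, Sum.elim_inl, Matrix.cons_val, hΨ, genRefManifold,
      genPriceManifold]
    refine ⟨hθ t, ?_, ?_, ?_, ?_⟩
    · refine (hasDerivAt_const t ws).congr_deriv ?_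
      field_simp
      ring
    · refine (((h1.sub h3).add_const (p.D * ws)).add_const Fs).congr_deriv ?_
      field_simp
      ring
    · refine ((((((h2.sub h4).const_mul p.TCH).add h1).sub h3).add_const (p.D * ws)).add_const
        Fs).congr_deriv ?_
      field_simp
      ring
    · refine h5.congr_deriv ?_
      ring
  · have h6 : HasDerivAt (fun t => sylv p.wind I *ᵥ χ t)
        (sylv p.wind I *ᵥ (p.wind.Φ *ᵥ χ t)) t :=
      ((sylv p.wind I).mulVecLin.toContinuousLinearMap.hasFDerivAt.comp_hasDerivAt t (hχ t))
    have h7 := (hasDerivAt_pi.mp h6) e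
    have hd : genDrive p Fs ws (pie t) (Sum.elim (genManifold p (θs t) ws Fs (pie t)
        (deriv pie t) (pL t) (deriv pL t) (pM t)) (sylv p.wind I *ᵥ χ t)) = pL t + pM t := by
      simp only [genDrive, genManifold, Sum.elim_inl, Matrix.cons_val]
      ring
    simp only [Sum.elim_inr, genRhs]
    refine h7.congr_deriv ?_
    rw [sylv_mulVec_Φ p.wind I hM, genEtaDot, hΨ, hd]
    rfl

end Gen

/-! ### Deviations and backstepping at a load bus. -/

section Load

variable {ℓL ℓM : ℕ}

/-- The deviation dynamics of a load bus, with input deviation `u`. -/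
def loadErr (p : LoadParams ℓL ℓM) (I : IntModel ℓL ℓM) (F u : ℝ)
    (z : LoadState ℓL ℓM) : LoadState ℓL ℓM :=
  Sum.elim
    ![2 * Real.pi * z (.inl 1),
      -(1 / p.m) * (p.D * z (.inl 1) + F + z (.inl 2)),
      p.c * z (.inl 2) - u]
    (loadEtaDot p I 0 0 0 z)

/-- The transformed state of a load bus as a linear function of the deviation. -/
def loadHatLin (p : LoadParams ℓL ℓM) (d : LoadDesign ℓL ℓM) (τ : ℝ) (z : LoadState ℓL ℓM) :
    LoadState ℓL ℓM :=
  loadHatFull p d τ 0 0 0 0 0 z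

/-- The input deviation of a load bus as a linear function of the state deviation. -/
def loadControlLin (p : LoadParams ℓL ℓM) (d : LoadDesign ℓL ℓM) (τ : ℝ) (z : LoadState ℓL ℓM) :
    ℝ :=
  loadControl p d τ 0 0 0 0 0 z - p.b

lemma forall_fin_three {P : Fin 3 → Prop} : (∀ i, P i) ↔ P 0 ∧ P 1 ∧ P 2 := by
  simp [Fin.forall_fin_succ]

lemma loadRhs_sub (p : LoadParams ℓL ℓM) (I : IntModel ℓL ℓM) (F F' Fs ws pie pren : ℝ)
    (u u' : ℝ) (x x' : LoadState ℓL ℓM) :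
    loadRhs p I F Fs ws pie pren u x - loadRhs p I F' Fs ws pie pren u' x' =
      loadErr p I (F - F') (u - u') (x - x') := by
  rw [loadRhs, loadRhs, loadErr, ← Sum.elim_sub_sub]
  congr 1
  · ext i
    revert i
    rw [forall_fin_three]
    simp only [Pi.sub_apply, Matrix.cons_val]
    refine ⟨?_, ?_, ?_⟩ <;> ring
  · simp only [loadEtaDot]
    have : (fun e => (x - x') (.inr e)) = (fun e => x (.inr e)) - fun e => x' (.inr e) := rfl
    rw [this, Matrix.mulVec_sub]
    ext e
    simp only [Pi.sub_apply, Pi.add_apply, Pi.smul_apply, smul_eq_mul]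
    ring

lemma loadHatFull_eq (p : LoadParams ℓL ℓM) (d : LoadDesign ℓL ℓM)
    (τ θs ws Fs pie pr : ℝ) (ϑ : Exo ℓL ℓM → ℝ)
    (h : estRow p.wind d.im p.wind.Ψ ⬝ᵥ ϑ = pr) (x : LoadState ℓL ℓM) :
    loadHatFull p d τ θs ws Fs pie ϑ x =
      loadHatLin p d τ (x - Sum.elim (loadManifold p θs ws Fs pie pr) ϑ) := by
  obtain ⟨a, η, rfl⟩ : ∃ a η, x = Sum.elim a η := ⟨_, _, (Sum.elim_comp_inl_inr x).symm⟩
  have hy : loadHat p d τ θs ws Fs pie (Sum.elim a η) = loadHat p d τ 0 0 0 0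
      (Sum.elim a η - Sum.elim (loadManifold p θs ws Fs pie pr) ϑ) := by
    ext i
    revert i
    rw [forall_fin_three]
    subst h
    simp only [loadHat, loadManifold, Sum.elim_inl, Sum.elim_inr,
      Matrix.cons_val, Pi.sub_apply, ← Pi.sub_def, dotProduct_sub]
    refine ⟨?_, ?_, ?_⟩ <;> ring
  rw [loadHatLin, loadHatFull, loadHatFull]
  simp only [hy]
  congr 1
  ext e
  simp

lemma loadControl_eq (p : LoadParams ℓL ℓM) (d : LoadDesign ℓL ℓM)
    (τ θs ws Fs pie pie' pr pr' : ℝ) (ϑ : Exo ℓL ℓM → ℝ)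
    (h : estRow p.wind d.im p.wind.Ψ ⬝ᵥ ϑ = pr)
    (h' : estRow p.wind d.im p.wind.Ψ ⬝ᵥ (d.im.M *ᵥ ϑ + pr • d.im.N) = pr')
    (x : LoadState ℓL ℓM) :
    loadControl p d τ θs ws Fs pie pie' x = loadPriceManifold p ws Fs pie pie' pr pr' +
      loadControlLin p d τ (x - Sum.elim (loadManifold p θs ws Fs pie pr) ϑ) := by
  have hhat := loadHatFull_eq p d τ θs ws Fs pie pr ϑ h x
  have hy : loadHat p d τ θs ws Fs pie x = loadHat p d τ 0 0 0 0
      (x - Sum.elim (loadManifold p θs ws Fs pie pr) ϑ) := by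
    ext i
    exact congrFun hhat (.inl i)
  obtain ⟨a, η, rfl⟩ : ∃ a η, x = Sum.elim a η := ⟨_, _, (Sum.elim_comp_inl_inr x).symm⟩
  simp only [loadControlLin, loadControl, hy]
  generalize loadHat p d τ 0 0 0 0 (Sum.elim a η - Sum.elim _ ϑ) = y
  simp only [dotProduct_add, dotProduct_smul, smul_eq_mul] at h'
  subst h
  simp only [loadManifold, loadEtaDot, Sum.elim_inl, Sum.elim_inr,
      Matrix.cons_val, Pi.sub_apply, ← Pi.sub_def, Matrix.mulVec_sub,
      loadPriceManifold, dotProduct_add, dotProduct_sub, dotProduct_smul, smul_eq_mul]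
  subst h'
  ring

lemma loadHatLin_elim (p : LoadParams ℓL ℓM) (d : LoadDesign ℓL ℓM) (τ : ℝ) (a : Fin 3 → ℝ)
    (η : Exo ℓL ℓM → ℝ) :
    loadHatLin p d τ (Sum.elim a η) =
      Sum.elim (loadHat p d τ 0 0 0 0 (Sum.elim a η)) (η + (p.m * a 1) • d.im.N) := by
  rw [loadHatLin, loadHatFull]
  congr 1
  ext e
  simp only [loadHat, loadManifold, Matrix.cons_val, Sum.elim_inl, Sum.elim_inr, Pi.zero_apply,
    Pi.add_apply, Pi.smul_apply, smul_eq_mul]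
  ring

lemma loadHat_zero (p : LoadParams ℓL ℓM) (d : LoadDesign ℓL ℓM) (τ : ℝ) (a : Fin 3 → ℝ)
    (η : Exo ℓL ℓM → ℝ) (y1 y2 y3 : ℝ) (h1 : y1 = a 0)
    (h2 : y2 = a 1 + d.k 0 / (2 * Real.pi) * y1)
    (h3 : y3 = a 2 - estRow p.wind d.im p.wind.Ψ ⬝ᵥ η + (loadM1 p d τ * y1 + loadM2 p d * y2)) :
    loadHat p d τ 0 0 0 0 (Sum.elim a η) = ![y1, y2, y3] := by
  have e1 : a 0 - 0 = y1 := by rw [h1, sub_zero]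
  have e2 : a 1 - 0 - -(d.k 0 / (2 * Real.pi)) * y1 = y2 := by rw [h2]; ring
  have e3 : a 2 - (estRow p.wind d.im p.wind.Ψ ⬝ᵥ η - 0 - p.D * 0 - 0)
      - -(loadM1 p d τ * y1 + loadM2 p d * y2) = y3 := by rw [h3]; ring
  simp only [loadHat, loadManifold, Matrix.cons_val, Sum.elim_inl, Sum.elim_inr, e1, e2, e3]

/-- The same backstepping with a shorter chain: the elastic demand replaces P_M, with opposite sign,
and the price is its input, so only the first derivative of η enters. -/
lemma loadHatLin_loadErr (p : LoadParams ℓL ℓM) (d : LoadDesign ℓL ℓM) (τ s : ℝ)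
    (z : LoadState ℓL ℓM) :
    loadHatLin p d τ (loadErr p d.im (τ * z (.inl 0) - s) (loadControlLin p d τ z) z) =
      loadHatRhs p d τ s (loadHatLin p d τ z) := by
  have hm := p.m_pos.ne'
  obtain ⟨a, η, rfl⟩ : ∃ a η, z = Sum.elim a η := ⟨_, _, (Sum.elim_comp_inl_inr z).symm⟩
  set r := estRow p.wind d.im p.wind.Ψ with hr
  obtain ⟨η', hη'⟩ : ∃ η', loadEtaDot p d.im 0 0 0 (Sum.elim a η) = η' := ⟨_, rfl⟩
  obtain ⟨y1, h1⟩ : ∃ y, y = a 0 := ⟨_, rfl⟩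
  obtain ⟨y2, h2⟩ : ∃ y, y = a 1 + d.k 0 / (2 * Real.pi) * y1 := ⟨_, rfl⟩
  obtain ⟨y3, h3⟩ : ∃ y, y = a 2 - r ⬝ᵥ η + (loadM1 p d τ * y1 + loadM2 p d * y2) := ⟨_, rfl⟩
  have hy := loadHat_zero p d τ a η y1 y2 y3 h1 h2 h3
  obtain ⟨u, hu⟩ : ∃ u, loadControlLin p d τ (Sum.elim a η) = u := ⟨_, rfl⟩
  have hu1 : u = -(r ⬝ᵥ η') + p.c * (r ⬝ᵥ η) - loadM1 p d τ * (p.c + d.k 0) * y1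
      + (2 * Real.pi * loadM1 p d τ - loadM2 p d * (p.c + d.k 1)) * y2
      + (p.c + d.k 2 - loadM2 p d / p.m) * y3 := by
    rw [← hu]
    simp only [loadControlLin, loadControl, hy, hη', Matrix.cons_val, Sum.elim_inr,
      loadPriceManifold, ← hr]
    ring
  rw [hu]
  clear_value r
  obtain ⟨b, hb⟩ : ∃ b : Fin 3 → ℝ, b = ![2 * Real.pi * a 1,
      -(1 / p.m) * (p.D * a 1 + (τ * a 0 - s) + a 2), p.c * a 2 - u] := ⟨_, rfl⟩
  have hz : loadErr p d.im (τ * (Sum.elim a η : LoadState ℓL ℓM) (.inl 0) - s) u (Sum.elim a η) =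
      Sum.elim b η' := by
    rw [loadErr, hη', hb]
    rfl
  have hb0 : b 0 = 2 * Real.pi * a 1 := by rw [hb]; rfl
  have hb1 : b 1 = -(1 / p.m) * (p.D * a 1 + (τ * a 0 - s) + a 2) := by rw [hb]; rfl
  have hb2 : b 2 = p.c * a 2 - u := by rw [hb]; rfl
  clear hb
  have hη'eq : η' = d.im.M *ᵥ η + a 2 • d.im.N := by
    rw [← hη', loadEtaDot]
    simp only [Sum.elim_inl, Sum.elim_inr]
    congr 2
    ring
  have hζ : (fun e => (Sum.elim ![y1, y2, y3] (η + (p.m * a 1) • d.im.N) :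
      LoadState ℓL ℓM) (.inr e)) = η + (p.m * a 1) • d.im.N := rfl
  rw [hz, loadHatLin_elim, loadHatLin_elim, hy, loadHatRhs]
  simp only [hζ, ← hr, Sum.elim_inl, Matrix.cons_val, dotProduct_add,
    dotProduct_smul, smul_eq_mul]
  have hm1 : loadM1 p d τ = τ - d.k 0 / (2 * Real.pi) *
    (p.D - p.m * (r ⬝ᵥ d.im.N) - p.m * d.k 0) := by rw [loadM1, hr]
  have hm2 : loadM2 p d = p.D - p.m * (r ⬝ᵥ d.im.N) - p.m * d.k 0 - p.m * d.k 1 := by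
    rw [loadM2, hr]
  congr 1
  · have ha1 : a 1 = y2 - d.k 0 / (2 * Real.pi) * y1 := by rw [h2]; ring
    have ha2 : a 2 = y3 + r ⬝ᵥ η - (loadM1 p d τ * y1 + loadM2 p d * y2) := by rw [h3]; ring
    have e1 : -(d.k 0) * y1 + 2 * Real.pi * y2 = b 0 := by
      rw [hb0, h2]
      field_simp
      ring
    have e2 : -(d.k 1) * y2 + 1 / p.m * (-y3 - (r ⬝ᵥ η + p.m * a 1 * r ⬝ᵥ d.im.N - s)) =
        b 1 + d.k 0 / (2 * Real.pi) * (-(d.k 0) * y1 + 2 * Real.pi * y2) := by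
      rw [hb1, ha2, ha1, ← h1, hm1, hm2]
      field_simp
      ring
    generalize r ⬝ᵥ η + p.m * a 1 * r ⬝ᵥ d.im.N - s = A at e2 ⊢
    have e3 : -(d.k 2) * y3 - loadM2 p d / p.m * A =
        b 2 - r ⬝ᵥ η' + (loadM1 p d τ * (-(d.k 0) * y1 + 2 * Real.pi * y2) +
          loadM2 p d * (-(d.k 1) * y2 + 1 / p.m * (-y3 - A))) := by
      rw [hb2, hu1, ha2]
      field_simp
      ring
    exact loadHat_zero p d τ b η' _ _ _ e1 e2 (by rw [e3, hr])
  · have hv : y2 - d.k 0 / (2 * Real.pi) * y1 = a 1 := by rw [h2]; ring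
    rw [hv, hη'eq, Matrix.mulVec_add, Matrix.mulVec_smul, hb1, ← h1]
    ext e
    simp only [Pi.sub_apply, Pi.add_apply, Pi.smul_apply, smul_eq_mul]
    field_simp
    ring

/-- The manifold of a load bus is a trajectory under the input manifold. -/
lemma hasDerivAt_loadManifold (p : LoadParams ℓL ℓM) (I : IntModel ℓL ℓM) (hM : IsHurwitz I.M)
    (θs : ℝ → ℝ) (ws Fs : ℝ) (hθ : ∀ t, HasDerivAt θs (2 * Real.pi * ws) t) (pie : ℝ → ℝ)
    (hpie : Differentiable ℝ pie)
    (χ : ℝ → Exo ℓL ℓM → ℝ) (hχ : ∀ t, HasDerivAt χ (p.wind.Φ *ᵥ χ t) t) (pr : ℝ → ℝ)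
    (hpr : ∀ t, p.wind.Ψ ⬝ᵥ χ t = pr t) (dr : Differentiable ℝ pr) (t : ℝ) :
    HasDerivAt (fun t => Sum.elim (loadManifold p (θs t) ws Fs (pie t) (pr t))
        (sylv p.wind I *ᵥ χ t))
      (loadRhs p I Fs Fs ws (pie t) (p.wind.Ψ ⬝ᵥ χ t)
        (loadPriceManifold p ws Fs (pie t) (deriv pie t) (pr t) (deriv pr t))
        (Sum.elim (loadManifold p (θs t) ws Fs (pie t) (pr t)) (sylv p.wind I *ᵥ χ t))) t := by
  have h1 := (hpie t).hasDerivAt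
  have h2 := (dr t).hasDerivAt
  rw [hasDerivAt_pi]
  rintro (i | e)
  · revert i
    rw [forall_fin_three]
    simp only [loadRhs, loadManifold, Sum.elim_inl, Matrix.cons_val, hpr, loadPriceManifold]
    refine ⟨hθ t, ?_, ?_⟩
    · refine (hasDerivAt_const t ws).congr_deriv ?_
      field_simp
      ring
    · refine (((h2.sub h1).sub_const (p.D * ws)).sub_const Fs).congr_deriv ?_
      ring
  · have h6 : HasDerivAt (fun t => sylv p.wind I *ᵥ χ t)
        (sylv p.wind I *ᵥ (p.wind.Φ *ᵥ χ t)) t :=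
      ((sylv p.wind I).mulVecLin.toContinuousLinearMap.hasFDerivAt.comp_hasDerivAt t (hχ t))
    have h7 := (hasDerivAt_pi.mp h6) e
    have hd : (Sum.elim (loadManifold p (θs t) ws Fs (pie t) (pr t)) (sylv p.wind I *ᵥ χ t) :
        LoadState ℓL ℓM) (.inl 2) + pie t + Fs + p.D * ws = pr t := by
      simp only [loadManifold, Sum.elim_inl, Matrix.cons_val]
      ring
    simp only [Sum.elim_inr, loadRhs]
    refine h7.congr_deriv ?_
    rw [sylv_mulVec_Φ p.wind I hM, loadEtaDot, hpr, hd]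
    rfl

end Load

/-! ### Linearity of the local maps -/

section Linearity

variable {ℓL ℓM : ℕ}

lemma isLinearMap_of_combination {E F : Type} [AddCommGroup E] [Module ℝ E] [AddCommGroup F]
    [Module ℝ F] {f : E → F} (h : ∀ (c : ℝ) x y, f (c • x + y) = c • f x + f y) :
    IsLinearMap ℝ f := by
  have h0 : f 0 = 0 := by simpa using h 1 0 0
  exact ⟨fun x y => by simpa using h 1 x y, fun c x => by simpa [h0] using h c x 0⟩

lemma genHatLin_combination (p : GenParams ℓL ℓM) (d : GenDesign ℓL ℓM) (τ c : ℝ)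
    (x y : GenState ℓL ℓM) :
    genHatLin p d τ (c • x + y) = c • genHatLin p d τ x + genHatLin p d τ y := by
  have hη : (fun e => c * x (.inr e) + y (.inr e)) =
      c • (fun e => x (.inr e)) + fun e => y (.inr e) := rfl
  ext (i | e)
  · revert i
    rw [forall_fin_five]
    simp only [genHatLin, genHatFull, genHat, genManifold, genEtaDot, genDrive, hη, Sum.elim_inl,
      Matrix.cons_val, Pi.add_apply, Pi.smul_apply, smul_eq_mul, Matrix.mulVec_add,
      Matrix.mulVec_smul, dotProduct_add, dotProduct_smul]
    refine ⟨?_, ?_, ?_, ?_, ?_⟩ <;> ring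
  · simp only [genHatLin, genHatFull, genHat, genManifold, Sum.elim_inr,
      Matrix.cons_val, Pi.add_apply, Pi.smul_apply, smul_eq_mul, Pi.zero_apply]
    ring

lemma genControlLin_combination (p : GenParams ℓL ℓM) (d : GenDesign ℓL ℓM) (τ c : ℝ)
    (x y : GenState ℓL ℓM) :
    genControlLin p d τ (c • x + y) = c • genControlLin p d τ x + genControlLin p d τ y := by
  have hη : (fun e => c * x (.inr e) + y (.inr e)) =
      c • (fun e => x (.inr e)) + fun e => y (.inr e) := rfl
  have hy : genHat p d τ 0 0 0 0 0 (c • x + y) =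
      c • genHat p d τ 0 0 0 0 0 x + genHat p d τ 0 0 0 0 0 y := by
    ext i
    exact congrFun (genHatLin_combination p d τ c x y) (.inl i)
  have hη' : genEtaDot p d.im 0 0 0 (c • x + y) =
      c • genEtaDot p d.im 0 0 0 x + genEtaDot p d.im 0 0 0 y := by
    simp only [genEtaDot, genDrive, Pi.add_apply, Pi.smul_apply, smul_eq_mul, hη,
      Matrix.mulVec_add, Matrix.mulVec_smul]
    ext e
    simp only [Pi.add_apply, Pi.smul_apply, smul_eq_mul]
    ring
  ext i
  revert i
  rw [Fin.forall_fin_two]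
  simp only [genControlLin, genControl, hy, hη', hη, genPriceManifold, genRefManifold,
    Matrix.cons_val, Pi.add_apply, Pi.sub_apply, Pi.smul_apply, smul_eq_mul, Matrix.mulVec_add,
    Matrix.mulVec_smul, dotProduct_add, dotProduct_smul]
  constructor <;> ring

/-- Linearity is needed jointly in the state and in the inflow `s`, because in the network the
inflow is itself linear in the global state. -/
lemma genHatRhs_combination (p : GenParams ℓL ℓM) (d : GenDesign ℓL ℓM) (τ c s s' : ℝ)
    (x y : GenState ℓL ℓM) :
    genHatRhs p d τ (c * s + s') (c • x + y) = c • genHatRhs p d τ s x + genHatRhs p d τ s' y := by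
  have hη : (fun e => c * x (.inr e) + y (.inr e)) =
      c • (fun e => x (.inr e)) + fun e => y (.inr e) := rfl
  ext (i | e)
  · revert i
    rw [forall_fin_five]
    simp only [genHatRhs, hη, Sum.elim_inl,
      Matrix.cons_val, Pi.add_apply, Pi.smul_apply, smul_eq_mul, dotProduct_add, dotProduct_smul]
    refine ⟨?_, ?_, ?_, ?_, ?_⟩ <;> ring
  · simp only [genHatRhs, hη, Sum.elim_inr, Matrix.mulVec_add, Matrix.mulVec_smul,
      Pi.add_apply, Pi.sub_apply, Pi.smul_apply, smul_eq_mul]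
    ring

/-- The transformation is triangular in the order θ, w, η, P_M, P^E, P_v. P_v comes last because its
manifold contains the derivative of the estimate, which involves η, P_M and P^E. -/
lemma genHatLin_eq_zero (p : GenParams ℓL ℓM) (d : GenDesign ℓL ℓM) (τ : ℝ)
    (z : GenState ℓL ℓM) (h : genHatLin p d τ z = 0) : z = 0 := by
  obtain ⟨a, η, rfl⟩ : ∃ a η, z = Sum.elim a η := ⟨_, _, (Sum.elim_comp_inl_inr z).symm⟩
  rw [genHatLin_elim, genHat_zero p d τ a η _ rfl _ _ _ _ _ rfl rfl rfl rfl rfl] at h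
  have h0 : a 0 = 0 := congrFun h (.inl 0)
  have h1 := congrFun h (.inl 1)
  simp only [Sum.elim_inl, Matrix.cons_val, Pi.zero_apply, h0, mul_zero, add_zero] at h1
  have hη : η = 0 := by
    ext e
    have := congrFun h (.inr e)
    simpa [h1] using this
  subst hη
  have h2 := congrFun h (.inl 2)
  have h4 := congrFun h (.inl 4)
  have h3 := congrFun h (.inl 3)
  simp only [Sum.elim_inl, Matrix.cons_val, Pi.zero_apply, h0, h1, mul_zero, add_zero, sub_zero,
    dotProduct_zero] at h2 h4
  simp only [Sum.elim_inl, Matrix.cons_val, Pi.zero_apply, h0, h1, h2, h4, mul_zero, add_zero,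
    sub_zero, dotProduct_zero, genEtaDot, genDrive, Sum.elim_inr, neg_zero, zero_smul] at h3
  have h3' : a 3 = 0 := by
    have hz : (d.im.M *ᵥ fun _ => (0 : ℝ)) = 0 := d.im.M.mulVec_zero
    rwa [hz, dotProduct_zero, mul_zero, add_zero] at h3
  ext (i | e)
  · revert i
    rw [forall_fin_five]
    exact ⟨h0, h1, h2, h3', h4⟩
  · rfl

lemma loadHatLin_combination (p : LoadParams ℓL ℓM) (d : LoadDesign ℓL ℓM) (τ c : ℝ)
    (x y : LoadState ℓL ℓM) :
    loadHatLin p d τ (c • x + y) = c • loadHatLin p d τ x + loadHatLin p d τ y := by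
  have hη : (fun e => c * x (.inr e) + y (.inr e)) =
      c • (fun e => x (.inr e)) + fun e => y (.inr e) := rfl
  ext (i | e)
  · revert i
    rw [forall_fin_three]
    simp only [loadHatLin, loadHatFull, loadHat, loadManifold, hη, Sum.elim_inl,
      Matrix.cons_val, Pi.add_apply, Pi.smul_apply, smul_eq_mul, dotProduct_add, dotProduct_smul]
    refine ⟨?_, ?_, ?_⟩ <;> ring
  · simp only [loadHatLin, loadHatFull, loadHat, loadManifold, Sum.elim_inr,
      Matrix.cons_val, Pi.add_apply, Pi.smul_apply, smul_eq_mul, Pi.zero_apply]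
    ring

lemma loadControlLin_combination (p : LoadParams ℓL ℓM) (d : LoadDesign ℓL ℓM) (τ c : ℝ)
    (x y : LoadState ℓL ℓM) :
    loadControlLin p d τ (c • x + y) = c * loadControlLin p d τ x + loadControlLin p d τ y := by
  have hη : (fun e => c * x (.inr e) + y (.inr e)) =
      c • (fun e => x (.inr e)) + fun e => y (.inr e) := rfl
  have hy : loadHat p d τ 0 0 0 0 (c • x + y) =
      c • loadHat p d τ 0 0 0 0 x + loadHat p d τ 0 0 0 0 y := by
    ext i
    exact congrFun (loadHatLin_combination p d τ c x y) (.inl i)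
  simp only [loadControlLin, loadControl, hy, loadEtaDot, hη, loadPriceManifold,
    Pi.add_apply, Pi.smul_apply, smul_eq_mul, Matrix.mulVec_add,
    Matrix.mulVec_smul, dotProduct_add, dotProduct_smul]
  ring

lemma loadHatRhs_combination (p : LoadParams ℓL ℓM) (d : LoadDesign ℓL ℓM) (τ c s s' : ℝ)
    (x y : LoadState ℓL ℓM) :
    loadHatRhs p d τ (c * s + s') (c • x + y) =
      c • loadHatRhs p d τ s x + loadHatRhs p d τ s' y := by
  have hη : (fun e => c * x (.inr e) + y (.inr e)) =
      c • (fun e => x (.inr e)) + fun e => y (.inr e) := rfl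
  ext (i | e)
  · revert i
    rw [forall_fin_three]
    simp only [loadHatRhs, hη, Sum.elim_inl,
      Matrix.cons_val, Pi.add_apply, Pi.smul_apply, smul_eq_mul, dotProduct_add, dotProduct_smul]
    refine ⟨?_, ?_, ?_⟩ <;> ring
  · simp only [loadHatRhs, hη, Sum.elim_inr, Matrix.mulVec_add, Matrix.mulVec_smul,
      Pi.add_apply, Pi.sub_apply, Pi.smul_apply, smul_eq_mul]
    ring

lemma loadHatLin_eq_zero (p : LoadParams ℓL ℓM) (d : LoadDesign ℓL ℓM) (τ : ℝ)
    (z : LoadState ℓL ℓM) (h : loadHatLin p d τ z = 0) : z = 0 := by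
  obtain ⟨a, η, rfl⟩ : ∃ a η, z = Sum.elim a η := ⟨_, _, (Sum.elim_comp_inl_inr z).symm⟩
  rw [loadHatLin_elim, loadHat_zero p d τ a η _ _ _ rfl rfl rfl] at h
  have h0 : a 0 = 0 := congrFun h (.inl 0)
  have h1 := congrFun h (.inl 1)
  simp only [Sum.elim_inl, Matrix.cons_val, Pi.zero_apply, h0, mul_zero, add_zero] at h1
  have hη : η = 0 := by
    ext e
    have := congrFun h (.inr e)
    simpa [h1] using this
  subst hη
  have h2 := congrFun h (.inl 2)
  simp only [Sum.elim_inl, Matrix.cons_val, Pi.zero_apply, h0, h1, mul_zero, add_zero, sub_zero,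
    dotProduct_zero] at h2
  ext (i | e)
  · revert i
    rw [forall_fin_three]
    exact ⟨h0, h1, h2⟩
  · rfl

end Linearity

/-! ### Error dynamics of the network -/

section Parts

variable {G L Z : Type} {ℓL ℓM : ℕ}

lemma angle_combination (c : ℝ) (x y : Idx G L Z ℓL ℓM → ℝ) :
    angle (c • x + y) = c • angle x + angle y := by
  ext (g | l | z) <;> rfl

lemma angle_sub (x y : Idx G L Z ℓL ℓM → ℝ) : angle (x - y) = angle x - angle y := by
  ext (g | l | z) <;> rfl

lemma genPart_assemble (a : G → GenState ℓL ℓM) (b : L → LoadState ℓL ℓM) (c : Z → Fin 2 → ℝ)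
    (g : G) : genPart (assemble a b c) g = a g := rfl

lemma loadPart_assemble (a : G → GenState ℓL ℓM) (b : L → LoadState ℓL ℓM) (c : Z → Fin 2 → ℝ)
    (l : L) : loadPart (assemble a b c) l = b l := rfl

lemma zeroPart_assemble (a : G → GenState ℓL ℓM) (b : L → LoadState ℓL ℓM) (c : Z → Fin 2 → ℝ)
    (z : Z) : zeroPart (assemble a b c) z = c z := rfl

lemma genPart_sub (x y : Idx G L Z ℓL ℓM → ℝ) (g : G) :
    genPart (x - y) g = genPart x g - genPart y g := rfl

lemma loadPart_sub (x y : Idx G L Z ℓL ℓM → ℝ) (l : L) :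
    loadPart (x - y) l = loadPart x l - loadPart y l := rfl

lemma ext_parts {x y : Idx G L Z ℓL ℓM → ℝ} (hG : ∀ g, genPart x g = genPart y g)
    (hL : ∀ l, loadPart x l = loadPart y l) (hZ : ∀ z, zeroPart x z = zeroPart y z) : x = y := by
  ext (⟨g, a⟩ | ⟨l, a⟩ | ⟨z, a⟩)
  · exact congrFun (hG g) a
  · exact congrFun (hL l) a
  · exact congrFun (hZ z) a

end Parts

/-! ### Linear coordinates for the whole network. -/

section Net

variable {G L Z : Type} {ℓL ℓM : ℕ} [Fintype G] [Fintype L] [Fintype Z]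

/-- Separates the own angle, which the local design handles through τ, from the inflow, the only
coupling between buses. -/
lemma Network.flow_eq (net : Network G L Z ℓL ℓM) (θ : G ⊕ L ⊕ Z → ℝ) (i : G ⊕ L ⊕ Z) :
    net.flow θ i = net.tSum i * θ i - net.inflow θ i := by
  rw [Network.flow, Network.tSum, Network.inflow, Finset.sum_mul, ← Finset.sum_sub_distrib]
  exact Finset.sum_congr rfl fun j _ => by ring

lemma Network.inflow_combination (net : Network G L Z ℓL ℓM) (c : ℝ) (θ θ' : G ⊕ L ⊕ Z → ℝ)
    (i : G ⊕ L ⊕ Z) : net.inflow (c • θ + θ') i = c * net.inflow θ i + net.inflow θ' i := by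
  simp only [Network.inflow, Finset.mul_sum, ← Finset.sum_add_distrib]
  exact Finset.sum_congr rfl fun j _ => by
    simp only [Pi.add_apply, Pi.smul_apply, smul_eq_mul]
    ring

lemma Network.flow_sub (net : Network G L Z ℓL ℓM) (θ θ' : G ⊕ L ⊕ Z → ℝ)
    (i : G ⊕ L ⊕ Z) : net.flow (θ - θ') i = net.flow θ i - net.flow θ' i := by
  simp only [Network.flow, ← Finset.sum_sub_distrib]
  exact Finset.sum_congr rfl fun j _ => by
    simp only [Pi.sub_apply]
    ring

/-- A common rotation of all angles carries no power; this removes 2π w* t from the desired angles.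
-/
lemma Network.flow_add_const (net : Network G L Z ℓL ℓM) (θ : G ⊕ L ⊕ Z → ℝ) (c : ℝ)
    (i : G ⊕ L ⊕ Z) : net.flow (fun j => c + θ j) i = net.flow θ i := by
  simp only [Network.flow]
  exact Finset.sum_congr rfl fun j _ => by ring

/-- The transformed state as a linear function of the deviation from the manifold. -/
def hatLin (net : Network G L Z ℓL ℓM) (d : Design G L ℓL ℓM) :
    (Idx G L Z ℓL ℓM → ℝ) →ₗ[ℝ] (Idx G L Z ℓL ℓM → ℝ) :=
  IsLinearMap.mk' (fun z => assemble
    (fun g => genHatLin (net.gen g) (d.gen g) (net.tSum (.inl g)) (genPart z g))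
    (fun l => loadHatLin (net.load l) (d.load l) (net.tSum (.inr (.inl l))) (loadPart z l))
    (zeroPart z)) <| isLinearMap_of_combination fun c x y => by
      ext (⟨g, a⟩ | ⟨l, a⟩ | ⟨z, a⟩)
      · exact congrFun (genHatLin_combination _ _ _ c (genPart x g) (genPart y g)) a
      · exact congrFun (loadHatLin_combination _ _ _ c (loadPart x l) (loadPart y l)) a
      · rfl

lemma hatLin_apply (net : Network G L Z ℓL ℓM) (d : Design G L ℓL ℓM)
    (z : Idx G L Z ℓL ℓM → ℝ) : hatLin net d z = assemble
    (fun g => genHatLin (net.gen g) (d.gen g) (net.tSum (.inl g)) (genPart z g))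
    (fun l => loadHatLin (net.load l) (d.load l) (net.tSum (.inr (.inl l))) (loadPart z l))
    (zeroPart z) := rfl

/-- The input deviation as a linear function of the deviation from the manifold. -/
def controlLin (net : Network G L Z ℓL ℓM) (d : Design G L ℓL ℓM) :
    (Idx G L Z ℓL ℓM → ℝ) →ₗ[ℝ] (InIdx G L → ℝ) :=
  IsLinearMap.mk' (fun z => Sum.elim
    (fun q => genControlLin (net.gen q.1) (d.gen q.1) (net.tSum (.inl q.1)) (genPart z q.1) q.2)
    (fun l => loadControlLin (net.load l) (d.load l) (net.tSum (.inr (.inl l)))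
      (loadPart z l))) <| isLinearMap_of_combination fun c x y => by
      ext (⟨g, a⟩ | l)
      · exact congrFun (genControlLin_combination _ _ _ c (genPart x g) (genPart y g)) a
      · exact loadControlLin_combination _ _ _ c (loadPart x l) (loadPart y l)

lemma controlLin_apply (net : Network G L Z ℓL ℓM) (d : Design G L ℓL ℓM)
    (z : Idx G L Z ℓL ℓM → ℝ) : controlLin net d z = Sum.elim
    (fun q => genControlLin (net.gen q.1) (d.gen q.1) (net.tSum (.inl q.1)) (genPart z q.1) q.2)
    (fun l => loadControlLin (net.load l) (d.load l) (net.tSum (.inr (.inl l)))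
      (loadPart z l)) := rfl

/-- The closed-loop deviation dynamics. -/
def netErr (net : Network G L Z ℓL ℓM) (d : Design G L ℓL ℓM) (z : Idx G L Z ℓL ℓM → ℝ) :
    Idx G L Z ℓL ℓM → ℝ :=
  assemble
    (fun g => genErr (net.gen g) (d.gen g).im (net.flow (angle z) (.inl g))
      (genControlLin (net.gen g) (d.gen g) (net.tSum (.inl g)) (genPart z g)) (genPart z g))
    (fun l => loadErr (net.load l) (d.load l).im (net.flow (angle z) (.inr (.inl l)))
      (loadControlLin (net.load l) (d.load l) (net.tSum (.inr (.inl l))) (loadPart z l))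
      (loadPart z l))
    (fun b => zeroRhs (net.zero b) (net.flow (angle z) (.inr (.inr b))) (zeroPart z b))

lemma hatRhs_combination (net : Network G L Z ℓL ℓM) (d : Design G L ℓL ℓM) (c : ℝ)
    (x y : Idx G L Z ℓL ℓM → ℝ) :
    hatRhs net d (c • x + y) = c • hatRhs net d x + hatRhs net d y := by
  ext (⟨g, a⟩ | ⟨l, a⟩ | ⟨z, a⟩)
  · simp only [hatRhs, assemble, Sum.elim_inl, angle_combination, net.inflow_combination,
      Pi.add_apply, Pi.smul_apply]
    exact congrFun (genHatRhs_combination _ _ _ c _ _ (genPart x g) (genPart y g)) a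
  · simp only [hatRhs, assemble, Sum.elim_inl, Sum.elim_inr, angle_combination,
      net.inflow_combination, Pi.add_apply, Pi.smul_apply]
    exact congrFun (loadHatRhs_combination _ _ _ c _ _ (loadPart x l) (loadPart y l)) a
  · simp only [hatRhs, assemble, Sum.elim_inr, angle_combination,
      net.inflow_combination, Pi.add_apply, Pi.smul_apply]
    revert a
    rw [Fin.forall_fin_two]
    simp only [zeroHatRhs, zeroPart, Matrix.cons_val, Pi.add_apply, Pi.smul_apply, smul_eq_mul]
    constructor <;> ring

lemma closedLoop_mulVec (net : Network G L Z ℓL ℓM) (d : Design G L ℓL ℓM)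
    (y : Idx G L Z ℓL ℓM → ℝ) : closedLoop net d *ᵥ y = hatRhs net d y := by
  classical
  have hlin : IsLinearMap ℝ (hatRhs net d) := isLinearMap_of_combination (hatRhs_combination net d)
  obtain ⟨f, hf⟩ : ∃ f : (Idx G L Z ℓL ℓM → ℝ) →ₗ[ℝ] (Idx G L Z ℓL ℓM → ℝ),
      ∀ x, f x = hatRhs net d x := ⟨hlin.mk', fun _ => rfl⟩
  have hmat : closedLoop net d = LinearMap.toMatrix' f := by
    ext a b
    rw [LinearMap.toMatrix'_apply, hf, closedLoop, Matrix.of_apply]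
    congr 1
    ext c
    by_cases hcb : c = b
    · subst hcb
      simp
    · simp [hcb]
  rw [hmat, LinearMap.toMatrix'_mulVec, hf]

lemma hatLin_injective (net : Network G L Z ℓL ℓM) (d : Design G L ℓL ℓM) :
    Function.Injective (hatLin net d) := by
  rw [injective_iff_map_eq_zero]
  intro z hz
  rw [hatLin_apply] at hz
  refine ext_parts (fun g => ?_) (fun l => ?_) (fun b => ?_)
  · have h := congrArg (genPart · g) hz
    simp only [genPart_assemble] at h
    exact genHatLin_eq_zero _ _ _ _ h
  · have h := congrArg (loadPart · l) hz
    simp only [loadPart_assemble] at h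
    exact loadHatLin_eq_zero _ _ _ _ h
  · have h := congrArg (zeroPart · b) hz
    simp only [zeroPart_assemble] at h
    exact h

/-- The transformation leaves the angles alone, so the coupling is the same in both coordinates and
the local identities can be glued. -/
lemma angle_hatLin (net : Network G L Z ℓL ℓM) (d : Design G L ℓL ℓM)
    (z : Idx G L Z ℓL ℓM → ℝ) : angle (hatLin net d z) = angle z := by
  ext (g | l | b)
  · exact sub_zero _
  · exact sub_zero _
  · rfl

/-- Bus by bus this is the backstepping identity, with the flow split into τ times the own angle and
the inflow. -/
lemma hatLin_netErr (net : Network G L Z ℓL ℓM) (d : Design G L ℓL ℓM)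
    (z : Idx G L Z ℓL ℓM → ℝ) :
    hatLin net d (netErr net d z) = closedLoop net d *ᵥ hatLin net d z := by
  rw [closedLoop_mulVec, hatRhs, angle_hatLin, hatLin_apply, hatLin_apply]
  refine ext_parts (fun g => ?_) (fun l => ?_) (fun b => ?_)
  · rw [genPart_assemble, genPart_assemble, genPart_assemble, ← genHatLin_genErr, netErr,
      genPart_assemble, net.flow_eq]
    rfl
  · rw [loadPart_assemble, loadPart_assemble, loadPart_assemble, ← loadHatLin_loadErr, netErr,
      loadPart_assemble, net.flow_eq]
    rfl
  · rw [zeroPart_assemble, zeroPart_assemble, zeroPart_assemble, netErr, zeroPart_assemble,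
      zeroRhs, zeroHatRhs, net.flow_eq]
    have : angle z (.inr (.inr b)) = zeroPart z b 0 := rfl
    rw [this, add_sub_assoc]

end Net

/-! ### The manifold as reference trajectory. -/

section Signals

variable {G L Z : Type} {ℓL ℓM : ℕ} [Fintype G] [Fintype L] [Fintype Z]
  {net : Network G L Z ℓL ℓM} {op : SetPoint G L Z} {d : Design G L ℓL ℓM} {σ : Signals G L ℓL ℓM}

lemma hasDerivAt_dotProduct {ι : Type} [Fintype ι] {χ : ℝ → ι → ℝ} {χ' : ι → ℝ} {t : ℝ}
    (h : HasDerivAt χ χ' t) (r : ι → ℝ) : HasDerivAt (fun s => r ⬝ᵥ χ s) (r ⬝ᵥ χ') t := by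
  simp only [dotProduct]
  exact HasDerivAt.fun_sum fun i _ => ((hasDerivAt_pi.mp h) i).const_mul (r i)

section Exo

variable {ι : Type} [Fintype ι] {Φ : Matrix ι ι ℝ} {χ : ℝ → ι → ℝ}

lemma hasDerivAt_mulVec (hχ : ∀ t, HasDerivAt χ (Φ *ᵥ χ t) t) (A : Matrix ι ι ℝ) (t : ℝ) :
    HasDerivAt (fun s => A *ᵥ χ s) (A *ᵥ (Φ *ᵥ χ t)) t :=
  A.mulVecLin.toContinuousLinearMap.hasFDerivAt.comp_hasDerivAt t (hχ t)

lemma deriv_dotProduct (hχ : ∀ t, HasDerivAt χ (Φ *ᵥ χ t) t) (r : ι → ℝ) (t : ℝ) :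
    deriv (fun s => r ⬝ᵥ χ s) t = r ⬝ᵥ (Φ *ᵥ χ t) :=
  (hasDerivAt_dotProduct (hχ t) r).deriv

lemma deriv_deriv_dotProduct (hχ : ∀ t, HasDerivAt χ (Φ *ᵥ χ t) t) (r : ι → ℝ) (t : ℝ) :
    deriv (deriv (fun s => r ⬝ᵥ χ s)) t = r ⬝ᵥ (Φ *ᵥ (Φ *ᵥ χ t)) := by
  rw [funext (deriv_dotProduct hχ r)]
  exact (hasDerivAt_dotProduct (hasDerivAt_mulVec hχ Φ t) r).deriv

lemma differentiable_dotProduct (hχ : ∀ t, HasDerivAt χ (Φ *ᵥ χ t) t) (r : ι → ℝ) :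
    Differentiable ℝ (fun s => r ⬝ᵥ χ s) :=
  fun t => (hasDerivAt_dotProduct (hχ t) r).differentiableAt

lemma differentiable_deriv_dotProduct (hχ : ∀ t, HasDerivAt χ (Φ *ᵥ χ t) t) (r : ι → ℝ) :
    Differentiable ℝ (deriv fun s => r ⬝ᵥ χ s) := by
  rw [funext (deriv_dotProduct hχ r)]
  exact fun t => (hasDerivAt_dotProduct (hasDerivAt_mulVec hχ Φ t) r).differentiableAt

end Exo

/-- All internal models are Hurwitz and all Sylvester solutions are invertible. -/
def Regular (net : Network G L Z ℓL ℓM) (d : Design G L ℓL ℓM) : Prop :=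
  (∀ g, IsHurwitz (d.gen g).im.M ∧ IsUnit (sylv (net.gen g).wind (d.gen g).im)) ∧
  (∀ l, IsHurwitz (d.load l).im.M ∧ IsUnit (sylv (net.load l).wind (d.load l).im))

/-- Regularity supplies both facts behind the local identity: the estimates are exact at Tχ, and the
internal model moves Tχ to TΦχ. -/
lemma hat_eq (hR : Regular net d) (hσ : σ.Admissible net) (t : ℝ) (x : Idx G L Z ℓL ℓM → ℝ) :
    hat net op d σ t x = hatLin net d (x - manifold net op d σ t) := by
  ext (⟨g, a⟩ | ⟨l, a⟩ | ⟨b, a⟩)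
  · obtain ⟨hM, hU⟩ := hR.1 g
    refine congrFun (genHatFull_eq (net.gen g) (d.gen g) (net.tSum (.inl g)) _ _ _ _ _ _
      (deriv (fun s => (net.gen g).wind.Ψ₁ ⬝ᵥ σ.χG g s) t) _ _
      (estRow_dotProduct_sylv _ _ hU _ _) (estRow_dotProduct_sylv _ _ hU _ _) ?_ (genPart x g)) a
    rw [← add_dotProduct, Wind.Ψ₁_add_Ψ₂, ← sylv_mulVec_Φ _ _ hM, estRow_dotProduct_sylv _ _ hU,
      deriv_dotProduct (hσ.1 g)]
  · obtain ⟨hM, hU⟩ := hR.2 l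
    exact congrFun (loadHatFull_eq (net.load l) (d.load l) (net.tSum (.inr (.inl l))) _ _ _ _ _ _
      (estRow_dotProduct_sylv _ _ hU _ _) (loadPart x l)) a
  · revert a
    rw [Fin.forall_fin_two]
    exact ⟨rfl, rfl⟩

lemma control_eq (hR : Regular net d) (hσ : σ.Admissible net) (t : ℝ) (x : Idx G L Z ℓL ℓM → ℝ) :
    control net op d σ t x =
      inputManifold net op σ t + controlLin net d (x - manifold net op d σ t) := by
  ext (⟨g, a⟩ | l)
  · obtain ⟨hM, hU⟩ := hR.1 g
    have hd := deriv_dotProduct (hσ.1 g)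
    have hdd := deriv_deriv_dotProduct (hσ.1 g)
    refine congrFun (genControl_eq (net.gen g) (d.gen g) (net.tSum (.inl g)) _ _ _ _ _ _ _
      (deriv (fun s => (net.gen g).wind.Ψ₁ ⬝ᵥ σ.χG g s) t)
      (deriv (deriv (fun s => (net.gen g).wind.Ψ₁ ⬝ᵥ σ.χG g s)) t) _
      (deriv (fun s => (net.gen g).wind.Ψ₂ ⬝ᵥ σ.χG g s) t) _
      (sylv (net.gen g).wind (d.gen g).im *ᵥ ((net.gen g).wind.Φ *ᵥ σ.χG g t))
      (estRow_dotProduct_sylv _ _ hU _ _) (estRow_dotProduct_sylv _ _ hU _ _) ?_ ?_ ?_ ?_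
      (genPart x g)) a
    · rw [← add_dotProduct, Wind.Ψ₁_add_Ψ₂, ← sylv_mulVec_Φ _ _ hM]
    · rw [hd, estRow_dotProduct_sylv _ _ hU]
    · rw [hd, estRow_dotProduct_sylv _ _ hU]
    · rw [hdd, hd, hd, ← add_dotProduct, Wind.Ψ₁_add_Ψ₂, ← sylv_mulVec_Φ _ _ hM,
        estRow_dotProduct_sylv _ _ hU]
  · obtain ⟨hM, hU⟩ := hR.2 l
    refine loadControl_eq (net.load l) (d.load l) (net.tSum (.inr (.inl l))) _ _ _ _ _ _
      (deriv (fun s => (net.load l).wind.Ψ ⬝ᵥ σ.χL l s) t) _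
      (estRow_dotProduct_sylv _ _ hU _ _) ?_ (loadPart x l)
    rw [← sylv_mulVec_Φ _ _ hM, estRow_dotProduct_sylv _ _ hU, deriv_dotProduct (hσ.2.1 l)]

lemma plantRhs_control (hR : Regular net d) (hσ : σ.Admissible net) (t : ℝ)
    (x : Idx G L Z ℓL ℓM → ℝ) :
    plantRhs net op d σ t (control net op d σ t x) x =
      plantRhs net op d σ t (inputManifold net op σ t) (manifold net op d σ t) +
        netErr net d (x - manifold net op d σ t) := by
  have hu : control net op d σ t x - inputManifold net op σ t =
      controlLin net d (x - manifold net op d σ t) := by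
    rw [control_eq hR hσ, add_sub_cancel_left]
  rw [← sub_eq_iff_eq_add']
  generalize manifold net op d σ t = x' at hu ⊢
  generalize control net op d σ t x = u at hu ⊢
  generalize inputManifold net op σ t = u' at hu ⊢
  rw [controlLin_apply] at hu
  refine ext_parts (fun g => ?_) (fun l => ?_) (fun b => ?_)
  · have hug : (fun a => u (.inl (g, a))) - (fun a => u' (.inl (g, a))) =
        genControlLin (net.gen g) (d.gen g) (net.tSum (.inl g)) (genPart (x - x') g) :=
      funext fun a => congrFun hu (.inl (g, a))
    rw [netErr, genPart_assemble, ← hug, angle_sub, net.flow_sub]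
    rw [genPart_sub, genPart_sub, plantRhs, plantRhs, genPart_assemble, genPart_assemble,
      genRhs_sub]
  · have hul : u (.inr l) - u' (.inr l) =
        loadControlLin (net.load l) (d.load l) (net.tSum (.inr (.inl l))) (loadPart (x - x') l) :=
      congrFun hu (.inr l)
    rw [netErr, loadPart_assemble, ← hul, angle_sub, net.flow_sub]
    rw [loadPart_sub, loadPart_sub, plantRhs, plantRhs, loadPart_assemble, loadPart_assemble,
      loadRhs_sub]
  · rw [netErr, zeroPart_assemble, angle_sub, net.flow_sub]
    ext a
    revert a
    rw [Fin.forall_fin_two]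
    simp only [plantRhs, assemble, Sum.elim_inr, zeroRhs, zeroPart, Matrix.cons_val, Pi.sub_apply]
    constructor <;> ring

/-- The regulator equations: the manifolds are defined to solve the local dynamics, with the
Sylvester equation for η. Uncontrolled buses have no input to enforce constant frequency, so there
`op.Balanced` is needed. -/
lemma hasDerivAt_manifold (hR : Regular net d) (hop : op.Balanced net) (hσ : σ.Admissible net)
    (t : ℝ) : HasDerivAt (manifold net op d σ)
      (plantRhs net op d σ t (inputManifold net op σ t) (manifold net op d σ t)) t := by
  have hflow : ∀ i, net.flow (angle (manifold net op d σ t)) i = net.flow op.θ i := by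
    intro i
    rw [← net.flow_add_const op.θ (2 * Real.pi * op.w * t) i]
    congr 1
    ext (g | l | b) <;> rfl
  have hangle : ∀ i t, HasDerivAt (op.angle i) (2 * Real.pi * op.w) t := by
    intro i t
    have := ((hasDerivAt_id t).const_mul (2 * Real.pi * op.w)).add_const (op.θ i)
    rw [mul_one] at this
    exact this
  rw [hasDerivAt_pi]
  rintro (⟨g, a⟩ | ⟨l, a⟩ | ⟨b, a⟩)
  · have h := hasDerivAt_pi.mp (hasDerivAt_genManifold (net.gen g) (d.gen g).im (hR.1 g).1
      (op.angle (.inl g)) op.w (net.flow op.θ (.inl g)) (hangle _) (σ.pieG g) (hσ.2.2.1 g).1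
      (hσ.2.2.1 g).2 (σ.χG g) (hσ.1 g) _ _ (fun _ => rfl) (fun _ => rfl)
      (differentiable_dotProduct (hσ.1 g) _) (differentiable_deriv_dotProduct (hσ.1 g) _)
      (differentiable_dotProduct (hσ.1 g) _) t) a
    refine h.congr_deriv ?_
    simp only [plantRhs, assemble, Sum.elim_inl, hflow]
    refine congrFun (congrArg (fun u => genRhs _ _ _ _ _ _ _ u _) ?_) a
    ext i
    rfl
  · have h := hasDerivAt_pi.mp (hasDerivAt_loadManifold (net.load l) (d.load l).im (hR.2 l).1
      (op.angle (.inr (.inl l))) op.w (net.flow op.θ (.inr (.inl l))) (hangle _) (σ.pieL l)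
      (hσ.2.2.2 l).1 (σ.χL l) (hσ.2.1 l) _ (fun _ => rfl)
      (differentiable_dotProduct (hσ.2.1 l) _) t) a
    refine h.congr_deriv ?_
    simp only [plantRhs, assemble, Sum.elim_inl, Sum.elim_inr, hflow]
    rfl
  · simp only [plantRhs, assemble, Sum.elim_inr, hflow]
    revert a
    rw [Fin.forall_fin_two]
    refine ⟨hangle _ t, ?_⟩
    refine (hasDerivAt_const t op.w).congr_deriv ?_
    have h : (net.zero b).D * zeroPart (manifold net op d σ t) b 1 +
        net.flow op.θ (.inr (.inr b)) = 0 := hop b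
    simp only [zeroRhs, Matrix.cons_val, h, mul_zero]

end Signals

/-! ### Exponential stability of linear systems -/

section Decay

open Polynomial

variable {ι : Type} [Fintype ι]

/-- Variation of constants: multiplying x by exp(-z (t - t₀)) leaves only the input, whose norm is
at most K exp(β (t - t₀)) ‖x t₀‖ with β = -Re z - α > 0. -/
lemma norm_le_of_hasDerivWithinAt_add {E : Type} [NormedAddCommGroup E] [NormedSpace ℂ E]
    {x u : ℝ → E} {z : ℂ} {t₀ α K : ℝ} (hz : z.re < -α) (hK : 0 ≤ K)
    (hx : ∀ t, t₀ ≤ t → HasDerivWithinAt x (z • x t + u t) (Set.Ici t₀) t)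
    (hu : ∀ t, t₀ ≤ t → ‖u t‖ ≤ K * Real.exp (-α * (t - t₀)) * ‖x t₀‖) (t : ℝ) (ht : t₀ ≤ t) :
    ‖x t‖ ≤ (1 + K / (-z.re - α)) * Real.exp (-α * (t - t₀)) * ‖x t₀‖ := by
  set β := -z.re - α with hβ
  have hβ0 : 0 < β := by rw [hβ]; linarith
  have hexp : ∀ s : ℝ, ‖Complex.exp (-z * ((s - t₀ : ℝ) : ℂ))‖ = Real.exp (-z.re * (s - t₀)) := by
    intro s
    rw [Complex.norm_exp]
    simp
  have hE : ∀ s : ℝ, HasDerivAt (fun s : ℝ => Complex.exp (-z * ((s - t₀ : ℝ) : ℂ)))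
      (Complex.exp (-z * ((s - t₀ : ℝ) : ℂ)) * -z) s := by
    intro s
    have h1 : HasDerivAt (fun s : ℝ => -z * ((s - t₀ : ℝ) : ℂ)) (-z) s := by
      have h2 : HasDerivAt (fun s : ℝ => ((s - t₀ : ℝ) : ℂ)) ((1 : ℝ) : ℂ) s :=
        ((hasDerivAt_id s).sub_const t₀).ofReal_comp
      simpa using h2.const_mul (-z)
    exact h1.cexp
  have hy : ∀ s, t₀ ≤ s → HasDerivWithinAt (fun s => Complex.exp (-z * ((s - t₀ : ℝ) : ℂ)) • x s)
      (Complex.exp (-z * ((s - t₀ : ℝ) : ℂ)) • u s) (Set.Ici t₀) s := by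
    intro s hs
    refine ((hE s).hasDerivWithinAt.smul (hx s hs)).congr_deriv ?_
    module
  -- The majorant integrates this bound; the summand 1 covers the initial value.
  have hB : ∀ s : ℝ, HasDerivAt
      (fun s => ‖x t₀‖ * (1 + K / β * Real.exp (β * (s - t₀))))
      (‖x t₀‖ * (K * Real.exp (β * (s - t₀)))) s := by
    intro s
    have h1 : HasDerivAt (fun s : ℝ => β * (s - t₀)) β s := by
      simpa using ((hasDerivAt_id s).sub_const t₀).const_mul β
    refine ((((h1.exp).const_mul (K / β)).const_add 1).const_mul ‖x t₀‖).congr_deriv ?_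
    field_simp
  have hmain := image_norm_le_of_norm_deriv_right_le_deriv_boundary (a := t₀) (b := t)
    (f := fun s => Complex.exp (-z * ((s - t₀ : ℝ) : ℂ)) • x s)
    (f' := fun s => Complex.exp (-z * ((s - t₀ : ℝ) : ℂ)) • u s)
    (fun s hs => ((hy s hs.1).continuousWithinAt).mono Set.Icc_subset_Ici_self)
    (fun s hs => (hy s hs.1).mono (Set.Ici_subset_Ici.mpr hs.1))
    (by
      simp only [sub_self, Complex.ofReal_zero, mul_zero, Complex.exp_zero, one_smul, Real.exp_zero,
        mul_one]
      have : 0 ≤ ‖x t₀‖ * (K / β) := by positivity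
      linarith)
    hB
    (by
      intro s hs
      rw [norm_smul, hexp]
      calc Real.exp (-z.re * (s - t₀)) * ‖u s‖
          ≤ Real.exp (-z.re * (s - t₀)) * (K * Real.exp (-α * (s - t₀)) * ‖x t₀‖) := by
            gcongr
            exact hu s hs.1
        _ = ‖x t₀‖ * (K * (Real.exp (-z.re * (s - t₀)) * Real.exp (-α * (s - t₀)))) := by ring
        _ = ‖x t₀‖ * (K * Real.exp (β * (s - t₀))) := by
            rw [← Real.exp_add, hβ]
            congr 3
            ring)
    (Set.right_mem_Icc.mpr ht)
  rw [norm_smul, hexp] at hmain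
  have h1 : ‖x t‖ = Real.exp (z.re * (t - t₀)) * (Real.exp (-z.re * (t - t₀)) * ‖x t‖) := by
    rw [← mul_assoc, ← Real.exp_add]
    simp
  have h2 : Real.exp (z.re * (t - t₀)) * Real.exp (β * (t - t₀)) = Real.exp (-α * (t - t₀)) := by
    rw [← Real.exp_add, hβ]
    congr 1
    ring
  calc ‖x t‖ = Real.exp (z.re * (t - t₀)) * (Real.exp (-z.re * (t - t₀)) * ‖x t‖) := h1
    _ ≤ Real.exp (z.re * (t - t₀)) * (‖x t₀‖ * (1 + K / β * Real.exp (β * (t - t₀)))) := by gcongr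
    _ = ‖x t₀‖ * (Real.exp (z.re * (t - t₀)) +
        K / β * (Real.exp (z.re * (t - t₀)) * Real.exp (β * (t - t₀)))) := by ring
    _ ≤ ‖x t₀‖ * (Real.exp (-α * (t - t₀)) + K / β * Real.exp (-α * (t - t₀))) := by
        rw [h2]
        gcongr
    _ = _ := by ring

/-- The strict gap lets repeated eigenvalues be treated without polynomial factors. -/
lemma exists_pos_lt_neg_re (zs : List ℂ) (h : ∀ z ∈ zs, z.re < 0) :
    ∃ α : ℝ, 0 < α ∧ ∀ z ∈ zs, z.re < -α := by
  induction zs with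
  | nil => exact ⟨1, one_pos, by simp⟩
  | cons z zs ih =>
    obtain ⟨α, hα, hzs⟩ := ih fun w hw => h w (List.mem_cons_of_mem _ hw)
    have hz := h z List.mem_cons_self
    refine ⟨min α (-z.re / 2), lt_min hα (by linarith), fun w hw => ?_⟩
    rcases List.mem_cons.mp hw with rfl | hw
    · have := min_le_right α (-w.re / 2)
      linarith
    · have := min_le_left α (-z.re / 2)
      have := hzs w hw
      linarith

lemma map_ofReal_mulVec (A : Matrix ι ι ℝ) (y : ι → ℝ) :
    A.map (algebraMap ℝ ℂ) *ᵥ (fun i => (y i : ℂ)) = fun i => ((A *ᵥ y) i : ℂ) := by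
  ext i
  simp [Matrix.mulVec, dotProduct]

/-- If all solutions of `y' = A y` tend to zero, then `A` is Hurwitz. -/
lemma isHurwitz_of_tendsto {A : Matrix ι ι ℝ}
    (h : ∀ y : ℝ → ι → ℝ, (∀ t, HasDerivAt y (A *ᵥ y t) t) →
      Filter.Tendsto y Filter.atTop (nhds 0)) : IsHurwitz A := by
  intro z v hv hz
  by_contra hre
  push Not at hre
  obtain ⟨a, ha⟩ := Function.ne_iff.mp hv
  let w : ℝ → ι → ℂ := fun t i => Complex.exp (z * (t : ℂ)) * v i
  have hw : ∀ t i, HasDerivAt (fun t => w t i) ((A.map (algebraMap ℝ ℂ) *ᵥ w t) i) t := by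
    intro t i
    have h1 : HasDerivAt (fun s : ℝ => z * (s : ℂ)) z t := by
      have h2 : HasDerivAt (fun s : ℝ => (s : ℂ)) ((1 : ℝ) : ℂ) t := (hasDerivAt_id t).ofReal_comp
      simpa using h2.const_mul z
    refine ((h1.cexp).mul_const (v i)).congr_deriv ?_
    have h3 : w t = Complex.exp (z * (t : ℂ)) • v := rfl
    rw [h3, Matrix.mulVec_smul, hz]
    simp only [Pi.smul_apply, smul_eq_mul]
    ring
  -- A is real, so a real-linear functional applied componentwise to exp(zt) v gives a real
  -- solution; real and imaginary parts together bound the modulus, which does not decay when Re z ≥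
  -- 0.
  have hpart : ∀ f : ℂ →L[ℝ] ℝ, Filter.Tendsto (fun t => f (w t a)) Filter.atTop (nhds 0) := by
    intro f
    have := h (fun t i => f (w t i)) (fun t => by
      rw [hasDerivAt_pi]
      intro i
      refine (f.hasFDerivAt.comp_hasDerivAt t (hw t i)).congr_deriv ?_
      simp only [Matrix.mulVec, dotProduct, Matrix.map_apply, map_sum]
      refine Finset.sum_congr rfl fun j _ => ?_
      rw [← Algebra.smul_def, map_smul, smul_eq_mul])
    simpa using (tendsto_pi_nhds.mp this) a
  have hre' := hpart Complex.reCLM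
  have him' := hpart Complex.imCLM
  have hsq : Filter.Tendsto (fun t => ‖w t a‖ ^ 2) Filter.atTop (nhds 0) := by
    have := (hre'.mul hre').add (him'.mul him')
    simp only [mul_zero, add_zero] at this
    refine this.congr fun t => ?_
    rw [← Complex.normSq_eq_norm_sq, Complex.normSq_apply]
    rfl
  have hle : ∀ᶠ t : ℝ in Filter.atTop, ‖v a‖ ^ 2 ≤ ‖w t a‖ ^ 2 := by
    filter_upwards [Filter.eventually_ge_atTop 0] with t ht
    have h1 : ‖w t a‖ = Real.exp (z.re * t) * ‖v a‖ := by
      simp only [w, norm_mul, Complex.norm_exp]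
      simp
    have h2 : 1 ≤ Real.exp (z.re * t) := Real.one_le_exp (mul_nonneg hre ht)
    rw [h1]
    have := norm_nonneg (v a)
    gcongr
    nlinarith
  have h0 : ‖v a‖ ^ 2 ≤ 0 := ge_of_tendsto hsq hle
  have h1 : 0 < ‖v a‖ := norm_pos_iff.mpr ha
  nlinarith

lemma exists_norm_le {E F : Type} [NormedAddCommGroup E] [NormedSpace ℝ E] [FiniteDimensional ℝ E]
    [NormedAddCommGroup F] [NormedSpace ℝ F] (f : E →ₗ[ℝ] F) :
    ∃ C : ℝ, 0 < C ∧ ∀ x, ‖f x‖ ≤ C * ‖x‖ :=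
  ⟨‖f.toContinuousLinearMap‖ + 1, by positivity, fun x =>
    (f.toContinuousLinearMap.le_opNorm x).trans (by
      have := norm_nonneg x
      gcongr
      linarith)⟩

variable [DecidableEq ι]

/-- Solutions of `x' = A x` that are annihilated by `∏ (A - z)` decay if all `z` have negative
real parts. -/
lemma exists_decay_of_roots (A : Matrix ι ι ℂ) (α : ℝ) (zs : List ℂ)
    (hzs : ∀ z ∈ zs, z.re < -α) :
    ∃ K : ℝ, 0 ≤ K ∧ ∀ (t₀ : ℝ) (x : ℝ → ι → ℂ),
      (∀ t, t₀ ≤ t → HasDerivWithinAt x (A *ᵥ x t) (Set.Ici t₀) t) →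
      (∀ t, t₀ ≤ t → aeval A (zs.map fun z => X - C z).prod *ᵥ x t = 0) →
      ∀ t, t₀ ≤ t → ‖x t‖ ≤ K * Real.exp (-α * (t - t₀)) * ‖x t₀‖ := by
  induction zs with
  | nil =>
    refine ⟨0, le_rfl, fun t₀ x _ h t ht => ?_⟩
    have := h t ht
    simp only [List.map_nil, List.prod_nil, map_one, Matrix.one_mulVec] at this
    simp [this]
  | cons z zs ih =>
    obtain ⟨K', hK', hdec⟩ := ih fun w hw => hzs w (List.mem_cons_of_mem _ hw)
    have hz := hzs z List.mem_cons_self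
    -- (A - z) x solves the same equation and is annihilated by the remaining factors, so it decays
    -- by induction; x' = z x + (A - z) x is then a scalar equation with decaying input.
    let S : (ι → ℂ) →L[ℂ] (ι → ℂ) := (A - z • (1 : Matrix ι ι ℂ)).mulVecLin.toContinuousLinearMap
    have hS : ∀ v, S v = A *ᵥ v - z • v := fun v => by
      simp [S]
    refine ⟨1 + K' * ‖S‖ / (-z.re - α), ?_, fun t₀ x hx hann t ht => ?_⟩
    · have : 0 < -z.re - α := by linarith
      positivity
    have hu : ∀ s, t₀ ≤ s → HasDerivWithinAt (fun s => S (x s)) (A *ᵥ S (x s)) (Set.Ici t₀) s := by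
      intro s hs
      refine (((S.restrictScalars ℝ).hasFDerivAt.comp_hasDerivWithinAt s (hx s hs))).congr_deriv ?_
      simp only [ContinuousLinearMap.coe_restrictScalars', hS, Matrix.mulVec_sub,
        Matrix.mulVec_smul]
    have huann : ∀ s, t₀ ≤ s → aeval A (zs.map fun z => X - C z).prod *ᵥ S (x s) = 0 := by
      intro s hs
      have h := hann s hs
      rw [List.map_cons, List.prod_cons, mul_comm, map_mul, ← Matrix.mulVec_mulVec] at h
      rw [← h, hS]
      congr 1
      simp [Matrix.sub_mulVec, Algebra.algebraMap_eq_smul_one, Matrix.smul_mulVec]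
    refine norm_le_of_hasDerivWithinAt_add (u := fun s => S (x s)) (K := K' * ‖S‖) hz (by positivity)
      (fun s hs => ?_) (fun s hs => ?_) t ht
    · refine (hx s hs).congr_deriv ?_
      rw [hS]
      abel
    · calc ‖S (x s)‖ ≤ K' * Real.exp (-α * (s - t₀)) * ‖S (x t₀)‖ := hdec t₀ _ hu huann s hs
        _ ≤ K' * Real.exp (-α * (s - t₀)) * (‖S‖ * ‖x t₀‖) := by
          gcongr
          exact S.le_opNorm _
        _ = _ := by ring

/-- Solutions of `y' = A y` with a Hurwitz matrix `A` decay exponentially. -/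
lemma IsHurwitz.exists_decay {A : Matrix ι ι ℝ} (hA : IsHurwitz A) :
    ∃ C α : ℝ, 0 ≤ C ∧ 0 < α ∧ ∀ (t₀ : ℝ) (y : ℝ → ι → ℝ),
      (∀ t, t₀ ≤ t → HasDerivWithinAt y (A *ᵥ y t) (Set.Ici t₀) t) →
      ∀ t, t₀ ≤ t → ‖y t‖ ≤ C * Real.exp (-α * (t - t₀)) * ‖y t₀‖ := by
  set B := A.map (algebraMap ℝ ℂ) with hB
  obtain ⟨α, hα, hroots⟩ := exists_pos_lt_neg_re B.charpoly.roots.toList (by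
    intro z hz
    rw [Multiset.mem_toList, mem_roots B.charpoly_monic.ne_zero] at hz
    obtain ⟨v, hv, h⟩ := exists_eigenvector_of_isRoot_charpoly hz
    exact hA z v hv h)
  obtain ⟨C, hC, hdec⟩ := exists_decay_of_roots B α _ hroots
  -- By Cayley–Hamilton the full list of roots annihilates every solution.
  have hprod : (B.charpoly.roots.toList.map fun z => X - Polynomial.C z).prod = B.charpoly := by
    conv_rhs => rw [(IsAlgClosed.splits B.charpoly).eq_prod_roots_of_monic B.charpoly_monic]
    rw [← Multiset.prod_coe, ← Multiset.map_coe, Multiset.coe_toList]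
  refine ⟨C, α, hC, hα, fun t₀ y hy t ht => ?_⟩
  have hnorm : ∀ v : ι → ℝ, ‖fun i => (v i : ℂ)‖ = ‖v‖ := by
    intro v
    simp [Pi.norm_def]
  have := hdec t₀ (fun t i => (y t i : ℂ)) (fun s hs => by
    rw [map_ofReal_mulVec, hasDerivWithinAt_pi]
    exact fun i => (hasDerivWithinAt_pi.mp (hy s hs) i).ofReal_comp) (fun s hs => by
    rw [hprod, Matrix.aeval_self_charpoly, Matrix.zero_mulVec]) t ht
  rwa [hnorm, hnorm] at this

end Decay

/-! ### Convergence of the closed loop -/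

/-- Uniform convergence over all signals says something about A only because some signals exist. -/
lemma exists_admissible_signals {G L Z : Type} {ℓL ℓM : ℕ} (net : Network G L Z ℓL ℓM) :
    ∃ σ : Signals G L ℓL ℓM, σ.Admissible net := by
  refine ⟨⟨fun _ _ => 0, fun _ _ => 0, fun _ _ => 0, fun _ _ => 0⟩, ?_, ?_, ?_, ?_⟩
  · intro g t
    simpa using hasDerivAt_const t (0 : Exo ℓL ℓM → ℝ)
  · intro l t
    simpa using hasDerivAt_const t (0 : Exo ℓL ℓM → ℝ)
  · intro g
    simp
  · intro l
    simp

section Convergence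

variable {G L Z : Type} {ℓL ℓM : ℕ} [Fintype G] [Fintype L] [Fintype Z]
  {net : Network G L Z ℓL ℓM} {op : SetPoint G L Z} {d : Design G L ℓL ℓM} {σ : Signals G L ℓL ℓM}

lemma hasDerivWithinAt_hat (hR : Regular net d) (hop : op.Balanced net) (hσ : σ.Admissible net)
    {t₀ : ℝ} {x : ℝ → Idx G L Z ℓL ℓM → ℝ} (hx : IsSolution net op d σ t₀ x) (t : ℝ)
    (ht : t₀ ≤ t) :
    HasDerivWithinAt (fun s => hat net op d σ s (x s))
      (closedLoop net d *ᵥ hat net op d σ t (x t)) (Set.Ici t₀) t := by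
  simp only [hat_eq hR hσ]
  have h := (hx t ht).sub (hasDerivAt_manifold hR hop hσ t).hasDerivWithinAt
  rw [plantRhs_control hR hσ, add_sub_cancel_left] at h
  rw [← hatLin_netErr]
  exact (hatLin net d).toContinuousLinearMap.hasFDerivAt.comp_hasDerivWithinAt t h

lemma isSolution_of_hasDerivAt (hR : Regular net d) (hop : op.Balanced net)
    (hσ : σ.Admissible net) (t₀ : ℝ) {z : ℝ → Idx G L Z ℓL ℓM → ℝ}
    (hz : ∀ t, HasDerivAt z (netErr net d (z t)) t) :
    IsSolution net op d σ t₀ (fun t => manifold net op d σ t + z t) := by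
  intro t _
  rw [plantRhs_control hR hσ, add_sub_cancel_left]
  exact ((hasDerivAt_manifold hR hop hσ t).add (hz t)).hasDerivWithinAt

/-- The constants come from A, `hatLin`, a left inverse of it and `controlLin`; none of these
involves the signals, whence uniformity. -/
lemma exists_expConv (hR : Regular net d) (hop : op.Balanced net)
    (hA : IsHurwitz (closedLoop net d)) :
    ∃ C α : ℝ, 0 < C ∧ 0 < α ∧ ∀ σ : Signals G L ℓL ℓM, σ.Admissible net →
      ExpConv net op d σ C α := by
  classical
  obtain ⟨C, α, hC, hα, hdec⟩ := hA.exists_decay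
  obtain ⟨g, hg⟩ := (hatLin net d).exists_leftInverse_of_injective
    (LinearMap.ker_eq_bot.mpr (hatLin_injective net d))
  have hg' : ∀ z, g (hatLin net d z) = z := fun z => LinearMap.congr_fun hg z
  obtain ⟨C₁, hC₁, h₁⟩ := exists_norm_le
    ((WithLp.linearEquiv 2 ℝ (Idx G L Z ℓL ℓM → ℝ)).symm.toLinearMap ∘ₗ g)
  obtain ⟨C₂, hC₂, h₂⟩ := exists_norm_le
    ((WithLp.linearEquiv 2 ℝ (InIdx G L → ℝ)).symm.toLinearMap ∘ₗ controlLin net d ∘ₗ g)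
  obtain ⟨C₃, hC₃, h₃⟩ := exists_norm_le
    (hatLin net d ∘ₗ (WithLp.linearEquiv 2 ℝ (Idx G L Z ℓL ℓM → ℝ)).toLinearMap)
  -- C is only nonnegative, hence C + 1; C₁ serves the states and C₂ the inputs.
  refine ⟨(C₁ + C₂) * (C + 1) * C₃, α, by positivity, hα, fun σ hσ t₀ x hx t ht => ?_⟩
  have hy := hdec t₀ _ (hasDerivWithinAt_hat hR hop hσ hx) t ht
  simp only [hat_eq hR hσ] at hy
  have hu : control net op d σ t (x t) - inputManifold net op σ t =
      controlLin net d (x t - manifold net op d σ t) := by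
    rw [control_eq hR hσ, add_sub_cancel_left]
  rw [hu]
  generalize x t - manifold net op d σ t = z at hy ⊢
  generalize x t₀ - manifold net op d σ t₀ = z₀ at hy ⊢
  have e₁ := h₁ (hatLin net d z)
  have e₂ := h₂ (hatLin net d z)
  have e₃ := h₃ (WithLp.toLp 2 z₀)
  simp only [LinearMap.comp_apply, hg'] at e₁ e₂
  have e₃' : ‖hatLin net d z₀‖ ≤ C₃ * ‖WithLp.toLp 2 z₀‖ := e₃
  have hbound : ‖hatLin net d z‖ ≤
      (C + 1) * C₃ * Real.exp (-α * (t - t₀)) * ‖WithLp.toLp 2 z₀‖ := by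
    calc _ ≤ C * Real.exp (-α * (t - t₀)) * ‖hatLin net d z₀‖ := hy
      _ ≤ (C + 1) * Real.exp (-α * (t - t₀)) * (C₃ * ‖WithLp.toLp 2 z₀‖) := by
        gcongr
        linarith
      _ = _ := by ring
  constructor
  · calc _ ≤ C₁ * ‖hatLin net d z‖ := e₁
      _ ≤ C₁ * ((C + 1) * C₃ * Real.exp (-α * (t - t₀)) * ‖WithLp.toLp 2 z₀‖) := by gcongr
      _ ≤ (C₁ + C₂) * ((C + 1) * C₃ * Real.exp (-α * (t - t₀)) * ‖WithLp.toLp 2 z₀‖) := by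
        gcongr
        linarith
      _ = _ := by ring
  · calc _ ≤ C₂ * ‖hatLin net d z‖ := e₂
      _ ≤ C₂ * ((C + 1) * C₃ * Real.exp (-α * (t - t₀)) * ‖WithLp.toLp 2 z₀‖) := by gcongr
      _ ≤ (C₁ + C₂) * ((C + 1) * C₃ * Real.exp (-α * (t - t₀)) * ‖WithLp.toLp 2 z₀‖) := by
        gcongr
        linarith
      _ = _ := by ring

/-- Each solution of y' = Ay is pulled back through `hatLin` and added to the manifold; the result
is a closed-loop trajectory, and its convergence makes y decay. -/
lemma isHurwitz_of_expConv (hR : Regular net d) (hop : op.Balanced net) (hσ : σ.Admissible net)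
    {C α : ℝ} (hα : 0 < α) (h : ExpConv net op d σ C α) : IsHurwitz (closedLoop net d) := by
  classical
  apply isHurwitz_of_tendsto
  intro y hy
  let e := LinearEquiv.ofInjectiveEndo (hatLin net d) (hatLin_injective net d)
  have he : ∀ z, e z = hatLin net d z := fun z => rfl
  have hz : ∀ t, HasDerivAt (fun t => e.symm (y t)) (netErr net d (e.symm (y t))) t := by
    intro t
    have h1 : netErr net d (e.symm (y t)) = e.symm (closedLoop net d *ᵥ y t) := by
      rw [LinearEquiv.eq_symm_apply, he, hatLin_netErr, ← he, LinearEquiv.apply_symm_apply]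
    rw [h1]
    exact e.symm.toLinearMap.toContinuousLinearMap.hasFDerivAt.comp_hasDerivAt t (hy t)
  have hconv := h 0 _ (isSolution_of_hasDerivAt hR hop hσ 0 hz)
  simp only [add_sub_cancel_left, sub_zero] at hconv
  obtain ⟨C₃, hC₃, h₃⟩ := exists_norm_le
    (hatLin net d ∘ₗ (WithLp.linearEquiv 2 ℝ (Idx G L Z ℓL ℓM → ℝ)).toLinearMap)
  have hbound : ∀ᶠ t : ℝ in Filter.atTop, ‖y t‖ ≤
      C₃ * (C * Real.exp (-α * t) * ‖WithLp.toLp 2 (e.symm (y 0))‖) := by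
    filter_upwards [Filter.eventually_ge_atTop 0] with t ht
    have h1 : ‖hatLin net d (e.symm (y t))‖ ≤ C₃ * ‖WithLp.toLp 2 (e.symm (y t))‖ :=
      h₃ (WithLp.toLp 2 (e.symm (y t)))
    rw [← he, LinearEquiv.apply_symm_apply] at h1
    exact h1.trans (mul_le_mul_of_nonneg_left (hconv t ht).1 hC₃.le)
  refine squeeze_zero_norm' hbound ?_
  have hexp : Filter.Tendsto (fun t : ℝ => Real.exp (-α * t)) Filter.atTop (nhds 0) := by
    refine Real.tendsto_exp_atBot.comp ?_
    exact Filter.tendsto_id.const_mul_atTop_of_neg (neg_lt_zero.mpr hα)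
  have := ((hexp.const_mul C).mul_const ‖WithLp.toLp 2 (e.symm (y 0))‖).const_mul C₃
  simpa using this

end Convergence

/-! ### Small gain with small imaginary part -/

section Tame

/-- `z` has modulus at most `A` and imaginary part at most `A |ω|`. -/
def Tame (ω A : ℝ) (z : ℂ) : Prop := ‖z‖ ≤ A ∧ |z.im| ≤ A * |ω|

variable {ω A B : ℝ} {z w : ℂ}

lemma Tame.nonneg (h : Tame ω A z) : 0 ≤ A := (norm_nonneg z).trans h.1

lemma Tame.mono (h : Tame ω A z) (hAB : A ≤ B) : Tame ω B z :=
  ⟨h.1.trans hAB, h.2.trans (mul_le_mul_of_nonneg_right hAB (abs_nonneg ω))⟩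

lemma Tame.add (hz : Tame ω A z) (hw : Tame ω B w) : Tame ω (A + B) (z + w) := by
  refine ⟨(norm_add_le z w).trans (add_le_add hz.1 hw.1), ?_⟩
  rw [Complex.add_im, add_mul]
  exact (abs_add_le _ _).trans (add_le_add hz.2 hw.2)

lemma Tame.neg (hz : Tame ω A z) : Tame ω A (-z) := by
  refine ⟨by rw [norm_neg]; exact hz.1, ?_⟩
  rw [Complex.neg_im, abs_neg]
  exact hz.2

lemma Tame.sub (hz : Tame ω A z) (hw : Tame ω B w) : Tame ω (A + B) (z - w) := by
  rw [sub_eq_add_neg]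
  exact hz.add hw.neg

/-- The factor 2 is due to the two products in the imaginary part. -/
lemma Tame.mul (hz : Tame ω A z) (hw : Tame ω B w) : Tame ω (2 * A * B) (z * w) := by
  have hA := hz.nonneg
  have hB := hw.nonneg
  constructor
  · rw [norm_mul]
    have := mul_le_mul hz.1 hw.1 (norm_nonneg w) hA
    nlinarith [mul_nonneg hA hB]
  · rw [Complex.mul_im]
    have h1 : |z.re * w.im| ≤ A * (B * |ω|) := by
      rw [abs_mul]
      exact mul_le_mul ((Complex.abs_re_le_norm z).trans hz.1) hw.2 (abs_nonneg _) hA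
    have h2 : |z.im * w.re| ≤ A * |ω| * B := by
      rw [abs_mul]
      exact mul_le_mul hz.2 ((Complex.abs_re_le_norm w).trans hw.1) (abs_nonneg _)
        (mul_nonneg hA (abs_nonneg ω))
    have := abs_add_le (z.re * w.im) (z.im * w.re)
    linarith

lemma tame_ofReal (ω r : ℝ) : Tame ω |r| (r : ℂ) := by
  refine ⟨by simp, ?_⟩
  rw [Complex.ofReal_im, abs_zero]
  positivity

lemma Tame.sum {ι : Type} (s : Finset ι) {A : ι → ℝ} {z : ι → ℂ}
    (h : ∀ i ∈ s, Tame ω (A i) (z i)) : Tame ω (∑ i ∈ s, A i) (∑ i ∈ s, z i) := by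
  classical
  induction s using Finset.induction_on with
  | empty => simp [Tame]
  | insert i s hi ih =>
    rw [Finset.sum_insert hi, Finset.sum_insert hi]
    exact (h i (Finset.mem_insert_self i s)).add
      (ih fun j hj => h j (Finset.mem_insert_of_mem hj))

/-- The imaginary part of z⁻¹ is -Im z / |z|², so the constant 1/A serves both bounds. -/
lemma tame_inv (hz : A ≤ ‖z‖) (hA : 0 < A) (him : |z.im| ≤ A * |ω|) : Tame ω (1 / A) z⁻¹ := by
  have hz0 : 0 < ‖z‖ := hA.trans_le hz
  constructor
  · rw [norm_inv, one_div]
    exact inv_anti₀ hA hz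
  · rw [Complex.inv_im, abs_div, abs_neg, Complex.normSq_eq_norm_sq, abs_of_nonneg (sq_nonneg ‖z‖),
      div_le_iff₀ (by positivity)]
    calc |z.im| ≤ A * |ω| := him
      _ = 1 / A * |ω| * A ^ 2 := by
        field_simp
      _ ≤ 1 / A * |ω| * ‖z‖ ^ 2 := by gcongr

lemma add_ofReal_ne_zero {z : ℂ} (hz : 0 ≤ z.re) {κ : ℝ} (hκ : 0 < κ) : z + κ ≠ 0 := by
  intro h
  have := congrArg Complex.re h
  simp only [Complex.add_re, Complex.ofReal_re, Complex.zero_re] at this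
  linarith

lemma tame_inv_add {z : ℂ} (hz : 0 ≤ z.re) {κ : ℝ} (hκ : 1 ≤ κ) :
    Tame z.im (1 / κ) (z + κ)⁻¹ := by
  refine tame_inv ?_ (by linarith) ?_
  · refine le_trans ?_ ((le_abs_self _).trans (Complex.abs_re_le_norm _))
    simp [hz]
  · simp only [Complex.add_im, Complex.ofReal_im, add_zero]
    nlinarith [abs_nonneg z.im]

/-- A feedback loop `y = H (β y + q s)` with small `H` has small gain from `s` to `y`. -/
lemma Tame.feedback {β q H y s : ℂ} {B h : ℝ} (hβ : Tame ω B β) (hq : Tame ω B q)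
    (hH : Tame ω h H) (hsmall : 2 * h * B ≤ 1 / 2) (hy : y = H * (β * y + q * s)) :
    ∃ w, Tame ω (8 * h * B) w ∧ y = w * s := by
  have hHβ := (hH.mul hβ).mono hsmall
  have hnorm : 1 / 2 ≤ ‖1 - H * β‖ := by
    have h1 := norm_sub_norm_le (1 : ℂ) (H * β)
    rw [norm_one] at h1
    linarith [hHβ.1]
  have hne : 1 - H * β ≠ 0 := by
    intro h0
    rw [h0, norm_zero] at hnorm
    norm_num at hnorm
  have hinv : Tame ω (1 / (1 / 2)) (1 - H * β)⁻¹ := by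
    refine tame_inv hnorm (by norm_num) ?_
    rw [Complex.sub_im, Complex.one_im, zero_sub, abs_neg]
    exact hHβ.2
  -- The constant 8 is a factor 2 for each of the two products and the bound 2 for the inverse.
  refine ⟨(1 - H * β)⁻¹ * (H * q), (hinv.mul (hH.mul hq)).mono (le_of_eq (by ring)), ?_⟩
  rw [mul_assoc, eq_inv_mul_iff_mul_eq₀ hne]
  linear_combination hy

end Tame

/-! ### High-gain design of a controlled bus -/

section HighGain

/-- The response of the internal model with matrix `diag (-c)` to the swing dynamics. -/
lemma internalModel_response {E : Type} [Fintype E] (c ψ : E → ℝ) (hc : ∀ e, 1 ≤ c e)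
    (m D τ : ℝ) :
    ∃ B : ℝ, 0 < B ∧ ∀ z : ℂ, 0 ≤ z.re → ∃ β q : ℂ, Tame z.im B β ∧ Tame z.im B q ∧
      ∀ (y v s : ℂ) (ζ : E → ℂ), 2 * Real.pi * v = z * y →
        (∀ e, z * ζ e = -(c e) * ζ e + m * v * c e - (D * v + τ * y - s)) →
        ∑ e, ψ e * ζ e - s = β * y + q * s := by
  refine ⟨(∑ e, 2 * |ψ e| * (2 * |(m * c e - D) / (2 * Real.pi)| * (|1| + 2 * |c e| * 1) +
    2 * |τ| * 1)) + (∑ e, 2 * |ψ e| * 1 + |1|), by positivity, fun z hz => ?_⟩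
  have hR : ∀ e, Tame z.im 1 (z + c e)⁻¹ := fun e =>
    (tame_inv_add hz (hc e)).mono (by
      rw [div_le_one (by linarith [hc e])]
      exact hc e)
  -- The frequency is v = zy/(2π), and z/(z + c) = 1 - c/(z + c) stays bounded although z does not.
  -- The bound is independent of the actuator gains.
  refine ⟨∑ e, (ψ e : ℂ) * (((m * c e - D) / (2 * Real.pi) : ℝ) *
      (((1 : ℝ) : ℂ) - (c e : ℂ) * (z + c e)⁻¹) - (τ : ℂ) * (z + c e)⁻¹),
    ∑ e, (ψ e : ℂ) * (z + c e)⁻¹ - ((1 : ℝ) : ℂ), ?_, ?_, ?_⟩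
  · refine (Tame.sum Finset.univ fun e _ => (tame_ofReal z.im (ψ e)).mul
      (((tame_ofReal z.im ((m * c e - D) / (2 * Real.pi))).mul
        ((tame_ofReal z.im 1).sub ((tame_ofReal z.im (c e)).mul (hR e)))).sub
        ((tame_ofReal z.im τ).mul (hR e)))).mono (le_add_of_nonneg_right ?_)
    positivity
  · refine ((Tame.sum Finset.univ fun e _ => (tame_ofReal z.im (ψ e)).mul (hR e)).sub
      (tame_ofReal z.im 1)).mono (le_add_of_nonneg_left ?_)
    positivity
  · intro y v s ζ hv hζ
    have hv' : v = z * y / (2 * Real.pi) := by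
      rw [← hv]
      field_simp
    have hζ' : ∀ e, ψ e * ζ e = (ψ e : ℂ) * (((m * c e - D) / (2 * Real.pi) : ℝ) *
      (((1 : ℝ) : ℂ) - (c e : ℂ) * (z + c e)⁻¹) - (τ : ℂ) * (z + c e)⁻¹) * y +
        (ψ e : ℂ) * (z + c e)⁻¹ * s := by
      intro e
      have hne := add_ofReal_ne_zero hz (zero_lt_one.trans_le (hc e))
      have h1 : ζ e = (m * v * c e - (D * v + τ * y - s)) * (z + c e)⁻¹ := by
        rw [eq_mul_inv_iff_mul_eq₀ hne]
        linear_combination hζ e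
      rw [h1, hv']
      push_cast
      field_simp
      ring
    rw [Finset.sum_congr rfl fun e _ => hζ' e, Finset.sum_add_distrib, ← Finset.sum_mul,
      ← Finset.sum_mul]
    push_cast
    ring

/-- The response of a chain of at most four stages with equal gains `κ` is small for large `κ`. -/
lemma chain_response (m κ E e g : ℝ) (hm : 0 < m) (hκ : 1 ≤ κ) (hE : 0 ≤ E) (he : |e| ≤ E * κ)
    (hg : |g| ≤ E * κ ^ 2) {z : ℂ} (hz : 0 ≤ z.re) :
    Tame z.im (16 * Real.pi / m * (1 + 6 * E) / κ) (((2 * Real.pi / m : ℝ) : ℂ) *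
      ((z + κ)⁻¹ ^ 2 * (e * (z + κ)⁻¹ + g * (z + κ)⁻¹ ^ 2 - 1))) := by
  have hκ0 : 0 < κ := by linarith
  have hρ := tame_inv_add hz hκ
  have h1 : Tame z.im (2 * E) (e * (z + κ)⁻¹) := by
    refine ((tame_ofReal z.im e).mul hρ).mono ?_
    calc 2 * |e| * (1 / κ) ≤ 2 * (E * κ) * (1 / κ) := by gcongr
      _ = 2 * E := by field_simp
  have hρ2 := hρ.mul hρ
  rw [← sq] at hρ2
  have h2 : Tame z.im (4 * E) (g * (z + κ)⁻¹ ^ 2) := by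
    refine ((tame_ofReal z.im g).mul hρ2).mono ?_
    calc 2 * |g| * (2 * (1 / κ) * (1 / κ)) ≤ 2 * (E * κ ^ 2) * (2 * (1 / κ) * (1 / κ)) := by gcongr
      _ = 4 * E := by
        field_simp
        ring
  have h3 : Tame z.im (1 + 6 * E) (e * (z + κ)⁻¹ + g * (z + κ)⁻¹ ^ 2 - 1) := by
    have := (h1.add h2).sub (tame_ofReal z.im 1)
    rw [Complex.ofReal_one, abs_one] at this
    exact this.mono (by linarith)
  -- One of the two factors 1/κ is enough for the gain to tend to zero.
  have h5 : Tame z.im (2 / κ) ((z + κ)⁻¹ ^ 2) := by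
    refine hρ2.mono ?_
    have : 1 / κ ≤ 1 := by
      rw [div_le_one hκ0]
      exact hκ
    calc 2 * (1 / κ) * (1 / κ) ≤ 2 * (1 / κ) * 1 := by gcongr
      _ = 2 / κ := by ring
  refine ((tame_ofReal z.im (2 * Real.pi / m)).mul (h5.mul h3)).mono (le_of_eq ?_)
  rw [abs_of_pos (by positivity)]
  field_simp
  ring

/-- The gain from the neighbours' angles to the own angle that is allowed at a controlled bus. -/
def gainBound (τ : ℝ) : ℝ := 1 / (16 * (1 + |τ|))

lemma gainBound_pos (τ : ℝ) : 0 < gainBound τ := by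
  rw [gainBound]
  positivity

lemma gainBound_mul_le {τ : ℝ} : gainBound τ * |τ| ≤ 1 / 16 := by
  rw [gainBound, div_mul_eq_mul_div, div_le_div_iff₀ (by positivity) (by norm_num)]
  linarith

/-- For large `κ` the closed loop of actuator chain and internal model has small gain. -/
lemma exists_high_gain {X : Type} [Fintype X] (c ψ : X → ℝ) (hc : ∀ e, 1 ≤ c e)
    (m D τ E : ℝ) (hm : 0 < m) (hE : 0 ≤ E) :
    ∃ κ : ℝ, 1 ≤ κ ∧ ∀ e g : ℝ, |e| ≤ E * κ → |g| ≤ E * κ ^ 2 → ∀ z : ℂ, 0 ≤ z.re →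
      ∀ (y v s a : ℂ) (ζ : X → ℂ), 2 * Real.pi * v = z * y →
        (∀ e, z * ζ e = -(c e) * ζ e + m * v * c e - (D * v + τ * y - s)) →
        a = ∑ e, ψ e * ζ e - s →
        y = ((2 * Real.pi / m : ℝ) : ℂ) *
          ((z + κ)⁻¹ ^ 2 * (e * (z + κ)⁻¹ + g * (z + κ)⁻¹ ^ 2 - 1)) * a →
        ∃ w, Tame z.im (gainBound τ) w ∧ y = w * s := by
  obtain ⟨B, hB, hresp⟩ := internalModel_response c ψ hc m D τ
  set K := 16 * Real.pi / m * (1 + 6 * E) with hK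
  have hδ := gainBound_pos τ
  set δ := gainBound τ
  obtain ⟨κ, hκ1, hκ2, hκ3⟩ : ∃ κ : ℝ, 1 ≤ κ ∧ 2 * (K / κ) * B ≤ 1 / 2 ∧ 8 * (K / κ) * B ≤ δ := by
    -- The three summands meet the three requirements in turn.
    refine ⟨1 + 4 * K * B + 8 * K * B / δ, ?_, ?_, ?_⟩
    · have : 0 ≤ 4 * K * B + 8 * K * B / δ := by positivity
      linarith
    · have h0 : 0 < 1 + 4 * K * B + 8 * K * B / δ := by positivity
      have h1 : 0 ≤ 8 * K * B / δ := by positivity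
      rw [mul_div_assoc', div_mul_eq_mul_div, div_le_iff₀ h0]
      linarith
    · have h0 : 0 < 1 + 4 * K * B + 8 * K * B / δ := by positivity
      have h1 : 0 ≤ 4 * K * B * δ := by positivity
      rw [mul_div_assoc', div_mul_eq_mul_div, div_le_iff₀ h0, mul_add, mul_div_cancel₀ _ hδ.ne']
      linarith
  refine ⟨κ, hκ1, fun e g he hg z hz y v s a ζ hv hζ ha hy => ?_⟩
  obtain ⟨β, q, hβ, hq, h⟩ := hresp z hz
  have hH := chain_response m κ E e g hm hκ1 hE he hg hz
  rw [ha, h y v s ζ hv hζ] at hy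
  obtain ⟨w, hw, hws⟩ := hβ.feedback hq hH hκ2 hy
  exact ⟨w, hw.mono hκ3, hws⟩

end HighGain

/-! ### A fixed internal model -/

section InternalModel

variable (ℓL ℓM : ℕ)

/-- Distinct decay rates `1, 2, 3, …`. -/
def decayRate (e : Exo ℓL ℓM) : ℝ := (Fintype.equivFin (Exo ℓL ℓM) e : ℕ) + 1

/-- The diagonal internal model with eigenvalues `-1, -2, -3, …`. -/
def diagModel : IntModel ℓL ℓM where
  M := Matrix.diagonal fun e => -decayRate ℓL ℓM e
  N := 1

variable {ℓL ℓM}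

lemma one_le_decayRate (e : Exo ℓL ℓM) : 1 ≤ decayRate ℓL ℓM e := by
  simp [decayRate]

lemma decayRate_injective : Function.Injective (decayRate ℓL ℓM) := by
  intro e e' h
  simpa [decayRate, Fin.val_inj] using h

lemma isHurwitz_diagModel : IsHurwitz (diagModel ℓL ℓM).M := by
  intro z v hv h
  obtain ⟨e, he⟩ := Function.ne_iff.mp hv
  have h1 := congrFun h e
  rw [diagModel, Matrix.diagonal_map (map_zero _), Matrix.mulVec_diagonal] at h1
  have h2 : z = ((-decayRate ℓL ℓM e : ℝ) : ℂ) := (mul_right_cancel₀ he h1).symm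
  rw [h2, Complex.ofReal_re]
  linarith [one_le_decayRate e]

/-- With N = 1 the vectors M^k N list the powers of the distinct diagonal entries, so their span
consists of the values of polynomials at distinct nodes; Lagrange interpolation gives every vector.
-/
lemma isControllable_diagModel : IsControllable (diagModel ℓL ℓM).M (diagModel ℓL ℓM).N := by
  rw [IsControllable, eq_top_iff]
  have hpow : ∀ p : Polynomial ℝ, (fun e => p.eval (-decayRate ℓL ℓM e)) ∈
      Submodule.span ℝ (Set.range fun k : ℕ =>
        ((diagModel ℓL ℓM).M ^ k) *ᵥ (diagModel ℓL ℓM).N) := by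
    intro p
    induction p using Polynomial.induction_on' with
    | add p q hp hq =>
      simp only [Polynomial.eval_add]
      exact Submodule.add_mem _ hp hq
    | monomial n a =>
      have : (fun e => (Polynomial.monomial n a).eval (-decayRate ℓL ℓM e)) =
          a • (((diagModel ℓL ℓM).M ^ n) *ᵥ (diagModel ℓL ℓM).N) := by
        ext e
        simp [diagModel, Matrix.diagonal_pow, Matrix.mulVec_diagonal]
      rw [this]
      exact Submodule.smul_mem _ _ (Submodule.subset_span ⟨n, rfl⟩)
  intro f _
  have hinj : Set.InjOn (fun e => -decayRate ℓL ℓM e)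
      ((Finset.univ : Finset (Exo ℓL ℓM)) : Set (Exo ℓL ℓM)) :=
    (neg_injective.comp decayRate_injective).injOn
  have := hpow (Lagrange.interpolate Finset.univ (fun e => -decayRate ℓL ℓM e) f)
  convert this using 1
  ext e
  exact (Lagrange.eval_interpolate_at_node f hinj (Finset.mem_univ e)).symm

end InternalModel

/-! ### Local eigenvalue equations -/

section LocalEigen

variable {ℓL ℓM : ℕ}

/-- The eigenvalue equation of a generator bus with input `s` from the neighbours. -/
def GenEigen (p : GenParams ℓL ℓM) (d : GenDesign ℓL ℓM) (τ : ℝ) (z s : ℂ)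
    (y : Fin 5 ⊕ Exo ℓL ℓM → ℂ) : Prop :=
  ∀ a, (genHatRhs p d τ s.re (fun b => (y b).re) a : ℂ) +
    genHatRhs p d τ s.im (fun b => (y b).im) a * Complex.I = z * y a

/-- The eigenvalue equation of a load bus with input `s` from the neighbours. -/
def LoadEigen (p : LoadParams ℓL ℓM) (d : LoadDesign ℓL ℓM) (τ : ℝ) (z s : ℂ)
    (y : Fin 3 ⊕ Exo ℓL ℓM → ℂ) : Prop :=
  ∀ a, (loadHatRhs p d τ s.re (fun b => (y b).re) a : ℂ) +
    loadHatRhs p d τ s.im (fun b => (y b).im) a * Complex.I = z * y a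

/-- Designs whose closed loop has small gain, with small imaginary part, from the neighbours'
angles to the own angle, and whose isolated closed loop has no unstable eigenvalue. -/
def GenDesign.Good (p : GenParams ℓL ℓM) (τ : ℝ) (d : GenDesign ℓL ℓM) : Prop :=
  d.Admissible ∧ ∀ (z s : ℂ) (y : Fin 5 ⊕ Exo ℓL ℓM → ℂ), 0 ≤ z.re → GenEigen p d τ z s y →
    (∃ w, Tame z.im (gainBound τ) w ∧ y (.inl 0) = w * s) ∧ (s = 0 → y = 0)

/-- See `GenDesign.Good`. -/
def LoadDesign.Good (p : LoadParams ℓL ℓM) (τ : ℝ) (d : LoadDesign ℓL ℓM) : Prop :=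
  d.Admissible ∧ ∀ (z s : ℂ) (y : Fin 3 ⊕ Exo ℓL ℓM → ℂ), 0 ≤ z.re → LoadEigen p d τ z s y →
    (∃ w, Tame z.im (gainBound τ) w ∧ y (.inl 0) = w * s) ∧ (s = 0 → y = 0)

lemma dotProduct_re_add_im {ι : Type} [Fintype ι] (r : ι → ℝ) (y : ι → ℂ) :
    ((r ⬝ᵥ fun i => (y i).re : ℝ) : ℂ) + ((r ⬝ᵥ fun i => (y i).im : ℝ) : ℂ) * Complex.I =
      ∑ i, (r i : ℂ) * y i := by
  simp only [dotProduct, Complex.ofReal_sum, Complex.ofReal_mul, Finset.sum_mul,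
    ← Finset.sum_add_distrib]
  refine Finset.sum_congr rfl fun i _ => ?_
  conv_rhs => rw [← Complex.re_add_im (y i)]
  ring

lemma diagModel_mulVec (v : Exo ℓL ℓM → ℝ) (e : Exo ℓL ℓM) :
    ((diagModel ℓL ℓM).M *ᵥ v) e = -decayRate ℓL ℓM e * v e := by
  simp [diagModel, Matrix.mulVec_diagonal]

lemma diagModel_N (e : Exo ℓL ℓM) : (diagModel ℓL ℓM).N e = 1 := rfl

/-- The high-gain design of a generator bus. -/
def genHighGain (ℓL ℓM : ℕ) (κ : ℝ) : GenDesign ℓL ℓM := ⟨fun _ => κ, diagModel ℓL ℓM⟩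

/-- The high-gain design of a load bus. -/
def loadHighGain (ℓL ℓM : ℕ) (κ : ℝ) : LoadDesign ℓL ℓM := ⟨fun _ => κ, diagModel ℓL ℓM⟩

lemma GenEigen.equations {p : GenParams ℓL ℓM} {κ τ : ℝ} {z s : ℂ}
    {y : Fin 5 ⊕ Exo ℓL ℓM → ℂ} (h : GenEigen p (genHighGain ℓL ℓM κ) τ z s y) {A v : ℂ}
    (hA : A = y (.inl 4) + ∑ e, (estRow p.wind (diagModel ℓL ℓM) p.wind.Ψ e : ℂ) * y (.inr e) - s)
    (hv : v = y (.inl 1) - κ / (2 * Real.pi) * y (.inl 0)) :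
    z * y (.inl 0) = -κ * y (.inl 0) + 2 * Real.pi * y (.inl 1) ∧
    z * y (.inl 1) = -κ * y (.inl 1) + 1 / p.m * (y (.inl 2) - A) ∧
    z * y (.inl 2) = -κ * y (.inl 2) + 1 / p.TCH * y (.inl 3) +
      (genM2 p (genHighGain ℓL ℓM κ) / p.m : ℝ) * A ∧
    z * y (.inl 3) = -κ * y (.inl 3) + (1 / p.m * (genV2 p (genHighGain ℓL ℓM κ) τ -
      genM2 p (genHighGain ℓL ℓM κ) * genV3 p (genHighGain ℓL ℓM κ)) : ℝ) * A ∧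
    z * y (.inl 4) = -κ * y (.inl 4) ∧
    ∀ e, z * y (.inr e) = -(decayRate ℓL ℓM e) * y (.inr e) + p.m * v * decayRate ℓL ℓM e
      - (p.D * v + τ * y (.inl 0) - s) := by
  have hre : ∀ w : ℂ, (w.re : ℂ) + w.im * Complex.I = w := Complex.re_add_im
  have h0 := h (.inl 0)
  have h1 := h (.inl 1)
  have h2 := h (.inl 2)
  have h3 := h (.inl 3)
  have h4 := h (.inl 4)
  have hζ := fun e => h (.inr e)
  have e0 := hre (y (.inl 0))
  have e1 := hre (y (.inl 1))
  have e2 := hre (y (.inl 2))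
  have e3 := hre (y (.inl 3))
  have e4 := hre (y (.inl 4))
  have es := hre s
  have eζ := dotProduct_re_add_im (estRow p.wind (diagModel ℓL ℓM) p.wind.Ψ) fun e => y (.inr e)
  rw [← eζ] at hA
  clear eζ
  have hk : ∀ l, (genHighGain ℓL ℓM κ).k l = κ := fun _ => rfl
  have him : (genHighGain ℓL ℓM κ).im = diagModel ℓL ℓM := rfl
  simp only [genHatRhs, Sum.elim_inl, Sum.elim_inr, Matrix.cons_val, hk, him, Pi.sub_apply,
    Pi.smul_apply, smul_eq_mul, diagModel_mulVec, diagModel_N] at h0 h1 h2 h3 h4 hζ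
  push_cast at h0 h1 h2 h3 h4 hζ ⊢
  refine ⟨?_, ?_, ?_, ?_, ?_, fun e => ?_⟩
  · linear_combination -h0 - κ * e0 + 2 * Real.pi * e1
  · subst hA
    linear_combination -h1 - κ * e1 + 1 / p.m * (e2 - e4 + es)
  · subst hA
    linear_combination -h2 - κ * e2 + 1 / p.TCH * e3 +
      genM2 p (genHighGain ℓL ℓM κ) / p.m * (e4 - es)
  · subst hA
    linear_combination -h3 - κ * e3 + 1 / p.m * (genV2 p (genHighGain ℓL ℓM κ) τ -
      genM2 p (genHighGain ℓL ℓM κ) * genV3 p (genHighGain ℓL ℓM κ)) * (e4 - es)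
  · linear_combination -h4 - κ * e4
  · have ee := hre (y (.inr e))
    subst hv
    linear_combination -hζ e - decayRate ℓL ℓM e * ee + (p.m * decayRate ℓL ℓM e - p.D) * (e1 -
      κ / (2 * Real.pi) * e0) - τ * e0 + es

lemma LoadEigen.equations {p : LoadParams ℓL ℓM} {κ τ : ℝ} {z s : ℂ}
    {y : Fin 3 ⊕ Exo ℓL ℓM → ℂ} (h : LoadEigen p (loadHighGain ℓL ℓM κ) τ z s y) {A v : ℂ}
    (hA : A = ∑ e, (estRow p.wind (diagModel ℓL ℓM) p.wind.Ψ e : ℂ) * y (.inr e) - s)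
    (hv : v = y (.inl 1) - κ / (2 * Real.pi) * y (.inl 0)) :
    z * y (.inl 0) = -κ * y (.inl 0) + 2 * Real.pi * y (.inl 1) ∧
    z * y (.inl 1) = -κ * y (.inl 1) + 1 / p.m * (-y (.inl 2) - A) ∧
    z * y (.inl 2) = -κ * y (.inl 2) - (loadM2 p (loadHighGain ℓL ℓM κ) / p.m : ℝ) * A ∧
    ∀ e, z * y (.inr e) = -(decayRate ℓL ℓM e) * y (.inr e) + p.m * v * decayRate ℓL ℓM e
      - (p.D * v + τ * y (.inl 0) - s) := by
  have hre : ∀ w : ℂ, (w.re : ℂ) + w.im * Complex.I = w := Complex.re_add_im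
  have h0 := h (.inl 0)
  have h1 := h (.inl 1)
  have h2 := h (.inl 2)
  have hζ := fun e => h (.inr e)
  have e0 := hre (y (.inl 0))
  have e1 := hre (y (.inl 1))
  have e2 := hre (y (.inl 2))
  have es := hre s
  have eζ := dotProduct_re_add_im (estRow p.wind (diagModel ℓL ℓM) p.wind.Ψ) fun e => y (.inr e)
  rw [← eζ] at hA
  clear eζ
  have hk : ∀ l, (loadHighGain ℓL ℓM κ).k l = κ := fun _ => rfl
  have him : (loadHighGain ℓL ℓM κ).im = diagModel ℓL ℓM := rfl
  simp only [loadHatRhs, Sum.elim_inl, Sum.elim_inr, Matrix.cons_val, hk, him, Pi.sub_apply,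
    Pi.smul_apply, smul_eq_mul, diagModel_mulVec, diagModel_N] at h0 h1 h2 hζ
  push_cast at h0 h1 h2 hζ ⊢
  refine ⟨?_, ?_, ?_, fun e => ?_⟩
  · linear_combination -h0 - κ * e0 + 2 * Real.pi * e1
  · subst hA
    linear_combination -h1 - κ * e1 + 1 / p.m * (-e2 + es)
  · subst hA
    linear_combination -h2 - κ * e2 + loadM2 p (loadHighGain ℓL ℓM κ) / p.m * es
  · have ee := hre (y (.inr e))
    subst hv
    linear_combination -hζ e - decayRate ℓL ℓM e * ee + (p.m * decayRate ℓL ℓM e - p.D) * (e1 -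
      κ / (2 * Real.pi) * e0) - τ * e0 + es

lemma eq_zero_of_mul_eq_neg_mul {z y : ℂ} {κ : ℝ} (hz : 0 ≤ z.re) (hκ : 0 < κ)
    (h : z * y = -κ * y) : y = 0 := by
  have h1 : (z + κ) * y = 0 := by linear_combination h
  exact (mul_eq_zero.mp h1).resolve_left (add_ofReal_ne_zero hz hκ)

/-- The estimate row depends on the fixed internal model but not on κ, so κ may be chosen after it.
The coefficients feeding A back into the chain grow like κ and κ², which the chain's own factors
1/(z + κ) compensate. -/
lemma exists_gen_good (p : GenParams ℓL ℓM) (τ : ℝ) :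
    ∃ d : GenDesign ℓL ℓM, GenDesign.Good p τ d := by
  have hm := p.m_pos
  have hT := p.TCH_pos
  have hpi := Real.pi_pos
  set ψ := estRow p.wind (diagModel ℓL ℓM) p.wind.Ψ with hψ
  set A₀ := p.D - p.m * (ψ ⬝ᵥ (diagModel ℓL ℓM).N) with hA₀
  -- The first summand bounds the coefficient of order κ, the second the one of order κ².
  set E := (|A₀| + 2 * p.m) / p.m +
    (2 * Real.pi * |τ| + |A₀| + p.m + (|A₀| + 2 * p.m) ^ 2 / p.m) / p.m with hE
  obtain ⟨κ, hκ, hgain⟩ := exists_high_gain (decayRate ℓL ℓM) ψ one_le_decayRate p.m p.D τ E hm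
    (by positivity)
  have hκ0 : 0 < κ := by linarith
  refine ⟨genHighGain ℓL ℓM κ, ⟨fun _ => hκ0, isHurwitz_diagModel, isControllable_diagModel⟩,
    fun z s y hz hy => ?_⟩
  obtain ⟨A, hA⟩ : ∃ A, A = y (.inl 4) + ∑ e, (ψ e : ℂ) * y (.inr e) - s := ⟨_, rfl⟩
  obtain ⟨v, hv⟩ : ∃ v, v = y (.inl 1) - κ / (2 * Real.pi) * y (.inl 0) := ⟨_, rfl⟩
  obtain ⟨h0, h1, h2, h3, h4, hζ⟩ := hy.equations hA hv
  have hM2 : genM2 p (genHighGain ℓL ℓM κ) = A₀ - 2 * p.m * κ := by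
    simp only [genM2, genHighGain, hA₀, hψ]
    ring
  -- The terms M2 (1 - T_CH κ) of `genV2` and `genM2 * genV3` cancel. The factor T_CH left in front
  -- cancels 1/T_CH in the next stage.
  have hg : 1 / p.m * (genV2 p (genHighGain ℓL ℓM κ) τ -
      genM2 p (genHighGain ℓL ℓM κ) * genV3 p (genHighGain ℓL ℓM κ)) =
      p.TCH * ((2 * Real.pi * τ - κ * A₀ + p.m * κ ^ 2 - (A₀ - 2 * p.m * κ) ^ 2 / p.m) / p.m) := by
    have hM1 : genM1 p (genHighGain ℓL ℓM κ) τ = τ - κ / (2 * Real.pi) * (A₀ - p.m * κ) := by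
      simp only [genM1, genHighGain, hA₀, hψ]
    have hk : ∀ l, (genHighGain ℓL ℓM κ).k l = κ := fun _ => rfl
    rw [genV2, genV3, hM1, hM2, hk, hk]
    field_simp
    ring
  rw [hg] at h3
  rw [hM2] at h2
  have hM2abs : |A₀ - 2 * p.m * κ| ≤ (|A₀| + 2 * p.m) * κ := by
    have h5 : |A₀| * 1 ≤ |A₀| * κ := by gcongr
    have h6 := abs_sub A₀ (2 * p.m * κ)
    rw [abs_of_pos (by positivity : 0 < 2 * p.m * κ)] at h6
    linarith
  set eκ := (A₀ - 2 * p.m * κ) / p.m with heκ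
  set gκ := (2 * Real.pi * τ - κ * A₀ + p.m * κ ^ 2 - (A₀ - 2 * p.m * κ) ^ 2 / p.m) / p.m with hgκ
  have he_le : |eκ| ≤ E * κ := by
    rw [heκ, abs_div, abs_of_pos hm]
    calc |A₀ - 2 * p.m * κ| / p.m ≤ (|A₀| + 2 * p.m) * κ / p.m := by gcongr
      _ = (|A₀| + 2 * p.m) / p.m * κ := by ring
      _ ≤ E * κ := by
        gcongr
        exact le_add_of_nonneg_right (by positivity)
  have hg_le : |gκ| ≤ E * κ ^ 2 := by
    have hκκ : κ ≤ κ ^ 2 := by nlinarith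
    have hκ1 : 1 ≤ κ ^ 2 := by nlinarith
    have h5 : |2 * Real.pi * τ| ≤ 2 * Real.pi * |τ| * κ ^ 2 := by
      rw [abs_mul, abs_of_pos (by positivity : 0 < 2 * Real.pi)]
      exact le_mul_of_one_le_right (by positivity) hκ1
    have h6 : |κ * A₀| ≤ |A₀| * κ ^ 2 := by
      rw [abs_mul, abs_of_pos hκ0, mul_comm]
      gcongr
    have h7 : |p.m * κ ^ 2| = p.m * κ ^ 2 := abs_of_pos (by positivity)
    have h8 : |(A₀ - 2 * p.m * κ) ^ 2 / p.m| ≤ (|A₀| + 2 * p.m) ^ 2 / p.m * κ ^ 2 := by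
      rw [abs_div, abs_of_pos hm, abs_pow]
      calc _ ≤ ((|A₀| + 2 * p.m) * κ) ^ 2 / p.m := by gcongr
        _ = _ := by ring
    have h9 : |2 * Real.pi * τ - κ * A₀ + p.m * κ ^ 2 - (A₀ - 2 * p.m * κ) ^ 2 / p.m| ≤
        (2 * Real.pi * |τ| + |A₀| + p.m + (|A₀| + 2 * p.m) ^ 2 / p.m) * κ ^ 2 := by
      have a1 := abs_sub (2 * Real.pi * τ - κ * A₀ + p.m * κ ^ 2) ((A₀ - 2 * p.m * κ) ^ 2 / p.m)
      have a2 := abs_add_le (2 * Real.pi * τ - κ * A₀) (p.m * κ ^ 2)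
      have a3 := abs_sub (2 * Real.pi * τ) (κ * A₀)
      linarith
    rw [hgκ, abs_div, abs_of_pos hm]
    calc _ ≤ (2 * Real.pi * |τ| + |A₀| + p.m + (|A₀| + 2 * p.m) ^ 2 / p.m) * κ ^ 2 / p.m := by
          gcongr
      _ = (2 * Real.pi * |τ| + |A₀| + p.m + (|A₀| + 2 * p.m) ^ 2 / p.m) / p.m * κ ^ 2 := by ring
      _ ≤ E * κ ^ 2 := by
        gcongr
        exact le_add_of_nonneg_left (by positivity)
  -- The demand error obeys its own stable equation, so it plays no part in an unstable mode.
  have hy4 : y (.inl 4) = 0 := eq_zero_of_mul_eq_neg_mul hz hκ0 h4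
  rw [hy4, zero_add] at hA
  have hpiC : (Real.pi : ℂ) ≠ 0 := Complex.ofReal_ne_zero.mpr hpi.ne'
  have hTC : (p.TCH : ℂ) ≠ 0 := Complex.ofReal_ne_zero.mpr hT.ne'
  have hzκ := add_ofReal_ne_zero hz hκ0
  have hvz : 2 * Real.pi * v = z * y (.inl 0) := by
    rw [hv, h0]
    field_simp
    ring
  obtain ⟨w, hw, hws⟩ := hgain eκ gκ he_le hg_le z hz (y (.inl 0)) v s A (fun e => y (.inr e)) hvz
    hζ hA (by
      have f3 : y (.inl 3) = (z + κ)⁻¹ * ((p.TCH * gκ : ℝ) * A) := by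
        rw [eq_inv_mul_iff_mul_eq₀ hzκ]
        linear_combination h3
      have f2 : y (.inl 2) = (z + κ)⁻¹ * (1 / p.TCH * y (.inl 3) + eκ * A) := by
        rw [eq_inv_mul_iff_mul_eq₀ hzκ]
        linear_combination h2
      have f1 : y (.inl 1) = (z + κ)⁻¹ * (1 / p.m * (y (.inl 2) - A)) := by
        rw [eq_inv_mul_iff_mul_eq₀ hzκ]
        linear_combination h1
      have f0 : y (.inl 0) = (z + κ)⁻¹ * (2 * Real.pi * y (.inl 1)) := by
        rw [eq_inv_mul_iff_mul_eq₀ hzκ]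
        linear_combination h0
      rw [f0, f1, f2, f3]
      generalize (z + (κ : ℂ))⁻¹ = ρ
      push_cast
      field_simp
      ring)
  -- Without inflow the angle vanishes, and then in turn w, η, P_v and P_M.
  refine ⟨⟨w, hw, hws⟩, fun hs => ?_⟩
  rw [hs, mul_zero] at hws
  have hy1 : y (.inl 1) = 0 := by
    rw [hws, mul_zero, mul_zero, zero_add] at h0
    simpa [hpiC] using h0.symm
  have hv0 : v = 0 := by rw [hv, hy1, hws]; ring
  have hζ0 : ∀ e, y (.inr e) = 0 := fun e =>
    eq_zero_of_mul_eq_neg_mul hz (zero_lt_one.trans_le (one_le_decayRate e)) (by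
      rw [hζ e, hv0, hws, hs]
      ring)
  have hA0 : A = 0 := by simp [hA, hζ0, hs]
  have hy3 : y (.inl 3) = 0 := eq_zero_of_mul_eq_neg_mul hz hκ0 (by rw [h3, hA0]; ring)
  have hy2 : y (.inl 2) = 0 := eq_zero_of_mul_eq_neg_mul hz hκ0 (by rw [h2, hA0, hy3]; ring)
  ext (i | e)
  · revert i
    rw [forall_fin_five]
    exact ⟨hws, hy1, hy2, hy3, hy4⟩
  · exact hζ0 e

lemma exists_load_good (p : LoadParams ℓL ℓM) (τ : ℝ) :
    ∃ d : LoadDesign ℓL ℓM, LoadDesign.Good p τ d := by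
  have hm := p.m_pos
  have hpi := Real.pi_pos
  set ψ := estRow p.wind (diagModel ℓL ℓM) p.wind.Ψ with hψ
  set A₀ := p.D - p.m * (ψ ⬝ᵥ (diagModel ℓL ℓM).N) with hA₀
  set E := (|A₀| + 2 * p.m) / p.m with hE
  obtain ⟨κ, hκ, hgain⟩ := exists_high_gain (decayRate ℓL ℓM) ψ one_le_decayRate p.m p.D τ E hm
    (by positivity)
  have hκ0 : 0 < κ := by linarith
  refine ⟨loadHighGain ℓL ℓM κ, ⟨fun _ => hκ0, isHurwitz_diagModel, isControllable_diagModel⟩,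
    fun z s y hz hy => ?_⟩
  obtain ⟨A, hA⟩ : ∃ A, A = ∑ e, (ψ e : ℂ) * y (.inr e) - s := ⟨_, rfl⟩
  obtain ⟨v, hv⟩ : ∃ v, v = y (.inl 1) - κ / (2 * Real.pi) * y (.inl 0) := ⟨_, rfl⟩
  obtain ⟨h0, h1, h2, hζ⟩ := hy.equations hA hv
  have hM2 : loadM2 p (loadHighGain ℓL ℓM κ) = A₀ - 2 * p.m * κ := by
    simp only [loadM2, loadHighGain, hA₀, hψ]
    ring
  rw [hM2] at h2
  have hM2abs : |A₀ - 2 * p.m * κ| ≤ (|A₀| + 2 * p.m) * κ := by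
    have h5 : |A₀| * 1 ≤ |A₀| * κ := by gcongr
    have h6 := abs_sub A₀ (2 * p.m * κ)
    rw [abs_of_pos (by positivity : 0 < 2 * p.m * κ)] at h6
    linarith
  set eκ := (A₀ - 2 * p.m * κ) / p.m with heκ
  have he_le : |eκ| ≤ E * κ := by
    rw [heκ, abs_div, abs_of_pos hm]
    calc |A₀ - 2 * p.m * κ| / p.m ≤ (|A₀| + 2 * p.m) * κ / p.m := by gcongr
      _ = E * κ := by ring
  have hpiC : (Real.pi : ℂ) ≠ 0 := Complex.ofReal_ne_zero.mpr hpi.ne'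
  have hzκ := add_ofReal_ne_zero hz hκ0
  have hvz : 2 * Real.pi * v = z * y (.inl 0) := by
    rw [hv, h0]
    field_simp
    ring
  -- There is no P_v stage, hence g = 0.
  obtain ⟨w, hw, hws⟩ := hgain eκ 0 he_le (by rw [abs_zero]; positivity) z hz (y (.inl 0)) v s A
    (fun e => y (.inr e)) hvz hζ hA (by
      have f2 : y (.inl 2) = (z + κ)⁻¹ * -(eκ * A) := by
        rw [eq_inv_mul_iff_mul_eq₀ hzκ]
        linear_combination h2
      have f1 : y (.inl 1) = (z + κ)⁻¹ * (1 / p.m * (-y (.inl 2) - A)) := by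
        rw [eq_inv_mul_iff_mul_eq₀ hzκ]
        linear_combination h1
      have f0 : y (.inl 0) = (z + κ)⁻¹ * (2 * Real.pi * y (.inl 1)) := by
        rw [eq_inv_mul_iff_mul_eq₀ hzκ]
        linear_combination h0
      rw [f0, f1, f2]
      generalize (z + (κ : ℂ))⁻¹ = ρ
      push_cast
      field_simp
      ring)
  refine ⟨⟨w, hw, hws⟩, fun hs => ?_⟩
  rw [hs, mul_zero] at hws
  have hy1 : y (.inl 1) = 0 := by
    rw [hws, mul_zero, mul_zero, zero_add] at h0
    simpa [hpiC] using h0.symm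
  have hv0 : v = 0 := by rw [hv, hy1, hws]; ring
  have hζ0 : ∀ e, y (.inr e) = 0 := fun e =>
    eq_zero_of_mul_eq_neg_mul hz (zero_lt_one.trans_le (one_le_decayRate e)) (by
      rw [hζ e, hv0, hws, hs]
      ring)
  have hA0 : A = 0 := by simp [hA, hζ0, hs]
  have hy2 : y (.inl 2) = 0 := eq_zero_of_mul_eq_neg_mul hz hκ0 (by rw [h2, hA0]; ring)
  ext (i | e)
  · revert i
    rw [forall_fin_three]
    exact ⟨hws, hy1, hy2⟩
  · exact hζ0 e

end LocalEigen

/-! ### Interconnection -/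

section Interconnection

variable {V : Type} [Fintype V]

/-- Cauchy–Schwarz with weights a. -/
lemma norm_sum_sq_le {a : V → ℝ} (ha : ∀ j, 0 ≤ a j) (θ : V → ℂ) :
    ‖∑ j, (a j : ℂ) * θ j‖ ^ 2 ≤ (∑ j, a j) * ∑ j, a j * ‖θ j‖ ^ 2 := by
  have h1 : ‖∑ j, (a j : ℂ) * θ j‖ ≤ ∑ j, a j * ‖θ j‖ := by
    refine (norm_sum_le _ _).trans (Finset.sum_le_sum fun j _ => ?_)
    rw [norm_mul, Complex.norm_real, Real.norm_of_nonneg (ha j)]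
  calc ‖∑ j, (a j : ℂ) * θ j‖ ^ 2 ≤ (∑ j, a j * ‖θ j‖) ^ 2 := by gcongr
    _ ≤ _ := Finset.sum_sq_le_sum_mul_sum_of_sq_le_mul _ (fun j _ => ha j)
      (fun j _ => mul_nonneg (ha j) (sq_nonneg _)) fun j _ => le_of_eq (by ring)

/-- The Hermitian form of a real symmetric matrix takes real values. -/
lemma sum_im_conj_mul_eq_zero {a : V → V → ℝ} (hsymm : ∀ i j, a i j = a j i) (θ : V → ℂ) :
    ∑ i, (starRingEnd ℂ (θ i) * ∑ j, (a i j : ℂ) * θ j).im = 0 := by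
  have h1 : ∀ i, (starRingEnd ℂ (θ i) * ∑ j, (a i j : ℂ) * θ j).im =
      ∑ j, a i j * ((θ i).re * (θ j).im - (θ i).im * (θ j).re) := by
    intro i
    rw [Finset.mul_sum, Complex.im_sum]
    refine Finset.sum_congr rfl fun j _ => ?_
    simp only [Complex.mul_im, Complex.mul_re, Complex.conj_re, Complex.conj_im, Complex.ofReal_re,
      Complex.ofReal_im]
    ring
  simp only [h1]
  have h2 : ∑ i, ∑ j, a i j * ((θ i).re * (θ j).im - (θ i).im * (θ j).re) =
      -∑ i, ∑ j, a i j * ((θ i).re * (θ j).im - (θ i).im * (θ j).re) := by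
    conv_lhs => rw [Finset.sum_comm]
    simp only [← Finset.sum_neg_distrib]
    refine Finset.sum_congr rfl fun i _ => Finset.sum_congr rfl fun j _ => ?_
    rw [hsymm j i]
    ring
  linarith

variable {a : V → V → ℝ} {θ s : V → ℂ} {z : ℂ} {ctrl : V → Prop} {τ m D : V → ℝ} {w : V → ℂ}

/-- In the imaginary part of ∑ conj(θ_i) s_i = real, divided by ω, uncontrolled buses contribute at
least D_i |θ_i|²/(2π) and controlled ones at least -δ_i |s_i|². The latter are bounded by a small
multiple of ∑ τ_i |θ_i|² over the uncontrolled buses, which D_i > τ_i dominates. Connectivity is not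
needed here. -/
lemma interconnection_eq_zero_of_im_ne_zero (ha : ∀ i j, 0 ≤ a i j)
    (hsymm : ∀ i j, a i j = a j i) (hτ : ∀ i, τ i = ∑ j, a i j)
    (hs : ∀ i, s i = ∑ j, (a i j : ℂ) * θ j) (hz : 0 ≤ z.re) (hω : z.im ≠ 0)
    (hw : ∀ i, ctrl i → Tame z.im (gainBound (τ i)) (w i)) (hctrl : ∀ i, ctrl i → θ i = w i * s i)
    (hm : ∀ i, ¬ ctrl i → 0 < m i) (hD : ∀ i, ¬ ctrl i → τ i < D i)
    (hfree : ∀ i, ¬ ctrl i →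
      s i = ((m i * z ^ 2 + D i * z) / (2 * Real.pi) + τ i) * θ i) : θ = 0 := by
  classical
  have hτ0 : ∀ i, 0 ≤ τ i := fun i => by
    rw [hτ]
    exact Finset.sum_nonneg fun j _ => ha i j
  obtain ⟨δ, hδ⟩ : ∃ δ : V → ℝ, ∀ i, δ i = gainBound (τ i) := ⟨_, fun _ => rfl⟩
  simp only [← hδ] at hw
  have hδ0 : ∀ i, 0 < δ i := fun i => by
    rw [hδ]
    exact gainBound_pos _
  have hδτ : ∀ i, δ i * τ i ≤ 1 / 16 := fun i => by
    have := gainBound_mul_le (τ := τ i)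
    rwa [abs_of_nonneg (hτ0 i), ← hδ] at this
  -- x lives on the controlled buses and y on the uncontrolled ones; x_i is the most that a
  -- controlled bus can put against the dissipation.
  obtain ⟨x, hx⟩ : ∃ x : V → ℝ, ∀ i, x i = if ctrl i then δ i * ‖s i‖ ^ 2 else 0 :=
    ⟨_, fun _ => rfl⟩
  have hx1 : ∀ i, ctrl i → x i = δ i * ‖s i‖ ^ 2 := fun i hi => by rw [hx, if_pos hi]
  have hx2 : ∀ i, ¬ ctrl i → x i = 0 := fun i hi => by rw [hx, if_neg hi]
  obtain ⟨y, hy⟩ : ∃ y : V → ℝ, ∀ i, y i = if ctrl i then 0 else ‖θ i‖ ^ 2 := ⟨_, fun _ => rfl⟩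
  have hy1 : ∀ i, ctrl i → y i = 0 := fun i hi => by rw [hy, if_pos hi]
  have hy2 : ∀ i, ¬ ctrl i → y i = ‖θ i‖ ^ 2 := fun i hi => by rw [hy, if_neg hi]
  have hx0 : ∀ i, 0 ≤ x i := fun i => by
    by_cases hi : ctrl i
    · rw [hx1 i hi]
      exact mul_nonneg (hδ0 i).le (sq_nonneg _)
    · rw [hx2 i hi]
  -- the imaginary part of the power balance
  have himag : ∑ i, D i / (2 * Real.pi) * y i ≤ ∑ i, x i := by
    have hsum := sum_im_conj_mul_eq_zero hsymm θ
    simp only [← hs] at hsum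
    have hterm : ∀ i, z.im ^ 2 * (D i / (2 * Real.pi) * y i - x i) ≤
        z.im * (starRingEnd ℂ (θ i) * s i).im := by
      intro i
      by_cases hi : ctrl i
      · rw [hx1 i hi, hy1 i hi, hctrl i hi, map_mul, mul_assoc, ← Complex.normSq_eq_conj_mul_self,
          Complex.im_mul_ofReal, Complex.conj_im, Complex.normSq_eq_norm_sq]
        have h1 : z.im * (w i).im ≤ δ i * z.im ^ 2 := by
          calc z.im * (w i).im ≤ |z.im * (w i).im| := le_abs_self _
            _ = |z.im| * |(w i).im| := abs_mul _ _
            _ ≤ |z.im| * (δ i * |z.im|) := by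
              gcongr
              exact (hw i hi).2
            _ = δ i * z.im ^ 2 := by rw [← sq_abs z.im]; ring
        have h2 := mul_le_mul_of_nonneg_right h1 (sq_nonneg ‖s i‖)
        linarith
      · have h3 : starRingEnd ℂ (θ i) * s i =
            ((1 / (2 * Real.pi) : ℝ) * (m i * (z * z) + D i * z) + τ i) *
              (Complex.normSq (θ i) : ℂ) := by
          rw [Complex.normSq_eq_conj_mul_self, hfree i hi]
          push_cast
          ring
        rw [h3, hx2 i hi, hy2 i hi, Complex.im_mul_ofReal, Complex.add_im, Complex.im_ofReal_mul,
          Complex.ofReal_im, Complex.add_im, Complex.im_ofReal_mul, Complex.im_ofReal_mul,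
          Complex.mul_im, Complex.normSq_eq_norm_sq]
        -- The inertia term has the good sign for Re z ≥ 0 and is dropped.
        have h4 : 0 ≤ z.im ^ 2 * (1 / (2 * Real.pi) * (2 * m i * z.re)) * ‖θ i‖ ^ 2 := by
          have := (hm i hi).le
          positivity
        have h5 : D i / (2 * Real.pi) = 1 / (2 * Real.pi) * D i := by ring
        rw [h5]
        linarith
    have h6 := Finset.sum_le_sum fun i (_ : i ∈ Finset.univ) => hterm i
    rw [← Finset.mul_sum, ← Finset.mul_sum, hsum, mul_zero, Finset.sum_sub_distrib] at h6
    have h7 : 0 < z.im ^ 2 := by positivity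
    have h8 := nonpos_of_mul_nonpos_right h6 h7
    linarith
  -- the gain of the controlled buses
  have hgain : ∑ i, x i ≤ 1 / 16 * ∑ i, τ i * ‖θ i‖ ^ 2 := by
    have h1 : ∀ i, x i ≤ 1 / 16 * ∑ j, a i j * ‖θ j‖ ^ 2 := by
      intro i
      have h2 : 0 ≤ ∑ j, a i j * ‖θ j‖ ^ 2 :=
        Finset.sum_nonneg fun j _ => mul_nonneg (ha i j) (sq_nonneg _)
      by_cases hi : ctrl i
      · have h3 := norm_sum_sq_le (ha i) θ
        rw [← hs, ← hτ] at h3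
        rw [hx1 i hi]
        calc δ i * ‖s i‖ ^ 2 ≤ δ i * (τ i * ∑ j, a i j * ‖θ j‖ ^ 2) :=
              mul_le_mul_of_nonneg_left h3 (hδ0 i).le
          _ = δ i * τ i * ∑ j, a i j * ‖θ j‖ ^ 2 := by ring
          _ ≤ _ := mul_le_mul_of_nonneg_right (hδτ i) h2
      · rw [hx2 i hi]
        positivity
    refine (Finset.sum_le_sum fun i _ => h1 i).trans (le_of_eq ?_)
    rw [← Finset.mul_sum, Finset.sum_comm]
    congr 1
    refine Finset.sum_congr rfl fun j _ => ?_
    rw [hτ, Finset.sum_mul]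
    exact Finset.sum_congr rfl fun i _ => by rw [hsymm]
  have hsplit : ∑ i, τ i * ‖θ i‖ ^ 2 ≤ ∑ i, τ i * y i + 1 / 16 * ∑ i, x i := by
    rw [Finset.mul_sum, ← Finset.sum_add_distrib]
    refine Finset.sum_le_sum fun i _ => ?_
    by_cases hi : ctrl i
    · have h1 : ‖θ i‖ ≤ δ i * ‖s i‖ := by
        rw [hctrl i hi, norm_mul]
        exact mul_le_mul_of_nonneg_right (hw i hi).1 (norm_nonneg _)
      rw [hx1 i hi, hy1 i hi, mul_zero, zero_add]
      calc τ i * ‖θ i‖ ^ 2 ≤ τ i * (δ i * ‖s i‖) ^ 2 := by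
            have := hτ0 i
            gcongr
        _ = δ i * τ i * (δ i * ‖s i‖ ^ 2) := by ring
        _ ≤ 1 / 16 * (δ i * ‖s i‖ ^ 2) :=
            mul_le_mul_of_nonneg_right (hδτ i) (mul_nonneg (hδ0 i).le (sq_nonneg _))
    · rw [hx2 i hi, hy2 i hi]
      simp
  have hY0 : 0 ≤ ∑ i, τ i * y i := Finset.sum_nonneg fun i _ => by
    refine mul_nonneg (hτ0 i) ?_
    by_cases hi : ctrl i
    · rw [hy1 i hi]
    · rw [hy2 i hi]
      positivity
  -- With X = ∑ x and Y = ∑ τ y, the bounds combine to X ≤ (Y + X/16)/16, so X ≤ 16/255 · Y ≤ Y/15.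
  -- It remains to compare 1/15 with 1/(2π).
  have hcoef : ∀ i, ¬ ctrl i → 0 < D i / (2 * Real.pi) - 1 / 15 * τ i := by
    intro i hi
    have h1 : τ i / (2 * Real.pi) < D i / (2 * Real.pi) := by
      have := hD i hi
      gcongr
    have h2 : 1 / 15 * τ i ≤ τ i / (2 * Real.pi) := by
      rw [div_eq_mul_one_div (τ i), mul_comm (1 / 15)]
      refine mul_le_mul_of_nonneg_left ?_ (hτ0 i)
      apply one_div_le_one_div_of_le (by positivity)
      linarith [Real.pi_lt_four]
    linarith
  have hnonneg : ∀ i, 0 ≤ (D i / (2 * Real.pi) - 1 / 15 * τ i) * y i := by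
    intro i
    by_cases hi : ctrl i
    · rw [hy1 i hi, mul_zero]
    · rw [hy2 i hi]
      exact mul_nonneg (hcoef i hi).le (sq_nonneg _)
  have hfree0 : ∀ i, ¬ ctrl i → θ i = 0 := by
    have h1 : ∑ i, (D i / (2 * Real.pi) - 1 / 15 * τ i) * y i ≤ 0 := by
      simp only [sub_mul, Finset.sum_sub_distrib, mul_assoc, ← Finset.mul_sum]
      linarith
    intro i hi
    have h2 := (Finset.sum_eq_zero_iff_of_nonneg fun i _ => hnonneg i).mp
      (le_antisymm h1 (Finset.sum_nonneg fun i _ => hnonneg i)) i (Finset.mem_univ i)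
    rw [hy2 i hi] at h2
    simpa using (mul_eq_zero.mp h2).resolve_left (hcoef i hi).ne'
  have hX0 : ∑ i, x i ≤ 0 := by
    have h1 : ∑ i, τ i * y i = 0 := Finset.sum_eq_zero fun i _ => by
      by_cases hi : ctrl i
      · rw [hy1 i hi, mul_zero]
      · simp [hy2 i hi, hfree0 i hi]
    linarith
  ext i
  by_cases hi : ctrl i
  · have h2 := (Finset.sum_eq_zero_iff_of_nonneg fun i _ => hx0 i).mp
      (le_antisymm hX0 (Finset.sum_nonneg fun i _ => hx0 i)) i (Finset.mem_univ i)
    rw [hx1 i hi] at h2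
    have h3 : s i = 0 := by simpa using (mul_eq_zero.mp h2).resolve_left (hδ0 i).ne'
    rw [hctrl i hi, h3, mul_zero]
    rfl
  · exact hfree0 i hi

/-- A maximum principle. At a controlled bus |θ_i| is at most 1/16 of the maximum. At an
uncontrolled bus the factor relating s_i to θ_i is real and at least τ_i, so a maximum there forces
all neighbours to be maximal. Reachability is essential: a component of uncontrolled buses alone
admits constant θ at z = 0. -/
lemma interconnection_eq_zero_of_im_eq_zero (ha : ∀ i j, 0 ≤ a i j) (hτ : ∀ i, τ i = ∑ j, a i j)
    (hs : ∀ i, s i = ∑ j, (a i j : ℂ) * θ j) (hz : 0 ≤ z.re) (hω : z.im = 0)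
    (hw : ∀ i, ctrl i → Tame z.im (gainBound (τ i)) (w i)) (hctrl : ∀ i, ctrl i → θ i = w i * s i)
    (hm : ∀ i, ¬ ctrl i → 0 < m i) (hD : ∀ i, ¬ ctrl i → τ i < D i)
    (hfree : ∀ i, ¬ ctrl i →
      s i = ((m i * z ^ 2 + D i * z) / (2 * Real.pi) + τ i) * θ i)
    (hreach : ∀ i, ¬ ctrl i → ∃ j, ctrl j ∧ Relation.ReflTransGen (fun i j => 0 < a i j) i j) :
    θ = 0 := by
  have hτ0 : ∀ i, 0 ≤ τ i := fun i => by
    rw [hτ]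
    exact Finset.sum_nonneg fun j _ => ha i j
  by_contra hne
  obtain ⟨i₁, hi₁⟩ := Function.ne_iff.mp hne
  obtain ⟨i₀, -, hmax⟩ := Finset.exists_max_image Finset.univ (fun i => ‖θ i‖)
    ⟨i₁, Finset.mem_univ i₁⟩
  obtain ⟨Y, hY⟩ : ∃ Y, Y = ‖θ i₀‖ := ⟨_, rfl⟩
  have hle : ∀ i, ‖θ i‖ ≤ Y := fun i => hY ▸ hmax i (Finset.mem_univ i)
  have hYpos : 0 < Y := (norm_pos_iff.mpr hi₁).trans_le (hle i₁)
  have hsle : ∀ i, ‖s i‖ ≤ ∑ j, a i j * ‖θ j‖ := fun i => by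
    rw [hs]
    refine (norm_sum_le _ _).trans (Finset.sum_le_sum fun j _ => ?_)
    rw [norm_mul, Complex.norm_real, Real.norm_of_nonneg (ha i j)]
  have hsY : ∀ i, ‖s i‖ ≤ τ i * Y := fun i => by
    refine (hsle i).trans ?_
    rw [hτ, Finset.sum_mul]
    exact Finset.sum_le_sum fun j _ => mul_le_mul_of_nonneg_left (hle j) (ha i j)
  have hnot : ∀ i, ‖θ i‖ = Y → ¬ ctrl i := by
    intro i hi hc
    have h1 : ‖θ i‖ ≤ gainBound (τ i) * (τ i * Y) := by
      rw [hctrl i hc, norm_mul]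
      exact mul_le_mul (hw i hc).1 (hsY i) (norm_nonneg _) (gainBound_pos _).le
    have h2 := gainBound_mul_le (τ := τ i)
    rw [abs_of_nonneg (hτ0 i)] at h2
    have h3 := mul_le_mul_of_nonneg_right h2 hYpos.le
    rw [hi] at h1
    linarith
  have hstep : ∀ i j, ‖θ i‖ = Y → 0 < a i j → ‖θ j‖ = Y := by
    intro i j hi hij
    have hc := hnot i hi
    have h1 : τ i * Y ≤ ‖s i‖ := by
      have hzr : z = (z.re : ℂ) := Complex.ext rfl (by simp [hω])
      have h2 : ((m i * z ^ 2 + D i * z) / (2 * Real.pi) + τ i : ℂ) =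
          (((m i * z.re ^ 2 + D i * z.re) / (2 * Real.pi) + τ i : ℝ) : ℂ) := by
        rw [hzr]
        push_cast
        rfl
      have h3 : 0 ≤ (m i * z.re ^ 2 + D i * z.re) / (2 * Real.pi) := by
        have := (hm i hc).le
        have := ((hτ0 i).trans_lt (hD i hc)).le
        positivity
      rw [hfree i hc, h2, norm_mul, Complex.norm_real,
        Real.norm_of_nonneg (add_nonneg h3 (hτ0 i)), hi]
      exact mul_le_mul_of_nonneg_right (le_add_of_nonneg_left h3) hYpos.le
    have h4 : ∑ k, a i k * (Y - ‖θ k‖) ≤ 0 := by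
      simp only [mul_sub, Finset.sum_sub_distrib, ← Finset.sum_mul, ← hτ]
      linarith [hsle i]
    have h5 : ∀ k ∈ Finset.univ, 0 ≤ a i k * (Y - ‖θ k‖) := fun k _ =>
      mul_nonneg (ha i k) (sub_nonneg.mpr (hle k))
    have h6 := (Finset.sum_eq_zero_iff_of_nonneg h5).mp
      (le_antisymm h4 (Finset.sum_nonneg h5)) j (Finset.mem_univ j)
    have := (mul_eq_zero.mp h6).resolve_left hij.ne'
    linarith
  obtain ⟨j, hj, hpath⟩ := hreach i₀ (hnot i₀ hY.symm)
  refine hnot j ?_ hj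
  clear hj
  induction hpath with
  | refl => exact hY.symm
  | tail _ hbc ih => exact hstep _ _ ih hbc

end Interconnection

/-! ### Stability of good designs -/

section Stability

variable {G L Z : Type} {ℓL ℓM : ℕ}

open Classical in
/-- The stiffness of a line, extended by zero to pairs that are not neighbours. -/
def Network.weight (net : Network G L Z ℓL ℓM) (i j : G ⊕ L ⊕ Z) : ℝ :=
  if net.graph.Adj i j then net.t i j else 0

lemma Network.weight_pos (net : Network G L Z ℓL ℓM) {i j : G ⊕ L ⊕ Z} (h : net.graph.Adj i j) :
    0 < net.weight i j := by
  rw [Network.weight, if_pos h]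
  exact net.t_pos i j h

lemma Network.weight_nonneg (net : Network G L Z ℓL ℓM) (i j : G ⊕ L ⊕ Z) :
    0 ≤ net.weight i j := by
  by_cases h : net.graph.Adj i j
  · exact (net.weight_pos h).le
  · rw [Network.weight, if_neg h]

lemma Network.weight_symm (net : Network G L Z ℓL ℓM) (i j : G ⊕ L ⊕ Z) :
    net.weight i j = net.weight j i := by
  by_cases h : net.graph.Adj i j
  · rw [Network.weight, Network.weight, if_pos h, if_pos h.symm, net.t_symm]
  · rw [Network.weight, Network.weight, if_neg h, if_neg fun h' => h h'.symm]

variable [Fintype G] [Fintype L] [Fintype Z]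

lemma Network.tSum_eq (net : Network G L Z ℓL ℓM) (i : G ⊕ L ⊕ Z) :
    net.tSum i = ∑ j, net.weight i j := by
  rw [Network.tSum, Finset.sum_filter]
  rfl

lemma Network.inflow_eq (net : Network G L Z ℓL ℓM) (θ : G ⊕ L ⊕ Z → ℝ) (i : G ⊕ L ⊕ Z) :
    net.inflow θ i = ∑ j, net.weight i j * θ j := by
  rw [Network.inflow, Finset.sum_filter]
  refine Finset.sum_congr rfl fun j _ => ?_
  rw [Network.weight, ite_mul, zero_mul]

/-- If all controlled buses have good designs, then the closed loop is stable. -/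
lemma isHurwitz_of_good (net : Network G L Z ℓL ℓM) (d : Design G L ℓL ℓM)
    (hG : ∀ g, GenDesign.Good (net.gen g) (net.tSum (.inl g)) (d.gen g))
    (hL : ∀ l, LoadDesign.Good (net.load l) (net.tSum (.inr (.inl l))) (d.load l))
    (hD : ∀ b : Z, net.tSum (.inr (.inr b)) < (net.zero b).D)
    (hreach : ∀ b : Z, (∃ g : G, net.graph.Reachable (.inr (.inr b)) (.inl g)) ∨
      (∃ l : L, net.graph.Reachable (.inr (.inr b)) (.inr (.inl l)))) :
    IsHurwitz (closedLoop net d) := by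
  intro z v hv hev
  by_contra hre
  push Not at hre
  -- The vector field is real, so it is applied to the real and imaginary parts of the eigenvector
  -- separately.
  obtain ⟨x, hx⟩ : ∃ x : Idx G L Z ℓL ℓM → ℝ, ∀ a, x a = (v a).re := ⟨_, fun _ => rfl⟩
  obtain ⟨y, hy⟩ : ∃ y : Idx G L Z ℓL ℓM → ℝ, ∀ a, y a = (v a).im := ⟨_, fun _ => rfl⟩
  have hcomp : ∀ a, (hatRhs net d x a : ℂ) + hatRhs net d y a * Complex.I = z * v a := by
    intro a
    have h1 := dotProduct_re_add_im (closedLoop net d a) v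
    simp only [← hx, ← hy] at h1
    rw [← closedLoop_mulVec, ← closedLoop_mulVec]
    refine h1.trans ?_
    have h2 := congrFun hev a
    simpa [Matrix.mulVec, dotProduct] using h2
  obtain ⟨θ, hθ⟩ : ∃ θ : G ⊕ L ⊕ Z → ℂ, θ = Sum.elim (fun g => v (.inl (g, .inl 0)))
      (Sum.elim (fun l => v (.inr (.inl (l, .inl 0)))) (fun b => v (.inr (.inr (b, 0))))) :=
    ⟨_, rfl⟩
  have hθre : ∀ i, (θ i).re = angle x i := by
    rintro (g | l | b) <;> rw [hθ] <;> exact (hx _).symm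
  have hθim : ∀ i, (θ i).im = angle y i := by
    rintro (g | l | b) <;> rw [hθ] <;> exact (hy _).symm
  obtain ⟨s, hs⟩ : ∃ s : G ⊕ L ⊕ Z → ℂ, ∀ i, s i = ∑ j, (net.weight i j : ℂ) * θ j :=
    ⟨_, fun _ => rfl⟩
  have hsre : ∀ i, (s i).re = net.inflow (angle x) i := by
    intro i
    rw [hs, Complex.re_sum, net.inflow_eq]
    exact Finset.sum_congr rfl fun j _ => by rw [Complex.re_ofReal_mul, hθre]
  have hsim : ∀ i, (s i).im = net.inflow (angle y) i := by
    intro i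
    rw [hs, Complex.im_sum, net.inflow_eq]
    exact Finset.sum_congr rfl fun j _ => by rw [Complex.im_ofReal_mul, hθim]
  have hgen : ∀ g, GenEigen (net.gen g) (d.gen g) (net.tSum (.inl g)) z (s (.inl g))
      (fun a => v (.inl (g, a))) := by
    intro g a
    simp only [hsre, hsim, ← hx, ← hy]
    exact hcomp (.inl (g, a))
  have hload : ∀ l, LoadEigen (net.load l) (d.load l) (net.tSum (.inr (.inl l))) z
      (s (.inr (.inl l))) (fun a => v (.inr (.inl (l, a)))) := by
    intro l a
    simp only [hsre, hsim, ← hx, ← hy]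
    exact hcomp (.inr (.inl (l, a)))
  have hzero : ∀ b, z * v (.inr (.inr (b, 0))) = 2 * Real.pi * v (.inr (.inr (b, 1))) ∧
      s (.inr (.inr b)) = (((net.zero b).m * z ^ 2 + (net.zero b).D * z) / (2 * Real.pi) +
        net.tSum (.inr (.inr b))) * v (.inr (.inr (b, 0))) := by
    intro b
    have hpi : (Real.pi : ℂ) ≠ 0 := Complex.ofReal_ne_zero.mpr Real.pi_ne_zero
    have hm : ((net.zero b).m : ℂ) ≠ 0 := Complex.ofReal_ne_zero.mpr (net.zero b).m_pos.ne'
    have h0 := hcomp (.inr (.inr (b, 0)))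
    have h1 := hcomp (.inr (.inr (b, 1)))
    have e0 := Complex.re_add_im (v (.inr (.inr (b, 0))))
    have e1 := Complex.re_add_im (v (.inr (.inr (b, 1))))
    have es := Complex.re_add_im (s (.inr (.inr b)))
    simp only [hatRhs, assemble, Sum.elim_inr, zeroHatRhs, zeroPart, Matrix.cons_val, ← hsre,
      ← hsim, hx, hy] at h0 h1
    push_cast at h0 h1
    have f0 : z * v (.inr (.inr (b, 0))) = 2 * Real.pi * v (.inr (.inr (b, 1))) := by
      linear_combination -h0 + 2 * Real.pi * e1
    have f1 : (net.zero b).m * (z * v (.inr (.inr (b, 1)))) =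
        -((net.zero b).D * v (.inr (.inr (b, 1))) +
          net.tSum (.inr (.inr b)) * v (.inr (.inr (b, 0))) - s (.inr (.inr b))) := by
      have hm' : ((net.zero b).m : ℂ) * (1 / (net.zero b).m) = 1 := mul_one_div_cancel hm
      linear_combination -(net.zero b).m * h1 - (net.zero b).m * (1 / (net.zero b).m) *
        ((net.zero b).D * e1 + net.tSum (.inr (.inr b)) * e0 - es) -
        ((net.zero b).D * v (.inr (.inr (b, 1))) +
          net.tSum (.inr (.inr b)) * v (.inr (.inr (b, 0))) - s (.inr (.inr b))) * hm'
    refine ⟨f0, ?_⟩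
    have f2 : v (.inr (.inr (b, 1))) = z * v (.inr (.inr (b, 0))) / (2 * Real.pi) := by
      rw [f0]
      field_simp
    rw [f2] at f1
    field_simp at f1 ⊢
    linear_combination -f1
  obtain ⟨ctrl, hctrl⟩ : ∃ ctrl : G ⊕ L ⊕ Z → Prop, ∀ i, ctrl i ↔ ∀ b, i ≠ .inr (.inr b) :=
    ⟨_, fun _ => Iff.rfl⟩
  have hnot : ∀ i, ¬ ctrl i → ∃ b, i = .inr (.inr b) := by
    intro i hi
    rw [hctrl] at hi
    push Not at hi
    exact hi
  have hgain : ∀ i, ∃ w, ctrl i → Tame z.im (gainBound (net.tSum i)) w ∧ θ i = w * s i := by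
    rintro (g | l | b)
    · obtain ⟨w, hw⟩ := ((hG g).2 z _ _ hre (hgen g)).1
      exact ⟨w, fun _ => by rw [hθ]; exact hw⟩
    · obtain ⟨w, hw⟩ := ((hL l).2 z _ _ hre (hload l)).1
      exact ⟨w, fun _ => by rw [hθ]; exact hw⟩
    · exact ⟨0, fun h => absurd rfl ((hctrl _).mp h b)⟩
  choose w hw using hgain
  obtain ⟨m, hm⟩ : ∃ m : G ⊕ L ⊕ Z → ℝ, ∀ b, m (.inr (.inr b)) = (net.zero b).m :=
    ⟨Sum.elim 0 (Sum.elim 0 fun b => (net.zero b).m), fun _ => rfl⟩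
  obtain ⟨D, hDdef⟩ : ∃ D : G ⊕ L ⊕ Z → ℝ, ∀ b, D (.inr (.inr b)) = (net.zero b).D :=
    ⟨Sum.elim 0 (Sum.elim 0 fun b => (net.zero b).D), fun _ => rfl⟩
  have hmpos : ∀ i, ¬ ctrl i → 0 < m i := by
    intro i hi
    obtain ⟨b, rfl⟩ := hnot i hi
    rw [hm]
    exact (net.zero b).m_pos
  have hDlt : ∀ i, ¬ ctrl i → net.tSum i < D i := by
    intro i hi
    obtain ⟨b, rfl⟩ := hnot i hi
    rw [hDdef]
    exact hD b
  have hfree : ∀ i, ¬ ctrl i →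
      s i = ((m i * z ^ 2 + D i * z) / (2 * Real.pi) + net.tSum i) * θ i := by
    intro i hi
    obtain ⟨b, rfl⟩ := hnot i hi
    rw [hm, hDdef, hθ]
    exact (hzero b).2
  have hθ0 : θ = 0 := by
    by_cases hω : z.im = 0
    · refine interconnection_eq_zero_of_im_eq_zero net.weight_nonneg net.tSum_eq hs hre hω
        (fun i hi => (hw i hi).1) (fun i hi => (hw i hi).2) hmpos hDlt hfree fun i hi => ?_
      obtain ⟨b, rfl⟩ := hnot i hi
      have hpath : ∀ j, net.graph.Reachable (.inr (.inr b)) j →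
          Relation.ReflTransGen (fun i j => 0 < net.weight i j) (.inr (.inr b)) j := fun j h =>
        Relation.ReflTransGen.mono (fun _ _ h => net.weight_pos h) _ _
          ((SimpleGraph.reachable_iff_reflTransGen _ _).mp h)
      rcases hreach b with ⟨g, h⟩ | ⟨l, h⟩
      · exact ⟨_, (hctrl _).mpr fun b => by simp, hpath _ h⟩
      · exact ⟨_, (hctrl _).mpr fun b => by simp, hpath _ h⟩
    · exact interconnection_eq_zero_of_im_ne_zero net.weight_nonneg net.weight_symm net.tSum_eq hs
        hre hω (fun i hi => (hw i hi).1) (fun i hi => (hw i hi).2) hmpos hDlt hfree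
  -- Without angles there is no inflow, and every bus is left with its isolated eigenvalue equation.
  have hs0 : ∀ i, s i = 0 := fun i => by simp [hs, hθ0]
  apply hv
  ext (⟨g, a⟩ | ⟨l, a⟩ | ⟨b, a⟩)
  · exact congrFun (((hG g).2 z _ _ hre (hgen g)).2 (hs0 _)) a
  · exact congrFun (((hL l).2 z _ _ hre (hload l)).2 (hs0 _)) a
  · have h0 : v (.inr (.inr (b, 0))) = 0 := by
      have := congrFun hθ0 (.inr (.inr b))
      rw [hθ] at this
      exact this
    have h1 : v (.inr (.inr (b, 1))) = 0 := by
      have hpi : (Real.pi : ℂ) ≠ 0 := Complex.ofReal_ne_zero.mpr Real.pi_ne_zero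
      have := (hzero b).1
      rw [h0, mul_zero] at this
      simpa [hpi] using this.symm
    revert a
    rw [Fin.forall_fin_two]
    exact ⟨h0, h1⟩

end Stability

end PowerNet

end

theorem theorem1 (ℓL ℓM : ℕ) :
    (∀ (G L Z : Type) [Fintype G] [Fintype L] [Fintype Z]
        (net : PowerNet.Network G L Z ℓL ℓM) (d : PowerNet.Design G L ℓL ℓM)
        (op : PowerNet.SetPoint G L Z),
        net.Observable → d.Admissible → op.Balanced net →
        -- the Sylvester equations have unique solutions, and these are nonsingular
        ((∀ g, (∃! T, PowerNet.IsSylvester (net.gen g).wind (d.gen g).im T) ∧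
            IsUnit (PowerNet.sylv (net.gen g).wind (d.gen g).im)) ∧
          (∀ l, (∃! T, PowerNet.IsSylvester (net.load l).wind (d.load l).im T) ∧
            IsUnit (PowerNet.sylv (net.load l).wind (d.load l).im))) ∧
        -- the transformed closed loop is the linear system with matrix `A`
        (∀ σ : PowerNet.Signals G L ℓL ℓM, σ.Admissible net →
          ∀ (t₀ : ℝ) (x : ℝ → PowerNet.Idx G L Z ℓL ℓM → ℝ),
            PowerNet.IsSolution net op d σ t₀ x → ∀ t, t₀ ≤ t →
              HasDerivWithinAt (fun s => PowerNet.hat net op d σ s (x s))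
                ((PowerNet.closedLoop net d).mulVec (PowerNet.hat net op d σ t (x t)))
                (Set.Ici t₀) t) ∧
        -- global exponential convergence, uniformly in the exogenous signals, iff `A` is Hurwitz
        ((∃ C α : ℝ, 0 < C ∧ 0 < α ∧ ∀ σ : PowerNet.Signals G L ℓL ℓM, σ.Admissible net →
            PowerNet.ExpConv net op d σ C α) ↔
          PowerNet.IsHurwitz (PowerNet.closedLoop net d)) ∧
        -- the same for each choice of the exogenous signals
        (∀ σ : PowerNet.Signals G L ℓL ℓM, σ.Admissible net →
          ((∃ C α : ℝ, 0 < C ∧ 0 < α ∧ PowerNet.ExpConv net op d σ C α) ↔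
            PowerNet.IsHurwitz (PowerNet.closedLoop net d)))) ∧
    -- stabilizing designs exist, and can be found from local information only
    (∃ (ruleG : PowerNet.GenParams ℓL ℓM → ℝ → PowerNet.GenDesign ℓL ℓM)
        (ruleL : PowerNet.LoadParams ℓL ℓM → ℝ → PowerNet.LoadDesign ℓL ℓM),
      ∀ (G L Z : Type) [Fintype G] [Fintype L] [Fintype Z]
        (net : PowerNet.Network G L Z ℓL ℓM),
        net.Observable →
        (∀ z : Z, net.tSum (.inr (.inr z)) < (net.zero z).D) →
        (∀ z : Z, (∃ g : G, net.graph.Reachable (.inr (.inr z)) (.inl g)) ∨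
          (∃ l : L, net.graph.Reachable (.inr (.inr z)) (.inr (.inl l)))) →
        (net.localDesign ruleG ruleL).Admissible ∧
          PowerNet.IsHurwitz (PowerNet.closedLoop net (net.localDesign ruleG ruleL))) := by
  refine ⟨?_, ?_⟩
  · intro G L Z _ _ _ net d op hO hd hop
    have hG : ∀ g, IsUnit (PowerNet.sylv (net.gen g).wind (d.gen g).im) := fun g =>
      PowerNet.isUnit_sylv _ _ (hO.1 g) (hd.1 g).2.1 (hd.1 g).2.2
    have hL : ∀ l, IsUnit (PowerNet.sylv (net.load l).wind (d.load l).im) := fun l =>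
      PowerNet.isUnit_sylv _ _ (hO.2 l) (hd.2 l).2.1 (hd.2 l).2.2
    have hR : PowerNet.Regular net d :=
      ⟨fun g => ⟨(hd.1 g).2.1, hG g⟩, fun l => ⟨(hd.2 l).2.1, hL l⟩⟩
    refine ⟨⟨fun g => ⟨PowerNet.exists_unique_sylvester _ _ (hd.1 g).2.1, hG g⟩,
      fun l => ⟨PowerNet.exists_unique_sylvester _ _ (hd.2 l).2.1, hL l⟩⟩,
      fun σ hσ t₀ x hx t ht => PowerNet.hasDerivWithinAt_hat hR hop hσ hx t ht, ⟨?_, ?_⟩, ?_⟩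
    · rintro ⟨C, α, -, hα, h⟩
      obtain ⟨σ, hσ⟩ := PowerNet.exists_admissible_signals net
      exact PowerNet.isHurwitz_of_expConv hR hop hσ hα (h σ hσ)
    · exact PowerNet.exists_expConv hR hop
    · intro σ hσ
      constructor
      · rintro ⟨C, α, -, hα, h⟩
        exact PowerNet.isHurwitz_of_expConv hR hop hσ hα h
      · intro hA
        obtain ⟨C, α, hC, hα, h⟩ := PowerNet.exists_expConv hR hop hA
        exact ⟨C, α, hC, hα, h σ hσ⟩
  -- `Good` refers only to the local parameters and τ, so a choice function for it is a local rule.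
  · choose ruleG hruleG using PowerNet.exists_gen_good (ℓL := ℓL) (ℓM := ℓM)
    choose ruleL hruleL using PowerNet.exists_load_good (ℓL := ℓL) (ℓM := ℓM)
    refine ⟨ruleG, ruleL, fun G L Z _ _ _ net _ hD hreach => ⟨⟨fun g => ?_, fun l => ?_⟩, ?_⟩⟩
    · exact (hruleG _ _).1
    · exact (hruleL _ _).1
    · exact PowerNet.isHurwitz_of_good net _ (fun g => hruleG _ _) (fun l => hruleL _ _) hD hreach
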